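/- **Setting.** Let $(M,\omega)$ be a symplectic manifold and $J$ an almost complex structure such that $g=\omega(\cdot,J\cdot)$ is a Riemannian metric, with Levi-Civita connection $\nabla$ and norm $\|\cdot\|$. Write $v=v^{1,0}+v^{0,1}$ for the decomposition of (complexified) tangent vectors with respect to $TM\otimes\mathbb C=T^{1,0}M\oplus T^{0,1}M$, write $(\cdot,\cdot)$ for the Hermitian extension of $g$ to $TM\otimes\mathbb C$, complex linear in the first and antilinear in the second entry, and let $\nabla^{T^{1,0}M}$ be the connection on $T^{1,0}M$ obtained by projecting $\nabla$. Let $L\to M$ be a Hermitian line bundle with a Hermitian connection $\nabla^L$ such that $\frac{\sqrt{-1}}{2\pi}(\nabla^L)^2=\omega$, and let $L^p$ be its $p$-th tensor power, $p\ge 1$, with the induced connection. A tangent vector $v$ acts on $\bigwedge^{0,*}T^*M\otimes L^p$ by the Clifford action $c(v)=\sqrt2\,\bigl(-i_{v^{0,1}}+(v^{1,0})^*\wedge\cdot\bigr)$, where $(v^{1,0})^*$ is dual to $v^{1,0}$ under the complex bilinear extension of $g$. The Spin$^c$-Dirac operator $D^{L^p}$ on $\Omega^{0,*}(M;L^p)$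 is $\sum_k c(e_k)\nabla_{e_k}$, for a local orthonormal frame $(e_k)$ of $TM$ and the Clifford connection on $\bigwedge^{0,*}T^*M\otimes L^p$ determined by $\nabla$, the connection on $\det T^{1,0}M$ induced by $\nabla^{T^{1,0}M}$, and $\nabla^L$. Let $G$ be a Lie group, with Lie algebra $\mathfrak g$, acting smoothly on $M$, with a lift of the action to $L$, such that $\omega$, $J$, the metric on $L$ and $\nabla^L$ are preserved. For $X\in\mathfrak g$, let $X^M$ be the vector field $X^M_m=\frac{d}{dt}\big|_{t=0}\exp(tX)m$, and let $L_X$ be the Lie derivative $(L_Xs)(m)=\frac{d}{dt}\big|_{t=0}\exp(-tX)\cdot s(\exp(tX)m)$. Let $\mu:M\to\mathfrak g^*$ be the momentum map, so that $d\mu_X=\omega(X^M,\cdot)$ and $L_Xs=\nabla^L_{X^M}s-2\pi\sqrt{-1}\,\mu_Xs$ for all $X\in\mathfrak g$ and all smooth sections $s$ of $L$, where $\mu_X=\langle\mu,X\rangle$. Let $\{(\cdot,\cdot)_m\}_{m\in M}$ be a smooth metric on the trivial bundle $M\times\mathfrak g^*\to M$ that is $G$-invariant, i.e. $(\mathrm{Ad}^*(g)\xi,\mathrm{Ad}^*(g)\xi')_{gm}=(\xi,\xi')_m$.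 Put $\mathcal H(m)=\|\mu(m)\|_m^2$, let $d_1\mathcal H$ be the one-form whose value at $m$ is the derivative at $m$ of $m'\mapsto\|\mu(m')\|_m^2$, and define the vector field $X_1^{\mathcal H}$ by $\omega(X_1^{\mathcal H},\cdot)=d_1\mathcal H$. For $t\in\mathbb R$ the deformed Dirac operator is $$D^{L^p}_t=D^{L^p}+\tfrac{\sqrt{-1}\,t}{2}\,c(X_1^{\mathcal H}).$$ Let $h_1,\dots,h_{d}$ be a smooth global orthonormal frame of $M\times\mathfrak g^*$ and write $\mu=\sum_j\mu_jh_j$. Let $h_j^*:M\to\mathfrak g$ be the map with $\langle\xi,h_j^*(m)\rangle=(h_j(m),\xi)_m$ for all $\xi\in\mathfrak g^*$, let $V_j$ be the vector field $V_j(m)=h_j^*(m)^M_m$, and put $(L_{h_j^*}s)(m)=(L_{h_j^*(m)}s)(m)$. Let $\langle\mu,Th_j^*\rangle$ be the one-form $v\mapsto\langle\mu(m),T_mh_j^*(v)\rangle$ ($v\in T_mM$), and $\langle\mu,Th_j^*\rangle^*$ the vector field dual to it with respect to $g$. For a vector field $v$, put $[v,(h_j^*)^M-V_j](m)=[v,h_j^*(m)^M-V_j](m)$,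 where $h_j^*(m)^M$ is the vector field induced by the fixed element $h_j^*(m)\in\mathfrak g$; this is extended complex linearly in $v$. **Theorem.** For every $p\ge 1$ there are smooth vector bundle endomorphisms $A_1,A_2,A_3$ of $\bigwedge^{0,*}T^*M\otimes L^p$, not depending on $t$, which in every local orthonormal frame $(e_k)$ of $TM$ are given by $$A_1=\tfrac{\sqrt{-1}}4\sum_kc(e_k)c(\nabla_{e_k}X_1^{\mathcal H})-\tfrac{\sqrt{-1}}2\operatorname{tr}\bigl(\nabla^{T^{1,0}M}(X_1^{\mathcal H})^{1,0}\big|_{T^{1,0}M}\bigr)+\tfrac12\sum_j\bigl(\sqrt{-1}\,c(JV_j)c(V_j)+\|V_j\|^2\bigr),$$ where the trace is that of the endomorphism $w\mapsto\nabla^{T^{1,0}M}_w(X_1^{\mathcal H})^{1,0}$ of $T^{1,0}M$, $$A_2=\tfrac{\sqrt{-1}}2\sum_jc(\langle\mu,Th_j^*\rangle^*)c(V_j)+\sqrt{-1}\sum_{j,k}\bigl\langle\langle\mu,Th_j^*\rangle,e_k^{1,0}\bigr\rangle\bigl(V_j,e_k^{1,0}\bigr),$$ $$A_3=-\tfrac{\sqrt{-1}}2\sum_{j,k}\mu_jc(e_k)c\bigl([e_k,(h_j^*)^M-V_j]\bigr)-\sqrt{-1}\sum_{j,k}\mu_j\bigl([e_k^{1,0},(h_j^*)^M-V_j],e_k^{1,0}\bigr),$$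 such that, with $A=A_1+A_2+A_3$, for every $t\in\mathbb R$ one has, on $\Omega^{0,*}(M;L^p)$, $$\bigl(D^{L^p}_t\bigr)^2=\bigl(D^{L^p}\bigr)^2+tA+4\pi pt\,\mathcal H+\tfrac{t^2}4\|X_1^{\mathcal H}\|^2-2\sqrt{-1}\,t\sum_j\mu_jL_{h_j^*}.$$ On $G$-invariant sections $s\in\Omega^{0,*}(M;L^p)^G$ one has $L_{h_j^*}s=0$ for all $j$, and hence $$\bigl(D^{L^p}_t\bigr)^2s=\bigl(D^{L^p}\bigr)^2s+tAs+4\pi pt\,\mathcal Hs+\tfrac{t^2}4\|X_1^{\mathcal H}\|^2s.$$ -/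

import Mathlib

open Bundle
open scoped Manifold ContDiff TensorProduct

noncomputable section

namespace SpincBochner

/-! ### Linear algebra of a Hermitian vector space `(V, g, J)` -/

section LinearAlgebra

variable {V : Type*} [AddCommGroup V] [Module ℝ V]
variable {W : Type*} [AddCommGroup W] [Module ℂ W]

/-- The vector `v` determined by `b(v, ·) = α`, for a nondegenerate bilinear form `b`. -/
def vecOf (b : V →ₗ[ℝ] V →ₗ[ℝ] ℝ) (α : V →ₗ[ℝ] ℝ) : V :=
  Function.invFun (fun v => b v) α

/-- The projection `(1 - √-1 J)/2` of the complexification of `V` onto its part of type `(1,0)`,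
the eigenspace of `J` for the eigenvalue `√-1`. -/
def proj10 (J : V →ₗ[ℝ] V) : ℂ ⊗[ℝ] V →ₗ[ℂ] ℂ ⊗[ℝ] V :=
  (1 / 2 : ℂ) • (LinearMap.id - Complex.I • J.baseChange ℂ)

/-- The component `v^{1,0}` of a real vector `v`. -/
def vec10 (J : V →ₗ[ℝ] V) (v : V) : ℂ ⊗[ℝ] V := proj10 J (1 ⊗ₜ v)

/-- Complex conjugation on the complexification of `V`. -/
def conjC : ℂ ⊗[ℝ] V →ₗ[ℝ] ℂ ⊗[ℝ] V :=
  LinearMap.rTensor V Complex.conjAe.toLinearMap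

/-- The Hermitian extension of `g` to the complexification of `V`, complex linear in the first
and complex antilinear in the second entry. -/
def herm (g : V →ₗ[ℝ] V →ₗ[ℝ] ℝ) (x y : ℂ ⊗[ℝ] V) : ℂ :=
  LinearMap.BilinForm.baseChange ℂ g x (conjC y)

/-- The complex linear extension of a real covector to the complexification of `V`. -/
def covecC (α : V →ₗ[ℝ] ℝ) : ℂ ⊗[ℝ] V →ₗ[ℂ] ℂ :=
  (Complex.ofRealCLM.toLinearMap ∘ₗ α).liftBaseChange ℂ

/-- Alternating real-multilinear forms of all degrees on `V`, with values in the complex vector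
space `W`: the space `Λ^* V^* ⊗ W`. -/
abbrev Forms (V W : Type*) [AddCommGroup V] [Module ℝ V] [AddCommGroup W] [Module ℂ W] :=
  ∀ q : ℕ, V [⋀^Fin q]→ₗ[ℝ] W

variable (W) in
/-- `Λ^{0,*} V^* ⊗ W`: the forms that are complex antilinear in each entry. -/
def forms01 (J : V →ₗ[ℝ] V) : Submodule ℂ (Forms V W) where
  carrier := {s | ∀ (q : ℕ) (v : Fin q → V) (i : Fin q),
    s q (Function.update v i (J (v i))) = -(Complex.I • s q v)}
  add_mem' := by
    intro a b ha hb q v i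
    simp [ha q v i, hb q v i, add_comm]
  zero_mem' := by
    intro q v i
    simp
  smul_mem' := by
    intro c a ha q v i
    simp [ha q v i, smul_comm c Complex.I]

/-- Contraction by `v`. -/
def contract (v : V) : Module.End ℂ (Forms V W) where
  toFun s q := (s (q + 1)).curryLeft v
  map_add' _ _ := by ext; simp
  map_smul' _ _ := by ext; simp

/-- Exterior multiplication from the left by a complex valued covector:
`(θ ∧ s)(v_0, …, v_q) = ∑_i (-1)^i θ(v_i) s(v_0, …, v_{i-1}, v_{i+1}, …, v_q)`. -/
def wedge (θ : V →ₗ[ℝ] ℂ) : Module.End ℂ (Forms V W) where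
  toFun s q := match q with
    | 0 => 0
    | q + 1 => AlternatingMap.alternatizeUncurryFin (θ.smulRight (s q))
  map_add' a b := by
    funext q
    cases q with
    | zero => simp
    | succ q =>
      ext v
      simp [AlternatingMap.alternatizeUncurryFin_apply, Finset.sum_add_distrib]
  map_smul' c a := by
    funext q
    cases q with
    | zero => simp
    | succ q =>
      ext v
      simp [AlternatingMap.alternatizeUncurryFin_apply, Finset.smul_sum, smul_comm c]

/-- The derivation of the exterior algebra induced by an endomorphism of `V`:
`(Γ · s)(v_1, …, v_q) = ∑_i s(v_1, …, Γ v_i, …, v_q)`. -/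
def derivationAct (Γ : V →ₗ[ℝ] V) : Module.End ℂ (Forms V W) where
  toFun s q := match q with
    | 0 => 0
    | q + 1 => AlternatingMap.alternatizeUncurryFin ((s (q + 1)).curryLeft ∘ₗ Γ)
  map_add' a b := by
    funext q
    cases q with
    | zero => simp
    | succ q =>
      ext v
      simp [AlternatingMap.alternatizeUncurryFin_apply, Finset.sum_add_distrib]
  map_smul' c a := by
    funext q
    cases q with
    | zero => simp
    | succ q =>
      ext v
      simp [AlternatingMap.alternatizeUncurryFin_apply, Finset.smul_sum, smul_comm c]

/-- The covector `(v^{1,0})^*`, that is `w ↦ g(v^{1,0}, w)` with `g` extended complex bilinearly. -/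
def dual10 (g : V →ₗ[ℝ] V →ₗ[ℝ] ℝ) (J : V →ₗ[ℝ] V) (v : V) : V →ₗ[ℝ] ℂ :=
  (LinearMap.BilinForm.baseChange ℂ g (vec10 J v)).restrictScalars ℝ ∘ₗ TensorProduct.mk ℝ ℂ V 1

/-- Contraction by `v^{0,1} = (v + √-1 J v)/2`. -/
def contract01 (J : V →ₗ[ℝ] V) (v : V) : Module.End ℂ (Forms V W) :=
  (1 / 2 : ℂ) • (contract v + Complex.I • contract (J v))

/-- The Clifford action `c(v) = √2 (- i_{v^{0,1}} + (v^{1,0})^* ∧ ·)`. -/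
def clifford (g : V →ₗ[ℝ] V →ₗ[ℝ] ℝ) (J : V →ₗ[ℝ] V) (v : V) : Module.End ℂ (Forms V W) :=
  (Real.sqrt 2 : ℂ) • (wedge (dual10 g J v) - contract01 J v)

end LinearAlgebra

/-- An alternating map on a finite-dimensional normed space is continuous. -/
theorem continuous_alternatingMap {E : Type*} [NormedAddCommGroup E] [NormedSpace ℝ E]
    [FiniteDimensional ℝ E] {q : ℕ} (f : E [⋀^Fin q]→ₗ[ℝ] ℂ) : Continuous f := by
  have h : (f : (Fin q → E) → ℂ) = fun v => ∑ a : Fin q → Fin (Module.finrank ℝ E),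
      (∏ i, (Module.finBasis ℝ E).equivFunL (v i) (a i)) •
        f (fun i => Module.finBasis ℝ E (a i)) := by
    funext v
    have hv : v = fun i => ∑ k, (Module.finBasis ℝ E).equivFunL (v i) k •
        Module.finBasis ℝ E k := by
      funext i
      exact ((Module.finBasis ℝ E).sum_equivFun (v i)).symm
    conv_lhs => rw [hv]
    have h1 := f.toMultilinearMap.map_sum
      (fun i k => (Module.finBasis ℝ E).equivFunL (v i) k • Module.finBasis ℝ E k)
    have h2 : ∀ a : Fin q → Fin (Module.finrank ℝ E),
        f.toMultilinearMap (fun i => (Module.finBasis ℝ E).equivFunL (v i) (a i) •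
          Module.finBasis ℝ E (a i)) = (∏ i, (Module.finBasis ℝ E).equivFunL (v i) (a i)) •
        f.toMultilinearMap (fun i => Module.finBasis ℝ E (a i)) :=
      fun a => f.toMultilinearMap.map_smul_univ _ _
    simp only [h2] at h1
    exact h1
  rw [h]
  fun_prop

/-- The continuous alternating map underlying an alternating map on a finite-dimensional space. -/
def toContinuousAlt {E : Type*} [NormedAddCommGroup E] [NormedSpace ℝ E]
    [FiniteDimensional ℝ E] {q : ℕ} (f : E [⋀^Fin q]→ₗ[ℝ] ℂ) : E [⋀^Fin q]→L[ℝ] ℂ :=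
  { f with cont := continuous_alternatingMap f }

/-! ### Almost Kähler manifolds -/

section Manifolds

variable {E : Type*} [NormedAddCommGroup E] [NormedSpace ℝ E] [FiniteDimensional ℝ E]
  {M : Type*} [TopologicalSpace M] [ChartedSpace E M] [IsManifold 𝓘(ℝ, E) ∞ M]

variable (E) in
/-- A function that assigns a tangent vector to each point (with no smoothness assumed). -/
abbrev VField (M : Type*) [TopologicalSpace M] [ChartedSpace E M] :=
  ∀ m : M, TangentSpace 𝓘(ℝ, E) m

/-- Smoothness of a vector field on a set. -/
def SmoothVFieldOn (X : VField E M) (U : Set M) : Prop :=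
  ContMDiffOn 𝓘(ℝ, E) (𝓘(ℝ, E).prod 𝓘(ℝ, E)) ∞
    (fun m => TotalSpace.mk' E (E := TangentSpace 𝓘(ℝ, E)) m (X m)) U

/-- Differentiability of a vector field at a point. -/
def DiffVFieldAt (X : VField E M) (m : M) : Prop :=
  MDifferentiableAt 𝓘(ℝ, E) (𝓘(ℝ, E).prod 𝓘(ℝ, E))
    (fun m => TotalSpace.mk' E (E := TangentSpace 𝓘(ℝ, E)) m (X m)) m

variable (E M) in
/-- A symplectic form `ω` together with an almost complex structure `J` such that `ω(·, J ·)` is a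
Riemannian metric. (Nondegeneracy of `ω` follows from `pos`.) -/
structure AlmostKahler where
  form : ∀ m : M, TangentSpace 𝓘(ℝ, E) m →L[ℝ] TangentSpace 𝓘(ℝ, E) m →L[ℝ] ℝ
  J : ∀ m : M, TangentSpace 𝓘(ℝ, E) m →L[ℝ] TangentSpace 𝓘(ℝ, E) m
  smooth_form : ContMDiff 𝓘(ℝ, E) (𝓘(ℝ, E).prod 𝓘(ℝ, E →L[ℝ] E →L[ℝ] ℝ)) ∞
    (fun m => TotalSpace.mk' (E →L[ℝ] E →L[ℝ] ℝ)
      (E := fun m : M => TangentSpace 𝓘(ℝ, E) m →L[ℝ] TangentSpace 𝓘(ℝ, E) m →L[ℝ] ℝ) m (form m))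
  smooth_J : ContMDiff 𝓘(ℝ, E) (𝓘(ℝ, E).prod 𝓘(ℝ, E →L[ℝ] E)) ∞
    (fun m => TotalSpace.mk' (E →L[ℝ] E)
      (E := fun m : M => TangentSpace 𝓘(ℝ, E) m →L[ℝ] TangentSpace 𝓘(ℝ, E) m) m (J m))
  alternating : ∀ m v, form m v v = 0
  closed : ∀ (X Y Z : VField E M) (m : M),
    DiffVFieldAt X m → DiffVFieldAt Y m → DiffVFieldAt Z m →
    mvfderiv 𝓘(ℝ, E) (fun x => form x (Y x) (Z x)) m (X m)
      + mvfderiv 𝓘(ℝ, E) (fun x => form x (Z x) (X x)) m (Y m)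
      + mvfderiv 𝓘(ℝ, E) (fun x => form x (X x) (Y x)) m (Z m)
      - form m (VectorField.mlieBracket 𝓘(ℝ, E) X Y m) (Z m)
      - form m (VectorField.mlieBracket 𝓘(ℝ, E) Y Z m) (X m)
      - form m (VectorField.mlieBracket 𝓘(ℝ, E) Z X m) (Y m) = 0
  J_sq : ∀ m v, J m (J m v) = -v
  symm : ∀ m v w, form m v (J m w) = form m w (J m v)
  pos : ∀ m v, v ≠ 0 → 0 < form m v (J m v)

namespace AlmostKahler

variable (K : AlmostKahler E M)

/-- The almost complex structure on the tangent space at `m`. -/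
def Jlin (m : M) : TangentSpace 𝓘(ℝ, E) m →ₗ[ℝ] TangentSpace 𝓘(ℝ, E) m := (K.J m).toLinearMap

/-- The symplectic form on the tangent space at `m`. -/
def formLin (m : M) : TangentSpace 𝓘(ℝ, E) m →ₗ[ℝ] TangentSpace 𝓘(ℝ, E) m →ₗ[ℝ] ℝ :=
  LinearMap.mk₂ ℝ (fun v w => K.form m v w) (by simp) (by simp) (by simp) (by simp)

/-- The Riemannian metric `ω(·, J ·)` on the tangent space at `m`. -/
def metric (m : M) : TangentSpace 𝓘(ℝ, E) m →ₗ[ℝ] TangentSpace 𝓘(ℝ, E) m →ₗ[ℝ] ℝ :=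
  LinearMap.mk₂ ℝ (fun v w => K.form m v (K.J m w)) (by simp) (by simp) (by simp) (by simp)

/-- `∇` is the Levi-Civita connection of the metric `ω(·, J ·)`: the torsion-free, metric
connection. (In Mathlib, `∇ Y m v` stands for `∇_v Y` at `m`.) -/
structure IsLeviCivita
    (nabla : CovariantDerivative 𝓘(ℝ, E) E (TangentSpace 𝓘(ℝ, E) : M → Type _)) : Prop where
  smooth : CovariantDerivative.ContMDiffCovariantDerivative nabla ∞
  torsion_free : ∀ (X Y : VField E M) (m : M), DiffVFieldAt X m → DiffVFieldAt Y m →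
    nabla Y m (X m) - nabla X m (Y m) = VectorField.mlieBracket 𝓘(ℝ, E) X Y m
  metric_compat : ∀ (Y Z : VField E M) (m : M) (v : TangentSpace 𝓘(ℝ, E) m),
    DiffVFieldAt Y m → DiffVFieldAt Z m →
    mvfderiv 𝓘(ℝ, E) (fun x => K.metric x (Y x) (Z x)) m v
      = K.metric m (nabla Y m v) (Z m) + K.metric m (Y m) (nabla Z m v)

/-- A local orthonormal frame of `TM` on `U`. -/
structure IsOrthonormalFrameOn (e : Fin (Module.finrank ℝ E) → VField E M) (U : Set M) : Prop where
  smooth : ∀ k, SmoothVFieldOn (e k) U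
  orthonormal : ∀ m ∈ U, ∀ k l, K.metric m (e k m) (e l m) = if k = l then 1 else 0

end AlmostKahler

end Manifolds

/-! ### Prequantum line bundles and group actions -/

section LineBundle

variable {E : Type*} [NormedAddCommGroup E] [NormedSpace ℝ E] [FiniteDimensional ℝ E]
  {M : Type*} [TopologicalSpace M] [ChartedSpace E M] [IsManifold 𝓘(ℝ, E) ∞ M]
  {L : M → Type*} [TopologicalSpace (TotalSpace ℂ L)]
  [∀ m, NormedAddCommGroup (L m)] [∀ m, InnerProductSpace ℂ (L m)]
  [FiberBundle ℂ L] [VectorBundle ℂ ℂ L] [VectorBundle ℝ ℂ L]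

variable (E) in
/-- Smoothness of a section of the line bundle. -/
def SmoothSection (s : ∀ m, L m) : Prop :=
  ContMDiff 𝓘(ℝ, E) (𝓘(ℝ, E).prod 𝓘(ℝ, ℂ)) ∞ (fun m => TotalSpace.mk' ℂ m (s m))

/-- `∇^L` is a Hermitian connection on the Hermitian line bundle `L`, and
`√-1/(2π) (∇^L)² = ω`. -/
structure IsPrequantum (K : AlmostKahler E M) (nablaL : CovariantDerivative 𝓘(ℝ, E) ℂ L) :
    Prop where
  smooth_hermitian : ∀ s t : (∀ m, L m), SmoothSection E s → SmoothSection E t →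
    ContMDiff 𝓘(ℝ, E) 𝓘(ℝ, ℂ) ∞ (fun m => inner ℂ (s m) (t m))
  smooth : CovariantDerivative.ContMDiffCovariantDerivative nablaL ∞
  complex_linear : ∀ (s : ∀ m, L m) (m : M) (v : TangentSpace 𝓘(ℝ, E) m),
    SmoothSection E s → nablaL (fun x => Complex.I • s x) m v = Complex.I • nablaL s m v
  metric_compat : ∀ (s t : ∀ m, L m) (m : M) (v : TangentSpace 𝓘(ℝ, E) m),
    SmoothSection E s → SmoothSection E t →
    mvfderiv 𝓘(ℝ, E) (fun x => inner ℂ (s x) (t x)) m v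
      = inner ℂ (nablaL s m v) (t m) + inner ℂ (s m) (nablaL t m v)
  curvature : ∀ (X Y : VField E M) (s : ∀ m, L m) (m : M),
    SmoothVFieldOn X Set.univ → SmoothVFieldOn Y Set.univ → SmoothSection E s →
    (Complex.I / (2 * Real.pi)) •
      (nablaL (fun x => nablaL s x (Y x)) m (X m) - nablaL (fun x => nablaL s x (X x)) m (Y m)
        - nablaL s m (VectorField.mlieBracket 𝓘(ℝ, E) X Y m))
      = (K.form m (X m) (Y m) : ℂ) • s m

variable {EG : Type*} [NormedAddCommGroup EG] [NormedSpace ℝ EG] [FiniteDimensional ℝ EG]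
  {G : Type*} [TopologicalSpace G] [ChartedSpace EG G] [Group G] [LieGroup 𝓘(ℝ, EG) ∞ G]
  [MulAction G M] [ContMDiffSMul 𝓘(ℝ, EG) 𝓘(ℝ, E) ∞ G M]

variable (E) in
/-- The derivative at `m` of the action by `g` on `M`. -/
def dAct (g : G) (m : M) : TangentSpace 𝓘(ℝ, E) m →L[ℝ] TangentSpace 𝓘(ℝ, E) (g • m) :=
  mfderiv 𝓘(ℝ, E) 𝓘(ℝ, E) (fun x : M => g • x) m

variable (EG) in
/-- A family of fibrewise linear isomorphisms `L_m → L_{g m}`, for `g` in `G`, that is a smooth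
action by `G` on `L` covering the action on `M`. The actions by `G` on `M` and `L` preserve
`ω`, `J`, the Hermitian metric on `L` and the connection on `L`. -/
structure IsPrequantumAction (K : AlmostKahler E M)
    (nablaL : CovariantDerivative 𝓘(ℝ, E) ℂ L) (actL : ∀ (g : G) (m : M), L m ≃ₗ[ℂ] L (g • m)) :
    Prop where
  map_one : ∀ (m : M) (l : L m),
    TotalSpace.mk' ℂ ((1 : G) • m) (actL 1 m l) = TotalSpace.mk' ℂ m l
  map_mul : ∀ (g h : G) (m : M) (l : L m),
    TotalSpace.mk' ℂ ((g * h) • m) (actL (g * h) m l)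
      = TotalSpace.mk' ℂ (g • h • m) (actL g (h • m) (actL h m l))
  smooth : ContMDiff (𝓘(ℝ, EG).prod (𝓘(ℝ, E).prod 𝓘(ℝ, ℂ))) (𝓘(ℝ, E).prod 𝓘(ℝ, ℂ)) ∞
    (fun x : G × TotalSpace ℂ L => TotalSpace.mk' ℂ (x.1 • x.2.proj) (actL x.1 x.2.proj x.2.snd))
  invariant_form : ∀ (g : G) (m : M) (v w : TangentSpace 𝓘(ℝ, E) m),
    K.form (g • m) (dAct E g m v) (dAct E g m w) = K.form m v w
  invariant_J : ∀ (g : G) (m : M) (v : TangentSpace 𝓘(ℝ, E) m),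
    K.J (g • m) (dAct E g m v) = dAct E g m (K.J m v)
  invariant_hermitian : ∀ (g : G) (m : M) (l l' : L m),
    inner ℂ (actL g m l) (actL g m l') = inner ℂ l l'
  invariant_nablaL : ∀ (g : G) (s : ∀ m, L m) (m : M) (v : TangentSpace 𝓘(ℝ, E) m),
    SmoothSection E s →
    nablaL (fun x => (actL g x).symm (s (g • x))) m v
      = (actL g m).symm (nablaL s (g • m) (dAct E g m v))

variable (E G) in
/-- The vector field `X^M` on `M` induced by `X ∈ 𝔤`: its value at `m` is the derivative at the
identity element of `g ↦ g m` in the direction `X`, that is, of `t ↦ exp(tX) m` at `t = 0`.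
The Lie algebra `𝔤 = T_1 G` is the model space `EG` of `G`. -/
def fundVF (X : EG) : VField E M := fun m =>
  (mfderiv 𝓘(ℝ, EG) 𝓘(ℝ, E) (fun g : G => g • m) 1 X : E)

/-- The Lie derivative of a section of `L` with respect to `X ∈ 𝔤`: the derivative at `t = 0` of
`exp(-tX) · s(exp(tX) m)`. -/
def lieDerivL (actL : ∀ (g : G) (m : M), L m ≃ₗ[ℂ] L (g • m)) (X : EG) (s : ∀ m, L m) (m : M) :
    L m :=
  mvfderiv 𝓘(ℝ, EG) (fun g : G => (actL g m).symm (s (g • m))) 1 X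

/-- `μ` is the momentum map: `dμ_X = ω(X^M, ·)`, and the Kostant formula holds. -/
structure IsMomentumMap (K : AlmostKahler E M) (nablaL : CovariantDerivative 𝓘(ℝ, E) ℂ L)
    (actL : ∀ (g : G) (m : M), L m ≃ₗ[ℂ] L (g • m)) (μ : M → (EG →L[ℝ] ℝ)) : Prop where
  smooth : ContMDiff 𝓘(ℝ, E) 𝓘(ℝ, EG →L[ℝ] ℝ) ∞ μ
  deriv_eq : ∀ (X : EG) (m : M) (v : TangentSpace 𝓘(ℝ, E) m),
    mvfderiv 𝓘(ℝ, E) (fun x => μ x X) m v = K.form m (fundVF E G X m) v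
  kostant : ∀ (X : EG) (s : ∀ m, L m) (m : M), SmoothSection E s →
    lieDerivL actL X s m
      = nablaL s m (fundVF E G X m) - (2 * Real.pi * Complex.I * (μ m X : ℂ)) • s m

variable (G) in
/-- The adjoint action by `g` on `𝔤`. -/
def adj (g : G) : EG →L[ℝ] EG := mfderiv 𝓘(ℝ, EG) 𝓘(ℝ, EG) (fun x : G => g * x * g⁻¹) 1

variable (G) in
/-- The coadjoint action by `g` on `𝔤^*`. -/
def coadj (g : G) (ξ : EG →L[ℝ] ℝ) : EG →L[ℝ] ℝ := ξ.comp (adj G g⁻¹)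

variable (E G) in
/-- A `G`-invariant smooth metric on the trivial bundle `M × 𝔤^*`. -/
structure IsInvariantMetric (κ : M → LinearMap.BilinForm ℝ (EG →L[ℝ] ℝ)) : Prop where
  smooth : ∀ ξ η, ContMDiff 𝓘(ℝ, E) 𝓘(ℝ, ℝ) ∞ (fun m => κ m ξ η)
  symm : ∀ m ξ η, κ m ξ η = κ m η ξ
  pos : ∀ m ξ, ξ ≠ 0 → 0 < κ m ξ ξ
  invariant : ∀ (g : G) (m : M) (ξ η), κ (g • m) (coadj G g ξ) (coadj G g η) = κ m ξ η

variable (E) in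
/-- A smooth global orthonormal frame of the bundle `M × 𝔤^*`. -/
structure IsOrthonormalFrame {ι : Type*} [DecidableEq ι]
    (κ : M → LinearMap.BilinForm ℝ (EG →L[ℝ] ℝ)) (h : ι → M → (EG →L[ℝ] ℝ)) : Prop where
  smooth : ∀ j, ContMDiff 𝓘(ℝ, E) 𝓘(ℝ, EG →L[ℝ] ℝ) ∞ (h j)
  orthonormal : ∀ m i j, κ m (h i m) (h j m) = if i = j then 1 else 0
  span : ∀ m, Submodule.span ℝ (Set.range fun j => h j m) = ⊤

/-- The map `f^* : M → 𝔤` dual to `f : M → 𝔤^*`, determined by `(f(m), ξ)_m = ⟨ξ, f^*(m)⟩`. -/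
def dualMap (κ : M → LinearMap.BilinForm ℝ (EG →L[ℝ] ℝ)) (f : M → (EG →L[ℝ] ℝ)) (m : M) :
    EG :=
  Function.invFun (fun (X : EG) (ξ : EG →L[ℝ] ℝ) => ξ X) (fun ξ => κ m (f m) ξ)

variable (E G) in
/-- The vector field `V_f`, with `V_f(m) = f^*(m)^M_m`. -/
def inducedVF (κ : M → LinearMap.BilinForm ℝ (EG →L[ℝ] ℝ)) (f : M → (EG →L[ℝ] ℝ)) :
    VField E M := fun m => fundVF E G (dualMap κ f m) m

/-- The function `H(m) = ‖μ(m)‖_m²`. -/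
def normSqMu (κ : M → LinearMap.BilinForm ℝ (EG →L[ℝ] ℝ)) (μ : M → (EG →L[ℝ] ℝ)) (m : M) :
    ℝ := κ m (μ m) (μ m)

/-- The one-form `d_1 H`, the derivative at `m` of `m' ↦ ‖μ(m')‖_m²`. -/
def d1 (κ : M → LinearMap.BilinForm ℝ (EG →L[ℝ] ℝ)) (μ : M → (EG →L[ℝ] ℝ)) (m : M) :
    TangentSpace 𝓘(ℝ, E) m →ₗ[ℝ] ℝ :=
  (mvfderiv 𝓘(ℝ, E) (fun m' => κ m (μ m') (μ m')) m).toLinearMap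

/-- The vector field `X_1^H`, determined by `d_1 H = ω(X_1^H, ·)`. -/
def X1 (K : AlmostKahler E M) (κ : M → LinearMap.BilinForm ℝ (EG →L[ℝ] ℝ))
    (μ : M → (EG →L[ℝ] ℝ)) : VField E M := fun m => vecOf (K.formLin m) (d1 κ μ m)

end LineBundle

/-! ### The spin-c Dirac operator on `Ω^{0,*}(M; L^p)` -/

section Dirac

variable {E : Type*} [NormedAddCommGroup E] [NormedSpace ℝ E] [FiniteDimensional ℝ E]
  {M : Type*} [TopologicalSpace M] [ChartedSpace E M] [IsManifold 𝓘(ℝ, E) ∞ M]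
  {L : M → Type*} [TopologicalSpace (TotalSpace ℂ L)]
  [∀ m, NormedAddCommGroup (L m)] [∀ m, InnerProductSpace ℂ (L m)]
  [FiberBundle ℂ L] [VectorBundle ℂ ℂ L] [VectorBundle ℝ ℂ L]

variable (L) in
/-- The fibre at `m` of the `p`-th tensor power of `L`. -/
abbrev LPow (p : ℕ) (m : M) : Type _ := ⨂[ℂ] (_ : Fin p), L m

variable (E L) in
/-- The fibre at `m` of `Λ^* T^*M ⊗ L^p`. -/
abbrev FormFibre (p : ℕ) (m : M) : Type _ := Forms (TangentSpace 𝓘(ℝ, E) m) (LPow L p m)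

/-- The fibre at `m` of `Λ^{0,*} T^*M ⊗ L^p`. -/
abbrev SpinorFibre (K : AlmostKahler E M) (L : M → Type*) [∀ m, NormedAddCommGroup (L m)]
    [∀ m, InnerProductSpace ℂ (L m)] (p : ℕ) (m : M) : Submodule ℂ (FormFibre E L p m) :=
  forms01 (LPow L p m) (K.Jlin m)

/-- The local section of `L` near `m` that equals `1` in the trivialization of `L` at `m`. -/
def localFrame (L : M → Type*) [TopologicalSpace (TotalSpace ℂ L)]
    [∀ m, NormedAddCommGroup (L m)] [∀ m, InnerProductSpace ℂ (L m)]
    [FiberBundle ℂ L] [VectorBundle ℂ ℂ L] (m x : M) : L x :=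
  (trivializationAt ℂ L m).symmL ℂ x 1

/-- The coordinate on the fibre of `L^p` at `x`, in the trivialization at `m`: the linear map with
`l_1 ⊗ ⋯ ⊗ l_p ↦ φ(l_1) ⋯ φ(l_p)`, where `φ : L_x → ℂ` is the trivialization of `L` at `m`. -/
def powCoord (L : M → Type*) [TopologicalSpace (TotalSpace ℂ L)]
    [∀ m, NormedAddCommGroup (L m)] [∀ m, InnerProductSpace ℂ (L m)]
    [FiberBundle ℂ L] [VectorBundle ℂ ℂ L] (p : ℕ) (m x : M) : LPow L p x →ₗ[ℂ] ℂ :=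
  PiTensorProduct.lift ((MultilinearMap.mkPiAlgebra ℂ (Fin p) ℂ).compLinearMap
    fun _ => ((trivializationAt ℂ L m).continuousLinearMapAt ℂ x).toLinearMap)

/-- An element of degree `q` of the fibre of `Λ^* T^*M ⊗ L^p` at `x`, in the local trivializations
of `TM` and `L` at `m`. -/
def toModel (p : ℕ) (m x : M) (q : ℕ) (s : TangentSpace 𝓘(ℝ, E) x [⋀^Fin q]→ₗ[ℝ] LPow L p x) :
    E [⋀^Fin q]→L[ℝ] ℂ :=
  toContinuousAlt (((powCoord L p m x).restrictScalars ℝ).compAlternatingMap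
    (s.compLinearMap
      ((trivializationAt E (TangentSpace 𝓘(ℝ, E)) m).symmL ℝ x).toLinearMap))

/-- The inverse of `toModel p m m q`. -/
def fromModel (p : ℕ) (m : M) (q : ℕ) (f : E [⋀^Fin q]→L[ℝ] ℂ) :
    TangentSpace 𝓘(ℝ, E) m [⋀^Fin q]→ₗ[ℝ] LPow L p m :=
  ((LinearMap.toSpanSingleton ℂ (LPow L p m)
      (PiTensorProduct.tprod ℂ fun _ : Fin p => localFrame L m m)).restrictScalars
      ℝ).compAlternatingMap
    (f.toAlternatingMap.compLinearMap
      ((trivializationAt E (TangentSpace 𝓘(ℝ, E)) m).continuousLinearMapAt ℝ m).toLinearMap)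

/-- Smooth sections of `Λ^* T^*M ⊗ L^p`. -/
def SmoothForm (p : ℕ) (s : ∀ m : M, FormFibre E L p m) : Prop :=
  ∀ (q : ℕ) (m : M), ContMDiffAt 𝓘(ℝ, E) 𝓘(ℝ, E [⋀^Fin q]→L[ℝ] ℂ) ∞
    (fun x => toModel p m x q (s x q)) m

/-- The space `Ω^{0,*}(M; L^p)` of smooth sections of `Λ^{0,*} T^*M ⊗ L^p`. -/
def IsSpinor (K : AlmostKahler E M) (p : ℕ) (s : ∀ m : M, FormFibre E L p m) : Prop :=
  SmoothForm p s ∧ ∀ m, s m ∈ SpinorFibre K L p m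

/-- The vector fields that form, in the local trivialization of `TM` at `m`, a fixed basis of the
model space: a local frame of `TM` near `m`. -/
def coordField (m : M) (i : Fin (Module.finrank ℝ E)) : VField E M := fun x =>
  (trivializationAt E (TangentSpace 𝓘(ℝ, E)) m).symmL ℝ x (Module.finBasis ℝ E i)

/-- The basis of the tangent space at `m` given by the values at `m` of the fields
`coordField m i`. -/
def tangentBasis (m : M) :
    Module.Basis (Fin (Module.finrank ℝ E)) ℝ (TangentSpace 𝓘(ℝ, E) m) :=
  (Module.finBasis ℝ E).map
    ((trivializationAt E (TangentSpace 𝓘(ℝ, E)) m).continuousLinearEquivAt ℝ m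
      (FiberBundle.mem_baseSet_trivializationAt' m)).symm.toLinearEquiv

/-- The vectors `b^i` determined by `g(b^i, b_j) = δ_{ij}`, for `b_j` in the basis
`tangentBasis m`. -/
def dualTangentBasis (K : AlmostKahler E M) (m : M) (i : Fin (Module.finrank ℝ E)) :
    TangentSpace 𝓘(ℝ, E) m := vecOf (K.metric m) ((tangentBasis m).coord i)

variable (K : AlmostKahler E M)
  (nabla : CovariantDerivative 𝓘(ℝ, E) E (TangentSpace 𝓘(ℝ, E) : M → Type _))
  (nablaL : CovariantDerivative 𝓘(ℝ, E) ℂ L)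

/-- The Clifford action by a tangent vector. -/
def cl {L : M → Type*} [∀ m, NormedAddCommGroup (L m)] [∀ m, InnerProductSpace ℂ (L m)]
    {p : ℕ} {m : M} (v : TangentSpace 𝓘(ℝ, E) m) : Module.End ℂ (FormFibre E L p m) :=
  clifford (K.metric m) (K.Jlin m) v

/-- The projection `(∇ - J ∇ J)/2` of the Levi-Civita connection to a connection that commutes
with `J`. Under the isomorphism `v ↦ v^{1,0}` from `TM` to `T^{1,0}M`, it corresponds to the
connection `∇^{T^{1,0}M}`. -/
def nablaJ (Y : VField E M) (m : M) (v : TangentSpace 𝓘(ℝ, E) m) : TangentSpace 𝓘(ℝ, E) m :=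
  (1 / 2 : ℝ) • (nabla Y m v - K.J m (nabla (fun x => K.J x (Y x)) m v))

/-- The connection matrix of `nablaJ` in the local frame `coordField m`. -/
def gammaJ (m : M) (v : TangentSpace 𝓘(ℝ, E) m) :
    TangentSpace 𝓘(ℝ, E) m →ₗ[ℝ] TangentSpace 𝓘(ℝ, E) m :=
  (tangentBasis m).constr ℝ fun i => nablaJ K nabla (coordField m i) m v

/-- The connection form of `∇^L` in the frame `localFrame L m`. -/
def thetaL (m : M) (v : TangentSpace 𝓘(ℝ, E) m) : ℂ :=
  (trivializationAt ℂ L m).continuousLinearMapAt ℂ m (nablaL (localFrame L m) m v)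

/-- The connection on `Λ^{0,*} T^*M ⊗ L^p` induced by `∇^{T^{1,0}M}` and `∇^L`, via the Leibniz
rules
`(∇_v s)(Y_1, …, Y_q) = ∇^{L^p}_v (s(Y_1, …, Y_q)) - ∑_i s(Y_1, …, ∇_v Y_i, …, Y_q)` and
`∇^{L^p}_v (f σ^p) = (v(f) + p θ(v) f) σ^p`, for a local section `σ` of `L` such that
`∇^L σ = θ ⊗ σ`. -/
def nablaForms (p : ℕ) (s : ∀ m : M, FormFibre E L p m) (m : M) (v : TangentSpace 𝓘(ℝ, E) m) :
    FormFibre E L p m :=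
  (fun q => fromModel p m q
    (mvfderiv 𝓘(ℝ, E) (fun x => toModel p m x q (s x q)) m v
      + ((p : ℂ) * thetaL nablaL m v) • toModel p m m q (s m q)))
  - derivationAct (gammaJ K nabla m v) (s m)

/-- The spin-c Clifford connection on `Λ^{0,*} T^*M ⊗ L^p`, determined by the Levi-Civita
connection, the connection on `det T^{1,0}M` induced by `∇^{T^{1,0}M}`, and `∇^L`. The
Levi-Civita connection `∇` equals `nablaJ + S` for a one-form `S` with values in skew-symmetric
endomorphisms of `TM` that anticommute with `J`. The connection `nablaForms` is compatible with
`nablaJ` and the Clifford action, and the spin representation maps `S(v)` to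
`(1/4) ∑_k c(e_k) c(S(v) e_k)`, for any orthonormal frame `e_k`. -/
def nablaSpinor (p : ℕ) (s : ∀ m : M, FormFibre E L p m) (m : M) (v : TangentSpace 𝓘(ℝ, E) m) :
    FormFibre E L p m :=
  nablaForms K nabla nablaL p s m v
  + (1 / 4 : ℂ) • ∑ i, cl K (dualTangentBasis K m i)
      (cl K (nabla (coordField m i) m v - nablaJ K nabla (coordField m i) m v) (s m))

/-- The spin-c Dirac operator `D^{L^p} = ∑_k c(e_k) ∇_{e_k}`, for any orthonormal frame `e_k`;
equivalently `∑_i c(b^i) ∇_{b_i}` for any frame `b_i` with dual frame `b^i`. -/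
def dirac (p : ℕ) (s : ∀ m : M, FormFibre E L p m) (m : M) : FormFibre E L p m :=
  ∑ i, cl K (dualTangentBasis K m i) (nablaSpinor K nabla nablaL p s m (tangentBasis m i))

/-- The deformed Dirac operator `D^{L^p} + (√-1 t / 2) c(X)`. -/
def deformedDirac (p : ℕ) (X : VField E M) (t : ℝ) (s : ∀ m : M, FormFibre E L p m) (m : M) :
    FormFibre E L p m :=
  dirac K nabla nablaL p s m + (Complex.I * t / 2) • cl K (X m) (s m)

variable {EG : Type*} [NormedAddCommGroup EG] [NormedSpace ℝ EG] [FiniteDimensional ℝ EG]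
  {G : Type*} [TopologicalSpace G] [ChartedSpace EG G] [Group G] [LieGroup 𝓘(ℝ, EG) ∞ G]
  [MulAction G M] [ContMDiffSMul 𝓘(ℝ, EG) 𝓘(ℝ, E) ∞ G M]

/-- The pullback of a section along `g`, whose value at `m` is `g⁻¹ · s(g m)`, for the action by
`G` on `Λ^* T^*M ⊗ L^p`. -/
def pullbackForm (actL : ∀ (g : G) (m : M), L m ≃ₗ[ℂ] L (g • m)) (p : ℕ)
    (s : ∀ m : M, FormFibre E L p m) (g : G) (m : M) : FormFibre E L p m := fun q =>
  ((PiTensorProduct.map (R := ℂ) fun _ : Fin p =>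
      (actL g m).symm.toLinearMap).restrictScalars ℝ).compAlternatingMap
    ((s (g • m) q).compLinearMap (dAct E g m).toLinearMap)

/-- `G`-invariance of a section of `Λ^* T^*M ⊗ L^p`. -/
def IsInvariantForm (actL : ∀ (g : G) (m : M), L m ≃ₗ[ℂ] L (g • m)) (p : ℕ)
    (s : ∀ m : M, FormFibre E L p m) : Prop :=
  ∀ (g : G) (m : M), pullbackForm actL p s g m = s m

/-- The Lie derivative `L_X s` with respect to `X ∈ 𝔤`: the derivative at `t = 0` of
`exp(-tX) · s(exp(tX) m)`. -/
def lieDerivForm (actL : ∀ (g : G) (m : M), L m ≃ₗ[ℂ] L (g • m)) (p : ℕ) (X : EG)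
    (s : ∀ m : M, FormFibre E L p m) (m : M) : FormFibre E L p m := fun q =>
  fromModel p m q
    (mvfderiv 𝓘(ℝ, EG) (fun g : G => toModel p m m q (pullbackForm actL p s g m q)) 1 X)

/-- The one-form `⟨μ, T f⟩`, for `f : M → 𝔤`, given by `v ↦ ⟨μ(m), T_m f (v)⟩`. -/
def pairDeriv (μ : M → (EG →L[ℝ] ℝ)) (f : M → EG) (m : M) : TangentSpace 𝓘(ℝ, E) m →ₗ[ℝ] ℝ :=
  (μ m).toLinearMap ∘ₗ (mvfderiv 𝓘(ℝ, E) f m).toLinearMap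

variable (E G) in
/-- The commutator `[v, X(·)^M - V](m)`, where `X : M → 𝔤`, the vector field `V` has the value
`X(m)^M_m` at `m`, and `X(m)^M` is the vector field induced by the fixed element `X(m)` of `𝔤`. -/
def bracketDiff (X : M → EG) (v : VField E M) (m : M) : TangentSpace 𝓘(ℝ, E) m :=
  VectorField.mlieBracket 𝓘(ℝ, E) v
    (fun x => fundVF E G (X m) x - fundVF E G (X x) x) m

variable (G) in
/-- The commutator `[v^{1,0}, X(·)^M - V](m)`, with the Lie bracket extended complex linearly. -/
def bracketDiff10 (X : M → EG) (v : VField E M) (m : M) : ℂ ⊗[ℝ] TangentSpace 𝓘(ℝ, E) m :=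
  (1 / 2 : ℂ) ⊗ₜ bracketDiff E G X v m
    - (Complex.I / 2) ⊗ₜ bracketDiff E G X (fun x => K.J x (v x)) m

/-- The endomorphism `w ↦ ∇^{T^{1,0}M}_w X^{1,0}` of `T^{1,0}M`, extended by zero
on `T^{0,1}M`. -/
def nabla10 (X : VField E M) (m : M) : Module.End ℂ (ℂ ⊗[ℝ] TangentSpace 𝓘(ℝ, E) m) :=
  proj10 (K.Jlin m) ∘ₗ
    ((1 / 2 : ℂ) • ((nabla X m).toLinearMap.baseChange ℂ
      - Complex.I • (nabla (fun x => K.J x (X x)) m).toLinearMap.baseChange ℂ)) ∘ₗ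
    proj10 (K.Jlin m)

/-- The endomorphism `A₁`, computed in the local orthonormal frame `e`. Here `X` stands for
`X_1^H`, and `V` for the family of vector fields `V_j`. -/
def formulaA1 {ι : Type*} [Fintype ι] (L : M → Type*) [∀ m, NormedAddCommGroup (L m)]
    [∀ m, InnerProductSpace ℂ (L m)] (p : ℕ) (X : VField E M) (V : ι → VField E M)
    (e : Fin (Module.finrank ℝ E) → VField E M) (m : M) : Module.End ℂ (FormFibre E L p m) :=
  (Complex.I / 4) • ∑ k, cl K (e k m) * cl K (nabla X m (e k m))
  - (Complex.I / 2 * LinearMap.trace ℂ _ (nabla10 K nabla X m)) • 1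
  + (1 / 2 : ℂ) • ∑ j, (Complex.I • (cl K (K.J m (V j m)) * cl K (V j m))
      + (K.metric m (V j m) (V j m) : ℂ) • 1)

variable (G) in
/-- The endomorphism `A₂`, computed in the local orthonormal frame `e`. -/
def formulaA2 {ι : Type*} [Fintype ι] (L : M → Type*) [∀ m, NormedAddCommGroup (L m)]
    [∀ m, InnerProductSpace ℂ (L m)] (p : ℕ)
    (κ : M → LinearMap.BilinForm ℝ (EG →L[ℝ] ℝ)) (μ : M → (EG →L[ℝ] ℝ))
    (h : ι → M → (EG →L[ℝ] ℝ))
    (e : Fin (Module.finrank ℝ E) → VField E M) (m : M) : Module.End ℂ (FormFibre E L p m) :=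
  (Complex.I / 2) • ∑ j,
    cl K (vecOf (K.metric m) (pairDeriv μ (dualMap κ (h j)) m)) * cl K (inducedVF E G κ (h j) m)
  + (Complex.I * ∑ j, ∑ k,
      covecC (pairDeriv μ (dualMap κ (h j)) m) (vec10 (K.Jlin m) (e k m))
        * herm (K.metric m) (1 ⊗ₜ inducedVF E G κ (h j) m) (vec10 (K.Jlin m) (e k m))) • 1

variable (G) in
/-- The endomorphism `A₃`, computed in the local orthonormal frame `e`. Here `c` stands for the
family of coefficients `μ_j` of the momentum map in the frame `h_j`. -/
def formulaA3 {ι : Type*} [Fintype ι] (L : M → Type*) [∀ m, NormedAddCommGroup (L m)]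
    [∀ m, InnerProductSpace ℂ (L m)] (p : ℕ)
    (κ : M → LinearMap.BilinForm ℝ (EG →L[ℝ] ℝ)) (c : ι → M → ℝ)
    (h : ι → M → (EG →L[ℝ] ℝ))
    (e : Fin (Module.finrank ℝ E) → VField E M) (m : M) : Module.End ℂ (FormFibre E L p m) :=
  -((Complex.I / 2) • ∑ j, ∑ k,
      (c j m : ℂ) • (cl K (e k m) * cl K (bracketDiff E G (dualMap κ (h j)) (e k) m)))
  - (Complex.I * ∑ j, ∑ k, (c j m : ℂ)
      * herm (K.metric m) (bracketDiff10 K G (dualMap κ (h j)) (e k) m)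
          (vec10 (K.Jlin m) (e k m))) • 1

/-- A (smooth) vector bundle endomorphism of `Λ^{0,*} T^*M ⊗ L^p`. -/
def IsSmoothEnd (p : ℕ) (A : ∀ m : M, Module.End ℂ (SpinorFibre K L p m)) : Prop :=
  ∀ (s : ∀ m : M, FormFibre E L p m) (hs : IsSpinor K p s),
    SmoothForm p (fun m => (A m ⟨s m, hs.2 m⟩ : FormFibre E L p m))

end Dirac

end SpincBochner

end

open SpincBochner

/-!
The cross term in the square of the deformed operator contains a covariant derivative along
`X_1^H`, which is a combination of fundamental vector fields of the action. The formula expresses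
this covariant derivative through Lie derivatives; the rest of the cross term is of order zero.

*Squaring the deformed operator.* With `Q(T) = ∑ c(b^i) c(T b_i)` for an endomorphism `T` of a
tangent space, where `(b_i)` is any basis with dual basis `(b^i)`, the Clifford relations and the
compatibility of the Clifford connection with the Levi-Civita connection give
`(D + (i t / 2) c(X))² = D² + (i t / 2) (Q(∇X) - 2 ∇_X) + (t² / 4) ‖X‖²`
for every smooth vector field `X` (`deformedDirac_deformedDirac`). No curvature enters, since only
the cross terms are computed.

*The Hamiltonian vector field.* In `d_1 H` the metric on the dual Lie algebra is frozen at `m`, so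
that only the derivative of `μ` contributes and `X_1 = 2 ∑ μ_j V_j` (`X1_eq`). Hence `∇_{X_1}` at
`m` is a combination of the derivatives along the vector fields induced by the *fixed* elements
`h_j^*(m)`.

*The Kostant formula.* For `ξ` in the Lie algebra, with fundamental vector field `ξ^M`,
`∇_{ξ^M} = L_ξ + Q(∇ ξ^M) / 4 + tr_{T^{1,0}}(∇ ξ^M) / 2 + 2 π i p μ_ξ`
on spinors (`nablaSpinor_fundVF`). On forms with values in `L^p` the Lie derivative is computed in
coordinates (`lieDerivForm_eq_nablaForms`), by the symmetry of the mixed second derivatives of the action. The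
metric connection `nablaJ`, for which `J` is parallel, differs along `ξ^M` from the commutator with
`ξ^M` by the endomorphism `momentEnd`. It is skew and commutes with `J` (`momentEnd_skew`,
`momentEnd_J`), because the action preserves `ω` and `J`. The action of such an endomorphism on
forms of type `(0, q)` is expressed by Clifford multiplication in
`IsDualFrame.derivationAct_eq_cliffordTrace`. The Levi-Civita connection differs from `nablaJ` by
the intrinsic torsion, which is skew and anticommutes with `J`, and therefore has no trace over
`T^{1,0}M`.

*Comparison of traces.* The closedness of `ω` implies the quasi-Kähler identity
`intrinsicTorsion_J_left`, and hence that the trace of `∇^{T^{1,0}M} X^{1,0}` on `T^{1,0}M` equals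
the trace of `∇X` over vectors of type `(1, 0)` (`trace_nabla10`).

Finally `∇X_1 = 2 ∑ (dμ_j ⊗ V_j + μ_j ∇V_j)` (`nabla_X1`), where
`dμ_j = g(J V_j, ·) + ⟨μ, T h_j^*⟩` (`mvfderiv_coeff`), and `∇V_j` differs from `∇(h_j^*(m)^M)` by
the endomorphism `v ↦ (T h_j^*(v))^M`, which up to sign is also the commutator in the expression of
`A₃` (`bracketDiff_eq`). Collecting terms (`bochner_algebra`) yields `A₁`, `A₂` and `A₃` as expressions
in one arbitrary frame; these do not depend on the frame, and in a coordinate frame they are visibly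
smooth.
-/

noncomputable section

namespace SpincBochner

open scoped Topology

set_option linter.unusedSectionVars false

/-! ### The algebra of forms: contraction and exterior multiplication -/

section FormsAlgebra

variable {V : Type*} [AddCommGroup V] [Module ℝ V]
variable {W : Type*} [AddCommGroup W] [Module ℂ W]

theorem contract_apply (v : V) (s : Forms V W) (q : ℕ) (w : Fin q → V) :
    contract v s q w = s (q + 1) (Fin.cons v w) := rfl

theorem wedge_apply_zero (θ : V →ₗ[ℝ] ℂ) (s : Forms V W) : wedge θ s 0 = 0 := rfl

theorem wedge_apply_succ (θ : V →ₗ[ℝ] ℂ) (s : Forms V W) (q : ℕ) (w : Fin (q + 1) → V) :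
    wedge θ s (q + 1) w
      = ∑ i : Fin (q + 1), (-1 : ℂ) ^ (i : ℕ) • θ (w i) • s q (i.removeNth w) := by
  have : wedge θ s (q + 1) = AlternatingMap.alternatizeUncurryFin (θ.smulRight (s q)) := rfl
  rw [this, AlternatingMap.alternatizeUncurryFin_apply]
  refine Finset.sum_congr rfl fun i _ => ?_
  rw [← Int.cast_smul_eq_zsmul ℂ]
  simp

/-- The action of an endomorphism as a derivation, as a sum over the arguments of the form. -/
theorem derivationAct_apply (Γ : V →ₗ[ℝ] V) (s : Forms V W) (q : ℕ) (w : Fin q → V) :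
    derivationAct Γ s q w = ∑ i, s q (Function.update w i (Γ (w i))) := by
  cases q with
  | zero => simp [derivationAct]
  | succ q =>
    have : derivationAct Γ s (q + 1)
      = AlternatingMap.alternatizeUncurryFin ((s (q + 1)).curryLeft ∘ₗ Γ) := rfl
    rw [this, AlternatingMap.alternatizeUncurryFin_apply]
    refine Finset.sum_congr rfl fun i _ => ?_
    have := AlternatingMap.neg_one_pow_smul_map_insertNth (s (q + 1)) i (Γ (w i)) (i.removeNth w)
    rw [Fin.insertNth_removeNth] at this
    rw [LinearMap.comp_apply, AlternatingMap.curryLeft_apply_apply, ← this, smul_smul, ← pow_add,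
      Even.neg_one_pow ⟨_, rfl⟩, one_smul]

theorem Forms.ext_apply {s t : Forms V W} (h : ∀ q w, s q w = t q w) : s = t := by
  funext q; ext w; exact h q w

theorem Forms.add_apply (s t : Forms V W) (q : ℕ) (w : Fin q → V) :
    (s + t) q w = s q w + t q w := rfl

theorem Forms.sub_apply (s t : Forms V W) (q : ℕ) (w : Fin q → V) :
    (s - t) q w = s q w - t q w := rfl

theorem Forms.smul_apply (c : ℂ) (s : Forms V W) (q : ℕ) (w : Fin q → V) :
    (c • s) q w = c • s q w := rfl

theorem Forms.sum_apply {ι : Type*} (a : Finset ι) (f : ι → Forms V W) (q : ℕ) (w : Fin q → V) :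
    (∑ i ∈ a, f i) q w = ∑ i ∈ a, f i q w := by
  induction a using Finset.cons_induction with
  | empty => rfl
  | cons i a ha ih => rw [Finset.sum_cons, Finset.sum_cons, ← ih]; rfl

theorem contract_add (v w : V) (s : Forms V W) :
    contract (v + w) s = contract v s + contract w s := by
  refine Forms.ext_apply fun q u => ?_
  simp [contract]

theorem contract_smul (a : ℝ) (v : V) (s : Forms V W) :
    contract (a • v) s = (a : ℂ) • contract v s := by
  refine Forms.ext_apply fun q u => ?_
  simp [contract]

theorem wedge_add_left (θ η : V →ₗ[ℝ] ℂ) (s : Forms V W) :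
    wedge (θ + η) s = wedge θ s + wedge η s := by
  refine Forms.ext_apply fun q u => ?_
  cases q with
  | zero => simp [wedge_apply_zero]
  | succ q =>
    simp [wedge_apply_succ, add_smul, Finset.sum_add_distrib]

theorem wedge_smul_left (a : ℂ) (θ : V →ₗ[ℝ] ℂ) (s : Forms V W) :
    wedge (a • θ) s = a • wedge θ s := by
  refine Forms.ext_apply fun q u => ?_
  cases q with
  | zero => simp [wedge_apply_zero]
  | succ q =>
    simp only [Forms.smul_apply, wedge_apply_succ, Finset.smul_sum, LinearMap.smul_apply]
    refine Finset.sum_congr rfl fun i _ => ?_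
    rw [smul_comm a, smul_eq_mul, mul_smul]

theorem contract_contract (v : V) (s : Forms V W) : contract v (contract v s) = 0 := by
  refine Forms.ext_apply fun q u => ?_
  rw [contract_apply, contract_apply]
  exact (s (q + 2)).map_eq_zero_of_eq _ (i := 0) (j := 1) (by simp [Fin.cons_one]) (by simp)

/-- Exterior multiplication by a covector squares to zero: the repeated alternatization of a
bilinear expression that is symmetric in its two arguments vanishes. -/
theorem wedge_wedge (θ : V →ₗ[ℝ] ℂ) (s : Forms V W) : wedge θ (wedge θ s) = 0 := by
  funext q
  match q with
  | 0 => rfl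
  | 1 =>
    have : wedge θ (wedge θ s) 1
      = AlternatingMap.alternatizeUncurryFin (θ.smulRight (wedge θ s 0)) := rfl
    rw [this, wedge_apply_zero]
    ext v
    simp [AlternatingMap.alternatizeUncurryFin_apply]
  | q + 2 =>
    let f : V →ₗ[ℝ] V →ₗ[ℝ] V [⋀^Fin q]→ₗ[ℝ] W :=
      LinearMap.mk₂ ℝ (fun x y => (θ x * θ y) • s q)
        (by intros; simp [add_mul, add_smul]) (by intros; ext; simp [mul_assoc, mul_smul])
        (by intros; simp [mul_add, add_smul]) (by intros; ext; simp [mul_left_comm, mul_smul])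
    have h := AlternatingMap.alternatizeUncurryFin_alternatizeUncurryFinLM_comp_of_symmetric
      (f := f) (fun x y => by simp [f, mul_comm])
    have h2 : AlternatingMap.alternatizeUncurryFinLM ∘ₗ f = θ.smulRight (wedge θ s (q + 1)) := by
      ext x v
      simp only [f, LinearMap.comp_apply, AlternatingMap.alternatizeUncurryFinLM_apply,
        AlternatingMap.alternatizeUncurryFin_apply, LinearMap.mk₂_apply, LinearMap.smulRight_apply,
        AlternatingMap.smul_apply, mul_smul]
      have : wedge θ s (q + 1) = AlternatingMap.alternatizeUncurryFin (θ.smulRight (s q)) := rfl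
      rw [this, AlternatingMap.alternatizeUncurryFin_apply, Finset.smul_sum]
      refine Finset.sum_congr rfl fun i _ => ?_
      simp only [LinearMap.smulRight_apply, AlternatingMap.smul_apply]
      exact smul_comm _ _ _
    rw [h2] at h
    exact h

/-- Contraction is an antiderivation of the exterior algebra. -/
theorem contract_wedge (v : V) (θ : V →ₗ[ℝ] ℂ) (s : Forms V W) :
    contract v (wedge θ s) = θ v • s - wedge θ (contract v s) := by
  refine Forms.ext_apply fun q u => ?_
  rw [contract_apply, wedge_apply_succ, Fin.sum_univ_succ, Forms.sub_apply, Forms.smul_apply]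
  simp only [Fin.val_zero, pow_zero, one_smul, Fin.cons_zero, Fin.cons_succ, Fin.val_succ]
  have h0 : (0 : Fin (q + 1)).removeNth (Fin.cons v u : Fin (q + 1) → V) = u := by
    funext i; simp [Fin.removeNth]
  rw [h0, sub_eq_add_neg]
  congr 1
  cases q with
  | zero => simp [wedge_apply_zero]
  | succ q =>
    rw [wedge_apply_succ, ← Finset.sum_neg_distrib]
    refine Finset.sum_congr rfl fun i _ => ?_
    rw [pow_succ, contract_apply]
    have : (i.succ).removeNth (Fin.cons v u : Fin (q + 2) → V)
        = (Fin.cons v (i.removeNth u) : Fin (q + 1) → V) := by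
      funext j
      refine Fin.cases ?_ (fun j => ?_) j
      · simp [Fin.removeNth]
      · simp [Fin.removeNth]
    rw [this]
    simp

end FormsAlgebra

/-! ### The Clifford action on forms over a Hermitian vector space -/

section HermitianAlgebra

variable {V : Type*} [AddCommGroup V] [Module ℝ V]
variable {W : Type*} [AddCommGroup W] [Module ℂ W]

/-- A symmetric bilinear form `g` with an orthogonal complex structure `J`. The Clifford algebra
needs no positivity of `g`. -/
structure IsHermitianPair (g : V →ₗ[ℝ] V →ₗ[ℝ] ℝ) (J : V →ₗ[ℝ] V) : Prop where
  symm : ∀ v w, g v w = g w v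
  J_sq : ∀ v, J (J v) = -v
  isometry : ∀ v w, g (J v) (J w) = g v w

variable {g : V →ₗ[ℝ] V →ₗ[ℝ] ℝ} {J : V →ₗ[ℝ] V}

theorem IsHermitianPair.skew (H : IsHermitianPair g J) (v w : V) : g (J v) w = -g v (J w) := by
  rw [← H.isometry v (J w), H.J_sq, map_neg, neg_neg]

theorem IsHermitianPair.self_J (H : IsHermitianPair g J) (v : V) : g (J v) v = 0 := by
  have := H.skew v v
  rw [H.symm v (J v)] at this
  linarith

theorem vec10_eq (v : V) : vec10 J v = (1 / 2 : ℂ) ⊗ₜ[ℝ] v - (Complex.I / 2) ⊗ₜ[ℝ] J v := by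
  simp only [vec10, proj10, LinearMap.smul_apply, LinearMap.sub_apply, LinearMap.id_apply,
    LinearMap.baseChange_tmul, smul_sub, TensorProduct.smul_tmul', smul_smul]
  congr 2 <;> simp [div_eq_mul_inv, mul_comm]

theorem dual10_apply (v w : V) :
    dual10 g J v w = (1 / 2 : ℂ) * g v w - Complex.I / 2 * g (J v) w := by
  simp only [dual10, LinearMap.comp_apply, vec10_eq, map_sub, LinearMap.restrictScalars_apply,
    TensorProduct.mk_apply, LinearMap.sub_apply, LinearMap.BilinForm.baseChange_tmul]
  simp
  ring

theorem dual10_add (v w : V) : dual10 g J (v + w) = dual10 g J v + dual10 g J w := by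
  ext u
  simp [dual10_apply]
  ring

theorem dual10_smul (a : ℝ) (v : V) : dual10 g J (a • v) = (a : ℂ) • dual10 g J v := by
  ext u
  simp [dual10_apply]
  ring

theorem IsHermitianPair.dual10_J (H : IsHermitianPair g J) (v : V) :
    dual10 g J (J v) = Complex.I • dual10 g J v := by
  ext u
  simp [dual10_apply, H.J_sq]
  linear_combination ((1 / 2 : ℂ) * g (J v) u) * Complex.I_mul_I

theorem IsHermitianPair.dual10_J_apply (H : IsHermitianPair g J) (v w : V) :
    dual10 g J v (J w) = -(Complex.I * dual10 g J v w) := by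
  simp only [dual10_apply, H.isometry]
  rw [← neg_neg (g v (J w)), ← H.skew]
  push_cast
  linear_combination ((-(1 / 2 : ℂ) * g (J v) w)) * Complex.I_mul_I

theorem contract01_apply (v : V) (s : Forms V W) :
    contract01 J v s = (1 / 2 : ℂ) • (contract v s + Complex.I • contract (J v) s) := rfl

theorem contract01_add (v w : V) (s : Forms V W) :
    contract01 J (v + w) s = contract01 J v s + contract01 J w s := by
  simp only [contract01_apply, map_add, contract_add]
  module

theorem contract01_smul (a : ℝ) (v : V) (s : Forms V W) :
    contract01 J (a • v) s = (a : ℂ) • contract01 J v s := by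
  simp only [contract01_apply, map_smul, contract_smul]
  module

theorem IsHermitianPair.contract01_J (H : IsHermitianPair g J) (v : V) (s : Forms V W) :
    contract01 J (J v) s = -(Complex.I • contract01 J v s) := by
  have h : contract (-v) s = -contract v s := by
    rw [← neg_one_smul ℝ v, contract_smul]; simp
  simp only [contract01_apply, H.J_sq, h, smul_add, smul_smul, smul_neg]
  have : Complex.I * (1 / 2 * Complex.I) = -(1 / 2 : ℂ) := by
    linear_combination (1 / 2 : ℂ) * Complex.I_mul_I
  rw [this]
  module

theorem clifford_apply (v : V) (s : Forms V W) :
    clifford g J v s = (Real.sqrt 2 : ℂ) • (wedge (dual10 g J v) s - contract01 J v s) := rfl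

theorem contract01_contract01 (v : V) (s : Forms V W) (J : V →ₗ[ℝ] V) :
    contract01 J v (contract01 J v s) = 0 := by
  have h : contract (v + J v) (contract (v + J v) s) = 0 := contract_contract _ _
  simp only [contract_add, map_add, contract_contract] at h
  simp only [contract01_apply, map_add, map_smul, contract_contract]
  have h2 : contract (J v) (contract v s) + contract v (contract (J v) s) = 0 := by
    simpa [add_comm] using h
  have h3 : contract v (contract (J v) s) = -contract (J v) (contract v s) :=
    (neg_eq_of_add_eq_zero_right h2).symm
  rw [h3]
  module

theorem contract01_wedge (v : V) (θ : V →ₗ[ℝ] ℂ) (s : Forms V W) :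
    contract01 J v (wedge θ s)
      = ((1 / 2 : ℂ) * (θ v + Complex.I * θ (J v))) • s - wedge θ (contract01 J v s) := by
  simp only [contract01_apply, contract_wedge, map_smul, map_add]
  module

theorem sqrt_two_mul_self : (Real.sqrt 2 : ℂ) * (Real.sqrt 2 : ℂ) = 2 := by
  rw [← Complex.ofReal_mul, Real.mul_self_sqrt (by norm_num)]
  norm_num

theorem clifford_add (v w : V) (s : Forms V W) :
    clifford g J (v + w) s = clifford g J v s + clifford g J w s := by
  simp only [clifford_apply, dual10_add, wedge_add_left, contract01_add]
  module

theorem clifford_smul (a : ℝ) (v : V) (s : Forms V W) :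
    clifford g J (a • v) s = (a : ℂ) • clifford g J v s := by
  simp only [clifford_apply, dual10_smul, wedge_smul_left, contract01_smul]
  module

variable (W g J) in
/-- The Clifford action as a linear map on vectors. -/
def cliffordL : V →ₗ[ℝ] Module.End ℂ (Forms V W) where
  toFun := clifford g J
  map_add' v w := LinearMap.ext fun s => clifford_add v w s
  map_smul' a v := LinearMap.ext fun s => by
    rw [clifford_smul]; rfl

theorem cliffordL_apply (v : V) :
    (cliffordL W g J v : Module.End ℂ (Forms V W)) = clifford g J v := rfl

/-- The Clifford relation: the square of `c(v)` is `-g(v, v)`. -/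
theorem IsHermitianPair.clifford_clifford_self (H : IsHermitianPair g J) (v : V)
    (s : Forms V W) : clifford g J v (clifford g J v s) = -((g v v : ℂ) • s) := by
  have h1 : (1 / 2 : ℂ) * (dual10 g J v v + Complex.I * dual10 g J v (J v))
      = (1 / 2 : ℂ) * g v v := by
    rw [H.dual10_J_apply, dual10_apply, H.self_J]
    simp only [Complex.ofReal_zero, mul_zero, sub_zero]
    linear_combination (-(1 / 4 : ℂ) * g v v) * Complex.I_mul_I
  simp only [clifford_apply, map_smul, map_sub, wedge_wedge, contract01_contract01,
    contract01_wedge, h1]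
  have h2 : (Real.sqrt 2 : ℂ) * Real.sqrt 2 = 2 := sqrt_two_mul_self
  rw [← smul_sub, smul_smul, h2]
  module

theorem IsHermitianPair.clifford_anticomm (H : IsHermitianPair g J) (v w : V)
    (s : Forms V W) :
    clifford g J v (clifford g J w s) + clifford g J w (clifford g J v s)
      = -((2 * g v w : ℂ) • s) := by
  have h := H.clifford_clifford_self (v + w) s
  simp only [clifford_add, map_add, H.clifford_clifford_self, LinearMap.add_apply,
    H.symm w v] at h
  have : clifford g J v (clifford g J w s) + clifford g J w (clifford g J v s)
    = (-((g v v : ℂ) • s) + clifford g J w (clifford g J v s) +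
      (clifford g J v (clifford g J w s) + -((g w w : ℂ) • s))) + (g v v : ℂ) • s
      + (g w w : ℂ) • s := by module
  rw [this, h]
  push_cast
  module

theorem contract_mem_forms01 (v : V) {s : Forms V W} (hs : s ∈ forms01 W J) :
    contract v s ∈ forms01 W J := by
  intro q w i
  have := hs (q + 1) (Fin.cons v w) i.succ
  rw [Fin.cons_succ, ← Fin.cons_update] at this
  exact this

theorem contract_J_of_mem {s : Forms V W} (hs : s ∈ forms01 W J) (v : V) :
    contract (J v) s = -(Complex.I • contract v s) := by
  refine Forms.ext_apply fun q w => ?_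
  have := hs (q + 1) (Fin.cons v w) 0
  rw [Fin.cons_zero, Fin.update_cons_zero] at this
  exact this

theorem contract01_mem_forms01 (v : V) {s : Forms V W} (hs : s ∈ forms01 W J) :
    contract01 J v s ∈ forms01 W J :=
  (forms01 W J).smul_mem _ ((forms01 W J).add_mem (contract_mem_forms01 v hs)
    ((forms01 W J).smul_mem _ (contract_mem_forms01 _ hs)))

/-- On forms of type `(0, q)`, contraction by `v^{0,1}` is contraction by `v`. -/
theorem contract01_of_mem {s : Forms V W} (hs : s ∈ forms01 W J) (v : V) :
    contract01 J v s = contract v s := by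
  rw [contract01_apply, contract_J_of_mem hs, smul_neg, smul_smul, Complex.I_mul_I]
  module

theorem wedge_mem_forms01 {θ : V →ₗ[ℝ] ℂ} (hθ : ∀ w, θ (J w) = -(Complex.I * θ w))
    {s : Forms V W} (hs : s ∈ forms01 W J) : wedge θ s ∈ forms01 W J := by
  intro q v i
  cases q with
  | zero => exact i.elim0
  | succ q =>
    rw [wedge_apply_succ, wedge_apply_succ, Finset.smul_sum, ← Finset.sum_neg_distrib]
    refine Finset.sum_congr rfl fun j _ => ?_
    rcases eq_or_ne i j with rfl | hij
    · rw [Function.update_self, Fin.removeNth_update, hθ, smul_comm Complex.I, ← smul_neg,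
        smul_smul Complex.I, neg_smul]
    · obtain ⟨i', rfl⟩ := Fin.exists_succAbove_eq hij
      cases q with
      | zero => exact i'.elim0
      | succ q =>
      have : j.removeNth (Function.update v (j.succAbove i') (J (v (j.succAbove i'))))
          = Function.update (j.removeNth v) i' (J (j.removeNth v i')) := by
        funext k
        simp only [Fin.removeNth]
        rcases eq_or_ne k i' with rfl | hk
        · simp
        · rw [Function.update_of_ne hk, Function.update_of_ne
            (fun h => hk (Fin.succAbove_right_injective h))]
          rfl
      rw [this, hs, Function.update_of_ne hij.symm]
      simp only [smul_neg, smul_smul]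
      congr 2
      ring

theorem IsHermitianPair.clifford_mem_forms01 (H : IsHermitianPair g J) (v : V) {s : Forms V W}
    (hs : s ∈ forms01 W J) : clifford g J v s ∈ forms01 W J :=
  (forms01 W J).smul_mem _ ((forms01 W J).sub_mem
    (wedge_mem_forms01 (H.dual10_J_apply v) hs) (contract01_mem_forms01 v hs))

end HermitianAlgebra

/-! ### Dual frames and traces over vectors of type (1,0) -/

section Frames

variable {V : Type*} [AddCommGroup V] [Module ℝ V] {N : Type*} [AddCommGroup N] [Module ℝ N]
variable {W : Type*} [AddCommGroup W] [Module ℂ W]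
variable {ι κ : Type*} [Fintype ι] [Fintype κ]
variable {g : V →ₗ[ℝ] V →ₗ[ℝ] ℝ} {J : V →ₗ[ℝ] V} {b' b : ι → V} {c' c : κ → V}

/-- The families `b'` and `b` are frames dual to each other with respect to `g`, expressed by the
two expansions of a vector. An orthonormal frame is dual to itself. -/
structure IsDualFrame (g : V →ₗ[ℝ] V →ₗ[ℝ] ℝ) (b' b : ι → V) : Prop where
  expand : ∀ v, ∑ i, g (b' i) v • b i = v
  expand_dual : ∀ v, ∑ i, g (b i) v • b' i = v

theorem IsDualFrame.swap (h : IsDualFrame g b' b) : IsDualFrame g b b' :=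
  ⟨h.expand_dual, h.expand⟩

/-- Contraction of a bilinear map with the metric does not depend on the frame. -/
theorem IsDualFrame.sum_eq (hg : ∀ v w, g v w = g w v) (h : IsDualFrame g b' b)
    (hc : IsDualFrame g c' c) (β : V →ₗ[ℝ] V →ₗ[ℝ] N) :
    ∑ i, β (b' i) (b i) = ∑ j, β (c' j) (c j) := by
  have h1 : ∀ i, β (b' i) (b i) = ∑ j, β (g (b i) (c' j) • b' i) (c j) := fun i => by
    conv_lhs => rw [← hc.expand (b i)]
    simp [hg (b i)]
  simp only [h1]
  rw [Finset.sum_comm]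
  refine Finset.sum_congr rfl fun j _ => ?_
  rw [← LinearMap.sum_apply, ← map_sum, h.expand_dual]

/-- An endomorphism can be moved to the other argument of a contraction as its adjoint. -/
theorem IsDualFrame.sum_adjoint (h : IsDualFrame g b' b) (β : V →ₗ[ℝ] V →ₗ[ℝ] N)
    (hg : ∀ v w, g v w = g w v) {T S : V →ₗ[ℝ] V} (hTS : ∀ v w, g (T v) w = g v (S w)) :
    ∑ i, β (b' i) (T (b i)) = ∑ i, β (S (b' i)) (b i) := by
  have h1 : ∀ i, β (b' i) (T (b i)) = ∑ j, β (g (b i) (S (b' j)) • b' i) (b j) := fun i => by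
    conv_lhs => rw [← h.expand (T (b i))]
    simp [← hTS, hg (b' _)]
  simp only [h1]
  rw [Finset.sum_comm]
  refine Finset.sum_congr rfl fun j _ => ?_
  rw [← LinearMap.sum_apply, ← map_sum, h.expand_dual]

theorem IsDualFrame.map_J (H : IsHermitianPair g J) (h : IsDualFrame g b' b) :
    IsDualFrame g (fun i => J (b' i)) (fun i => J (b i)) := by
  constructor <;> intro v
  · have := congrArg (fun u => -J u) (h.expand (J v))
    simpa [H.J_sq, H.skew] using this
  · have := congrArg (fun u => -J u) (h.expand_dual (J v))
    simpa [H.J_sq, H.skew] using this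

theorem IsDualFrame.trace_eq [FiniteDimensional ℝ V] (h : IsDualFrame g b' b) (T : V →ₗ[ℝ] V) :
    LinearMap.trace ℝ V T = ∑ i, g (b' i) (T (b i)) := by
  have : T = ∑ i, (g (b' i)).smulRight (T (b i)) := by
    ext v
    conv_lhs => rw [← h.expand v]
    simp
  conv_lhs => rw [this]
  simp [LinearMap.trace_smulRight]

theorem isDualFrame_of_orthonormal [FiniteDimensional ℝ V]
    (e : Fin (Module.finrank ℝ V) → V) (he : ∀ k l, g (e k) (e l) = if k = l then 1 else 0) :
    IsDualFrame g e e := by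
  have hli : LinearIndependent ℝ e := by
    rw [Fintype.linearIndependent_iff]
    intro a ha k
    have := congrArg (g (e k)) ha
    simpa [he] using this
  have hspan : ∀ v, v ∈ Submodule.span ℝ (Set.range e) := by
    rw [hli.span_eq_top_of_card_eq_finrank' (by simp)]
    simp
  have key : ∀ v, ∑ i, g (e i) v • e i = v := fun v => by
    obtain ⟨a, rfl⟩ := (Submodule.mem_span_range_iff_exists_fun ℝ).1 (hspan v)
    simp [he]
  exact ⟨key, key⟩

/-- The trace over `V^{1,0}` of the `(1,0)`-part of a real endomorphism of `V`, which need not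
commute with `J`; see `trace_proj10_comp` for the comparison with the trace on the complexification.
-/
def trace10 (J T : V →ₗ[ℝ] V) : ℂ :=
  (1 / 2 : ℂ) * (LinearMap.trace ℝ V T - Complex.I * LinearMap.trace ℝ V (J ∘ₗ T))

theorem trace10_add (T S : V →ₗ[ℝ] V) : trace10 J (T + S) = trace10 J T + trace10 J S := by
  simp [trace10, LinearMap.comp_add]
  ring

theorem trace10_smul (a : ℝ) (T : V →ₗ[ℝ] V) : trace10 J (a • T) = a * trace10 J T := by
  simp [trace10, LinearMap.comp_smul]
  ring

theorem trace10_sum {α : Type*} (s : Finset α) (T : α → V →ₗ[ℝ] V) :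
    trace10 J (∑ i ∈ s, T i) = ∑ i ∈ s, trace10 J (T i) := by
  induction s using Finset.cons_induction with
  | empty => simp [trace10]
  | cons i a ha ih => rw [Finset.sum_cons, Finset.sum_cons, trace10_add, ih]

theorem trace10_sub (T S : V →ₗ[ℝ] V) : trace10 J (T - S) = trace10 J T - trace10 J S := by
  simp [trace10, LinearMap.comp_sub]
  ring

theorem trace10_smulRight [FiniteDimensional ℝ V] (α : V →ₗ[ℝ] ℝ) (v : V) :
    trace10 J (α.smulRight v) = (1 / 2 : ℂ) * (α v - Complex.I * α (J v)) := by
  have : J ∘ₗ α.smulRight v = α.smulRight (J v) := by ext; simp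
  rw [trace10, this, LinearMap.trace_smulRight, LinearMap.trace_smulRight]

theorem trace10_J_comp (hJ : ∀ v, J (J v) = -v) (T : V →ₗ[ℝ] V) :
    trace10 J (J ∘ₗ T) = Complex.I * trace10 J T := by
  have : J ∘ₗ J ∘ₗ T = -T := by ext v; simp [hJ]
  rw [trace10, trace10, this]
  simp
  linear_combination ((1 / 2 : ℂ) * LinearMap.trace ℝ V (J ∘ₗ T)) * Complex.I_mul_I

/-- An endomorphism that anticommutes with `J` maps `V^{1,0}` to `V^{0,1}`, so that its trace over
`V^{1,0}` vanishes. -/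
theorem trace10_eq_zero_of_anticomm [FiniteDimensional ℝ V] (hJ : ∀ v, J (J v) = -v)
    {T : V →ₗ[ℝ] V} (hT : ∀ v, T (J v) = -J (T v)) : trace10 J T = 0 := by
  have key : ∀ S : V →ₗ[ℝ] V, (∀ v, S (J v) = -J (S v)) → LinearMap.trace ℝ V S = 0 := by
    intro S hS
    have h1 : S = J ∘ₗ (S ∘ₗ J) := by ext v; simp [hS, hJ]
    have h2 : (S ∘ₗ J) ∘ₗ J = -S := by ext v; simp [hJ]
    have h3 := LinearMap.trace_comp_comm' J (S ∘ₗ J)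
    rw [← h1, h2, map_neg] at h3
    linarith
  rw [trace10, key T hT, key (J ∘ₗ T) (fun v => by simp [hT])]
  simp

theorem IsDualFrame.trace10_eq [FiniteDimensional ℝ V] (H : IsHermitianPair g J)
    (h : IsDualFrame g b' b) (T : V →ₗ[ℝ] V) :
    trace10 J T = ∑ i, dual10 g J (T (b i)) (b' i) := by
  rw [trace10, h.trace_eq, h.trace_eq]
  simp only [dual10_apply, Finset.sum_sub_distrib, ← Finset.mul_sum, LinearMap.comp_apply,
    H.symm (b' _)]
  push_cast
  ring

theorem conjC_tmul (z : ℂ) (v : V) : conjC (z ⊗ₜ[ℝ] v) = (starRingEnd ℂ z) ⊗ₜ[ℝ] v := by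
  simp [conjC]

theorem herm_vec10 (x y v : V) :
    herm g ((1 / 2 : ℂ) ⊗ₜ[ℝ] x - (Complex.I / 2) ⊗ₜ[ℝ] y) (vec10 J v)
      = (1 / 4 : ℂ) * (g x v + g y (J v) + Complex.I * g x (J v) - Complex.I * g y v) := by
  simp only [herm, vec10_eq, map_sub, conjC_tmul, LinearMap.sub_apply,
    LinearMap.BilinForm.baseChange_tmul]
  simp [map_ofNat]
  linear_combination (-(1 / 4 : ℂ) * g y (J v)) * Complex.I_mul_I

/-- The trace over `V^{1,0}` in an orthonormal frame. -/
theorem trace10_eq_sum_herm [FiniteDimensional ℝ V] (H : IsHermitianPair g J)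
    {e : ι → V} (h : IsDualFrame g e e) (T : V →ₗ[ℝ] V) :
    ∑ k, herm g ((1 / 2 : ℂ) ⊗ₜ[ℝ] T (e k) - (Complex.I / 2) ⊗ₜ[ℝ] T (J (e k))) (vec10 J (e k))
      = trace10 J T := by
  have h1 := h.trace_eq T
  have h2 := (h.map_J H).trace_eq T
  have h3 := h.trace_eq (J ∘ₗ T)
  have h4 := h.trace_eq (T ∘ₗ J)
  rw [LinearMap.trace_comp_comm' J T] at h4
  simp only [herm_vec10, H.symm (T _), trace10]
  have h5 : ∀ k, g (J (e k)) (T (e k)) = - g (e k) ((J ∘ₗ T) (e k)) := fun k => by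
    rw [H.skew]; rfl
  simp only [h5, ← Finset.mul_sum, Finset.sum_sub_distrib, Finset.sum_add_distrib,
    ← Complex.ofReal_sum, Finset.sum_neg_distrib, ← h3]
  have h6 : ∀ k, g (e k) (T (J (e k))) = g (e k) ((T ∘ₗ J) (e k)) := fun k => rfl
  simp only [h6, ← h4, ← h1, ← h2]
  push_cast
  ring

theorem covecC_vec10 (α : V →ₗ[ℝ] ℝ) (v : V) :
    covecC α (vec10 J v) = (1 / 2 : ℂ) * (α v - Complex.I * α (J v)) := by
  simp [covecC, vec10_eq]
  ring

theorem trace10_smulRight_eq_sum [FiniteDimensional ℝ V] (H : IsHermitianPair g J)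
    {e : ι → V} (h : IsDualFrame g e e) (α : V →ₗ[ℝ] ℝ) (v : V) :
    ∑ k, covecC α (vec10 J (e k)) * herm g (1 ⊗ₜ v) (vec10 J (e k))
      = trace10 J (α.smulRight v) := by
  rw [← trace10_eq_sum_herm H h]
  refine Finset.sum_congr rfl fun k _ => ?_
  have : herm g ((1 : ℂ) ⊗ₜ[ℝ] v) (vec10 J (e k))
      = (1 / 2 : ℂ) * (g v (e k) + Complex.I * g v (J (e k))) := by
    simp only [herm, vec10_eq, map_sub, conjC_tmul, LinearMap.BilinForm.baseChange_tmul]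
    simp [map_ofNat]
    ring
  rw [this, covecC_vec10, herm_vec10]
  simp
  linear_combination (-(1 / 4 : ℂ) * α (J (e k)) * g v (J (e k))) * Complex.I_mul_I

/-- The trace over `V^{1,0}` of an endomorphism of the complexification of the form
`(A - √-1 B)/2`, for real endomorphisms `A` and `B`. -/
theorem trace_proj10_comp [FiniteDimensional ℝ V] (hJ : ∀ v, J (J v) = -v) (A B : V →ₗ[ℝ] V) :
    LinearMap.trace ℂ (ℂ ⊗[ℝ] V) (proj10 J ∘ₗ
      ((1 / 2 : ℂ) • (A.baseChange ℂ - Complex.I • B.baseChange ℂ)) ∘ₗ proj10 J)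
      = (1 / 2 : ℂ) * (trace10 J A - Complex.I * trace10 J B) := by
  have hP : proj10 J ∘ₗ proj10 J = proj10 J := by
    have hJ2 : (J.baseChange ℂ) ∘ₗ (J.baseChange ℂ)
        = -(LinearMap.id : ℂ ⊗[ℝ] V →ₗ[ℂ] ℂ ⊗[ℝ] V) := by
      ext v
      simp [hJ, TensorProduct.tmul_neg]
    have hx : ∀ x, J.baseChange ℂ (J.baseChange ℂ x) = -x := fun x =>
      LinearMap.congr_fun hJ2 x
    refine LinearMap.ext fun x => ?_
    simp only [proj10, LinearMap.comp_apply, LinearMap.smul_apply, LinearMap.sub_apply,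
      LinearMap.id_apply, map_smul, map_sub, hx]
    simp only [smul_sub, smul_smul, smul_neg]
    have : Complex.I * (1 / 2 * Complex.I) = -(1 / 2 : ℂ) := by
      linear_combination (1 / 2 : ℂ) * Complex.I_mul_I
    simp only [this]
    module
  have key : ∀ T : V →ₗ[ℝ] V,
      LinearMap.trace ℂ (ℂ ⊗[ℝ] V) (proj10 J ∘ₗ T.baseChange ℂ) = trace10 J T := by
    intro T
    have h1 : proj10 J ∘ₗ T.baseChange ℂ
        = (1 / 2 : ℂ) • (T.baseChange ℂ - Complex.I • (J ∘ₗ T).baseChange ℂ) := by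
      rw [LinearMap.baseChange_comp]
      rfl
    rw [h1, map_smul, map_sub, map_smul, LinearMap.trace_baseChange, LinearMap.trace_baseChange,
      trace10]
    simp
  rw [← LinearMap.comp_assoc, LinearMap.trace_comp_comm', ← LinearMap.comp_assoc, hP,
    LinearMap.comp_smul, map_smul, LinearMap.comp_sub, LinearMap.comp_smul, map_sub, map_smul,
    key, key]
  simp

/-! ### The spin representation on antiholomorphic forms -/

variable (g J b' b) in
/-- The sum `∑ c(b'_i) c(T b_i)` over dual frames. -/
def cliffordTrace (T : V →ₗ[ℝ] V) : Module.End ℂ (Forms V W) :=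
  ∑ i, clifford g J (b' i) * clifford g J (T (b i))

theorem cliffordTrace_apply (T : V →ₗ[ℝ] V) (s : Forms V W) :
    cliffordTrace g J b' b T s = ∑ i, clifford g J (b' i) (clifford g J (T (b i)) s) := by
  simp [cliffordTrace, LinearMap.sum_apply]

theorem IsDualFrame.cliffordTrace_eq (hg : ∀ v w, g v w = g w v) (h : IsDualFrame g b' b)
    (hc : IsDualFrame g c' c) (T : V →ₗ[ℝ] V) :
    (cliffordTrace g J b' b T : Module.End ℂ (Forms V W)) = cliffordTrace g J c' c T := by
  let β : V →ₗ[ℝ] V →ₗ[ℝ] Module.End ℂ (Forms V W) :=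
    (LinearMap.mul ℝ (Module.End ℂ (Forms V W))).compl₁₂ (cliffordL W g J)
      (cliffordL W g J ∘ₗ T)
  exact h.sum_eq hg hc β

theorem cliffordTrace_add (T S : V →ₗ[ℝ] V) :
    (cliffordTrace g J b' b (T + S) : Module.End ℂ (Forms V W))
      = cliffordTrace g J b' b T + cliffordTrace g J b' b S := by
  refine LinearMap.ext fun s => ?_
  simp [cliffordTrace_apply, clifford_add, Finset.sum_add_distrib]

theorem cliffordTrace_smul (a : ℝ) (T : V →ₗ[ℝ] V) :
    (cliffordTrace g J b' b (a • T) : Module.End ℂ (Forms V W))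
      = (a : ℂ) • cliffordTrace g J b' b T := by
  refine LinearMap.ext fun s => ?_
  simp only [cliffordTrace_apply, clifford_smul, LinearMap.smul_apply, map_smul, Finset.smul_sum]

theorem cliffordTrace_sum {α : Type*} (a : Finset α) (T : α → V →ₗ[ℝ] V) :
    (cliffordTrace g J b' b (∑ i ∈ a, T i) : Module.End ℂ (Forms V W))
      = ∑ i ∈ a, cliffordTrace g J b' b (T i) := by
  induction a using Finset.cons_induction with
  | empty =>
    have := cliffordTrace_smul (W := W) (g := g) (J := J) (b' := b') (b := b) 0 0
    simpa using this
  | cons i a ha ih => rw [Finset.sum_cons, Finset.sum_cons, cliffordTrace_add, ih]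

theorem IsDualFrame.sum_clifford_smul (h : IsDualFrame g b' b) (v : V) (s : Forms V W) :
    ∑ i, (g (b i) v : ℂ) • clifford g J (b' i) s = clifford g J v s := by
  conv_rhs => rw [← h.expand_dual v, ← cliffordL_apply, map_sum, LinearMap.sum_apply]
  refine Finset.sum_congr rfl fun i _ => ?_
  rw [cliffordL_apply, clifford_smul]

/-- The Clifford trace of the rank one endomorphism `v ↦ α(v) u`, with `α = g(a, ·)`. -/
theorem IsDualFrame.cliffordTrace_smulRight (h : IsDualFrame g b' b) (H : IsHermitianPair g J)
    (a u : V) : (cliffordTrace g J b' b ((g a).smulRight u) : Module.End ℂ (Forms V W))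
      = clifford g J a * clifford g J u := by
  refine LinearMap.ext fun s => ?_
  rw [cliffordTrace_apply, Module.End.mul_apply, ← h.sum_clifford_smul a]
  refine Finset.sum_congr rfl fun i _ => ?_
  rw [LinearMap.smulRight_apply, clifford_smul, map_smul, H.symm]

/-- The commutator of the spin representation of a skew endomorphism with the Clifford action. -/
theorem IsDualFrame.cliffordTrace_clifford (h : IsDualFrame g b' b) (H : IsHermitianPair g J)
    {S : V →ₗ[ℝ] V} (hS : ∀ v w, g (S v) w = -g v (S w)) (v : V) (s : Forms V W) :
    cliffordTrace g J b' b S (clifford g J v s)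
      = clifford g J v (cliffordTrace g J b' b S s) + (4 : ℂ) • clifford g J (S v) s := by
  have h1 : ∀ i, clifford g J (b' i) (clifford g J (S (b i)) (clifford g J v s))
      = clifford g J v (clifford g J (b' i) (clifford g J (S (b i)) s))
        + (2 : ℂ) • ((g (b' i) v : ℂ) • clifford g J (S (b i)) s)
        + (2 : ℂ) • ((g (b i) (S v) : ℂ) • clifford g J (b' i) s) := fun i => by
    have e1 := H.clifford_anticomm (S (b i)) v s
    have e2 := H.clifford_anticomm (b' i) v (clifford g J (S (b i)) s)
    have e1' := congrArg (clifford g J (b' i)) (eq_sub_of_add_eq e1)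
    rw [map_sub, map_neg, map_smul, eq_sub_of_add_eq e2, hS] at e1'
    rw [e1']
    push_cast
    module
  have h2 : ∑ i, (g (b' i) v : ℂ) • clifford g J (S (b i)) s = clifford g J (S v) s := by
    conv_rhs => rw [← h.expand v, map_sum, ← cliffordL_apply, map_sum, LinearMap.sum_apply]
    refine Finset.sum_congr rfl fun i _ => ?_
    rw [map_smul, cliffordL_apply, clifford_smul]
  rw [cliffordTrace_apply, Finset.sum_congr rfl fun i _ => h1 i, Finset.sum_add_distrib,
    Finset.sum_add_distrib, ← Finset.smul_sum, ← Finset.smul_sum, h2, h.sum_clifford_smul,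
    cliffordTrace_apply, map_sum]
  module

theorem derivationAct_apply_succ (Γ : V →ₗ[ℝ] V) (s : Forms V W) (q : ℕ) (w : Fin (q + 1) → V) :
    derivationAct Γ s (q + 1) w
      = ∑ i : Fin (q + 1), (-1 : ℂ) ^ (i : ℕ) • s (q + 1) (Fin.cons (Γ (w i)) (i.removeNth w)) := by
  have : derivationAct Γ s (q + 1)
    = AlternatingMap.alternatizeUncurryFin ((s (q + 1)).curryLeft ∘ₗ Γ) := rfl
  rw [this, AlternatingMap.alternatizeUncurryFin_apply]
  refine Finset.sum_congr rfl fun i _ => ?_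
  rw [← Int.cast_smul_eq_zsmul ℂ]
  push_cast
  rfl

/-- The derivation induced by `Γ` is `∑ b^i ∧ i_{Γ b_i}`. -/
theorem IsDualFrame.derivationAct_eq (h : IsDualFrame g b' b) (Γ : V →ₗ[ℝ] V) (s : Forms V W) :
    derivationAct Γ s = ∑ i, wedge (Complex.ofRealCLM.toLinearMap ∘ₗ g (b' i))
      (contract (Γ (b i)) s) := by
  refine Forms.ext_apply fun q w => ?_
  rw [Forms.sum_apply]
  cases q with
  | zero => simp [wedge_apply_zero, derivationAct_apply]
  | succ q =>
    simp only [derivationAct_apply_succ, wedge_apply_succ]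
    rw [Finset.sum_comm]
    refine Finset.sum_congr rfl fun k _ => ?_
    rw [← Finset.smul_sum]
    congr 1
    let ℓ : V →ₗ[ℝ] W :=
      { toFun := fun x => (s (q + 1)).curryLeft (Γ x) (k.removeNth w)
        map_add' := by simp
        map_smul' := by simp }
    have h2 : (s (q + 1)) (Fin.cons (Γ (w k)) (k.removeNth w)) = ℓ (w k) := rfl
    rw [h2]
    conv_lhs => rw [← h.expand (w k), map_sum]
    refine Finset.sum_congr rfl fun i _ => ?_
    rw [map_smul]
    simp [contract_apply]
    rfl

/-- The product of two Clifford multiplications in terms of exterior multiplications and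
contractions. -/
theorem IsHermitianPair.clifford_clifford_expand (H : IsHermitianPair g J) (v w : V)
    (s : Forms V W) : clifford g J v (clifford g J w s)
      = (2 : ℂ) • (wedge (dual10 g J v) (wedge (dual10 g J w) s)
        + contract01 J v (contract01 J w s)
        + wedge (dual10 g J w) (contract01 J v s)
        - wedge (dual10 g J v) (contract01 J w s) - dual10 g J w v • s) := by
  have h1 : (1 / 2 : ℂ) * (dual10 g J w v + Complex.I * dual10 g J w (J v)) = dual10 g J w v := by
    rw [H.dual10_J_apply]
    linear_combination (-(1 / 2 : ℂ) * dual10 g J w v) * Complex.I_mul_I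
  simp only [clifford_apply, map_smul, map_sub, contract01_wedge, h1]
  have h2 : (Real.sqrt 2 : ℂ) * Real.sqrt 2 = 2 := sqrt_two_mul_self
  rw [← smul_sub, smul_smul, h2]
  module

/-- On antiholomorphic forms, the action by a skew endomorphism that commutes with `J` as a
derivation differs from its spin representation by half its trace over `V^{1,0}`. -/
theorem IsDualFrame.derivationAct_eq_cliffordTrace [FiniteDimensional ℝ V]
    (h : IsDualFrame g b' b) (H : IsHermitianPair g J)
    {Γ : V →ₗ[ℝ] V} (hskew : ∀ v w, g (Γ v) w = -g v (Γ w)) (hJ : ∀ v, Γ (J v) = J (Γ v))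
    {s : Forms V W} (hs : s ∈ forms01 W J) :
    derivationAct Γ s = -((1 / 4 : ℂ) • cliffordTrace g J b' b Γ s)
      - ((1 / 2 : ℂ) * trace10 J Γ) • s := by
  -- the wedge part and the contraction part vanish, since they change sign under `b ↦ J b`
  have hzero : ∀ β : V →ₗ[ℝ] V →ₗ[ℝ] Forms V W, (∀ v w, β (J v) (J w) = -β v w) →
      ∑ i, β (b' i) (Γ (b i)) = 0 := by
    intro β hβ
    have e := h.sum_eq H.symm (h.map_J H) (β.compl₂ Γ)
    simp only [LinearMap.compl₂_apply, hJ, hβ, Finset.sum_neg_distrib] at e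
    have e2 : ∀ x : Forms V W, x = -x → x = 0 := fun x hx => by
      have h2 : (2 : ℂ) • x = 0 := by
        rw [two_smul]
        nth_rewrite 1 [hx]
        simp
      exact (smul_eq_zero_iff_right two_ne_zero).1 h2
    exact e2 _ e
  have hww : ∑ i, wedge (dual10 g J (b' i)) (wedge (dual10 g J (Γ (b i))) s) = 0 := by
    refine hzero (LinearMap.mk₂ ℝ (fun v w => wedge (dual10 g J v) (wedge (dual10 g J w) s))
      ?_ ?_ ?_ ?_) ?_
    · intros; simp [dual10_add, wedge_add_left]
    · intros; rw [dual10_smul, wedge_smul_left]; rfl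
    · intros; simp [dual10_add, wedge_add_left]
    · intros; rw [dual10_smul, wedge_smul_left]; first | rfl | (rw [map_smul]; rfl)
    · intro v w
      simp only [LinearMap.mk₂_apply, H.dual10_J, wedge_smul_left, map_smul, smul_smul,
        Complex.I_mul_I]
      simp
  have hcc : ∑ i, contract01 J (b' i) (contract01 J (Γ (b i)) s) = 0 := by
    refine hzero (LinearMap.mk₂ ℝ (fun v w => contract01 J v (contract01 J w s))
      ?_ ?_ ?_ ?_) ?_
    · intros; simp [contract01_add]
    · intros; simp [contract01_smul]
    · intros; simp [contract01_add]
    · intros; simp [contract01_smul]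
    · intro v w
      simp only [LinearMap.mk₂_apply, H.contract01_J, map_neg, map_smul, smul_neg, neg_neg,
        smul_smul, Complex.I_mul_I]
      simp
  have hwc : ∑ i, wedge (dual10 g J (Γ (b i))) (contract01 J (b' i) s)
      = -∑ i, wedge (dual10 g J (b' i)) (contract01 J (Γ (b i)) s) := by
    let β : V →ₗ[ℝ] V →ₗ[ℝ] Forms V W :=
      LinearMap.mk₂ ℝ (fun v w => wedge (dual10 g J w) (contract01 J v s))
        (by intros; simp [contract01_add]) (by intros; simp [contract01_smul])
        (by intros; simp [dual10_add, wedge_add_left])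
        (by intros; rw [dual10_smul, wedge_smul_left]; rfl)
    have e1 := h.sum_adjoint β H.symm (T := Γ) (S := -Γ) (fun v w => by simp [hskew])
    have e2 := h.sum_eq H.symm h.swap (β ∘ₗ Γ)
    simp only [LinearMap.neg_apply, map_neg, Finset.sum_neg_distrib] at e1
    exact e1.trans (congrArg Neg.neg e2)
  have hder : ∑ i, wedge (dual10 g J (b' i)) (contract01 J (Γ (b i)) s) = derivationAct Γ s := by
    let β : V →ₗ[ℝ] V →ₗ[ℝ] Forms V W :=
      LinearMap.mk₂ ℝ (fun v w => wedge (Complex.ofRealCLM.toLinearMap ∘ₗ g v) (contract (Γ w) s))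
        (by intros; rw [map_add, LinearMap.comp_add, wedge_add_left])
        (by
          intro c v w
          have : Complex.ofRealCLM.toLinearMap ∘ₗ g (c • v)
            = (c : ℂ) • (Complex.ofRealCLM.toLinearMap ∘ₗ g v) := by ext; simp
          rw [this, wedge_smul_left]
          rfl)
        (by intros; rw [map_add, contract_add, map_add])
        (by intros; rw [map_smul, contract_smul, map_smul]; rfl)
    have e0 : ∑ i, β (b' i) (b i) = derivationAct Γ s := (h.derivationAct_eq Γ s).symm
    have e1 : ∑ i, β (J (b' i)) (b i) = Complex.I • derivationAct Γ s := by
      rw [← h.sum_adjoint β H.symm (T := -J) (S := J) (fun v w => by simp [H.skew]),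
        ← e0, Finset.smul_sum]
      refine Finset.sum_congr rfl fun i _ => ?_
      simp only [β, LinearMap.mk₂_apply, LinearMap.neg_apply, hJ, map_neg Γ]
      have : contract (-J (Γ (b i))) s = Complex.I • contract (Γ (b i)) s := by
        have hn : contract (-J (Γ (b i))) s = -contract (J (Γ (b i))) s := by
          rw [← neg_one_smul ℝ, contract_smul]; simp
        rw [hn, contract_J_of_mem hs, neg_neg]
      rw [this, map_smul]
    have e2 : ∀ i, wedge (dual10 g J (b' i)) (contract01 J (Γ (b i)) s)
        = (1 / 2 : ℂ) • β (b' i) (b i) - (Complex.I / 2) • β (J (b' i)) (b i) := fun i => by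
      have : dual10 g J (b' i) = (1 / 2 : ℂ) • (Complex.ofRealCLM.toLinearMap ∘ₗ g (b' i))
          + (-(Complex.I / 2)) • (Complex.ofRealCLM.toLinearMap ∘ₗ g (J (b' i))) := by
        ext w
        simp [dual10_apply, sub_eq_add_neg]
      rw [contract01_of_mem hs, this, wedge_add_left, wedge_smul_left, wedge_smul_left]
      simp only [β, LinearMap.mk₂_apply, neg_smul, sub_eq_add_neg]
    rw [Finset.sum_congr rfl fun i _ => e2 i, Finset.sum_sub_distrib, ← Finset.smul_sum,
      ← Finset.smul_sum, e0, e1, smul_smul]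
    have : Complex.I / 2 * Complex.I = -(1 / 2 : ℂ) := by
      linear_combination (1 / 2 : ℂ) * Complex.I_mul_I
    rw [this]
    module
  rw [cliffordTrace_apply]
  simp only [H.clifford_clifford_expand]
  rw [← Finset.smul_sum, Finset.sum_sub_distrib, Finset.sum_sub_distrib, Finset.sum_add_distrib,
    Finset.sum_add_distrib, hww, hcc, hwc, hder, ← Finset.sum_smul, ← h.trace10_eq H]
  module

end Frames

/-! ### Directional derivatives on manifolds -/

section Calculus

variable {E : Type*} [NormedAddCommGroup E] [NormedSpace ℝ E]
  {M : Type*} [TopologicalSpace M] [ChartedSpace E M]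
  {F : Type*} [NormedAddCommGroup F] [NormedSpace ℝ F]
  {F₁ : Type*} [NormedAddCommGroup F₁] [NormedSpace ℝ F₁]
  {F₂ : Type*} [NormedAddCommGroup F₂] [NormedSpace ℝ F₂]

/-- The function `f` is differentiable at `m`, with derivative `f'` in the direction `v`. -/
structure HasDirDeriv (f : M → F) (m : M) (v : TangentSpace 𝓘(ℝ, E) m) (f' : F) : Prop where
  diff : MDifferentiableAt 𝓘(ℝ, E) 𝓘(ℝ, F) f m
  eq : mvfderiv 𝓘(ℝ, E) f m v = f'

variable {m : M} {v : TangentSpace 𝓘(ℝ, E) m} {f : M → F} {f' : F}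

theorem hasDirDeriv (hf : MDifferentiableAt 𝓘(ℝ, E) 𝓘(ℝ, F) f m)
    (v : TangentSpace 𝓘(ℝ, E) m) : HasDirDeriv f m v (mvfderiv 𝓘(ℝ, E) f m v) := ⟨hf, rfl⟩

theorem HasDirDeriv.comp {φ : F → F₁} {φ' : F →L[ℝ] F₁} (hf : HasDirDeriv f m v f')
    (hφ : HasFDerivAt φ φ' (f m)) : HasDirDeriv (fun x => φ (f x)) m v (φ' f') := by
  have h1 : HasMFDerivAt 𝓘(ℝ, F) 𝓘(ℝ, F₁) φ (f m) φ' := hφ.hasMFDerivAt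
  have h2 := h1.comp m hf.diff.hasMFDerivAt
  refine ⟨h2.mdifferentiableAt, ?_⟩
  have h3 := h2.mfderiv
  rw [← hf.eq]
  exact congrArg (fun L => L v) h3

theorem HasDirDeriv.prodMk {g : M → F₁} {g' : F₁} (hf : HasDirDeriv f m v f')
    (hg : HasDirDeriv g m v g') : HasDirDeriv (fun x => (f x, g x)) m v (f', g') := by
  have h : HasMFDerivAt 𝓘(ℝ, E) 𝓘(ℝ, F × F₁) (fun x => (f x, g x)) m
      ((mvfderiv 𝓘(ℝ, E) f m).prod (mvfderiv 𝓘(ℝ, E) g m)) :=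
    ⟨hf.diff.continuousAt.prodMk hg.diff.continuousAt,
      hf.diff.hasMFDerivAt.2.prodMk hg.diff.hasMFDerivAt.2⟩
  refine ⟨h.mdifferentiableAt, ?_⟩
  have h3 := h.mfderiv
  rw [← hf.eq, ← hg.eq]
  exact congrArg (fun L => L v) h3

theorem HasDirDeriv.pi {ι : Type*} [Fintype ι] {f : ι → M → F} {f' : ι → F}
    (hf : ∀ i, HasDirDeriv (f i) m v (f' i)) : HasDirDeriv (fun x i => f i x) m v f' := by
  have h : HasMFDerivAt 𝓘(ℝ, E) 𝓘(ℝ, ι → F) (fun x i => f i x) m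
      (ContinuousLinearMap.pi fun i => (mvfderiv 𝓘(ℝ, E) (f i) m :)) :=
    ⟨continuousAt_pi.2 fun i => (hf i).diff.continuousAt,
      hasFDerivWithinAt_pi.2 fun i => (hf i).diff.hasMFDerivAt.2⟩
  refine ⟨h.mdifferentiableAt, ?_⟩
  have h3 := h.mfderiv
  funext i
  rw [← (hf i).eq]
  exact congrFun (congrArg (fun L => L v) h3) i

theorem HasDirDeriv.congr {g : M → F} (hf : HasDirDeriv f m v f') (h : g =ᶠ[𝓝 m] f) :
    HasDirDeriv g m v f' := by
  have h1 := hf.diff.hasMFDerivAt.congr_of_eventuallyEq h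
  refine ⟨h1.mdifferentiableAt, ?_⟩
  have h3 := h1.mfderiv
  rw [← hf.eq]
  exact congrArg (fun L => L v) h3

theorem hasDirDeriv_const (a : F) : HasDirDeriv (fun _ : M => a) m v 0 :=
  ⟨mdifferentiableAt_const, by rw [mvfderiv_const]; rfl⟩

theorem HasDirDeriv.clm (L : F →L[ℝ] F₁) (hf : HasDirDeriv f m v f') :
    HasDirDeriv (fun x => L (f x)) m v (L f') := hf.comp L.hasFDerivAt

theorem HasDirDeriv.add {g : M → F} {g' : F} (hf : HasDirDeriv f m v f')
    (hg : HasDirDeriv g m v g') : HasDirDeriv (fun x => f x + g x) m v (f' + g') :=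
  (hf.prodMk hg).clm (ContinuousLinearMap.fst ℝ F F + ContinuousLinearMap.snd ℝ F F)

theorem HasDirDeriv.sub {g : M → F} {g' : F} (hf : HasDirDeriv f m v f')
    (hg : HasDirDeriv g m v g') : HasDirDeriv (fun x => f x - g x) m v (f' - g') :=
  (hf.prodMk hg).clm (ContinuousLinearMap.fst ℝ F F - ContinuousLinearMap.snd ℝ F F)

theorem HasDirDeriv.sum {ι : Type*} (s : Finset ι) {f : ι → M → F} {f' : ι → F}
    (hf : ∀ i ∈ s, HasDirDeriv (f i) m v (f' i)) :
    HasDirDeriv (fun x => ∑ i ∈ s, f i x) m v (∑ i ∈ s, f' i) := by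
  induction s using Finset.cons_induction with
  | empty => exact hasDirDeriv_const 0
  | cons i s hi ih =>
    simp only [Finset.sum_cons]
    exact (hf i (Finset.mem_cons_self i s)).add
      (ih fun j hj => hf j (Finset.mem_cons_of_mem hj))

theorem HasDirDeriv.bilin {g : M → F₁} {g' : F₁} (B : F →L[ℝ] F₁ →L[ℝ] F₂)
    (hf : HasDirDeriv f m v f') (hg : HasDirDeriv g m v g') :
    HasDirDeriv (fun x => B (f x) (g x)) m v (B f' (g m) + B (f m) g') := by
  have h := (hf.prodMk hg).comp (B.isBoundedBilinearMap.hasFDerivAt (f m, g m))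
  refine ⟨h.diff, h.eq.trans ?_⟩
  simp [add_comm]

theorem HasDirDeriv.mul {A : Type*} [NormedRing A] [NormedAlgebra ℝ A] {a b : M → A} {a' b' : A}
    (ha : HasDirDeriv a m v a') (hb : HasDirDeriv b m v b') :
    HasDirDeriv (fun x => a x * b x) m v (a' * b m + a m * b') :=
  ha.bilin (ContinuousLinearMap.mul ℝ A) hb

theorem HasDirDeriv.pow {a : M → ℂ} {a' : ℂ} (ha : HasDirDeriv a m v a') (p : ℕ) :
    HasDirDeriv (fun x => a x ^ p) m v ((p : ℂ) * a m ^ (p - 1) * a') := by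
  have h := (hasDerivAt_pow p (a m)).hasFDerivAt.restrictScalars ℝ
  have h2 := ha.comp h
  refine ⟨h2.diff, h2.eq.trans ?_⟩
  simp [mul_comm]

/-- The Leibniz rule for the evaluation of alternating forms. -/
theorem HasDirDeriv.alternating_apply {q : ℕ} {T : M → F [⋀^Fin q]→L[ℝ] F₁}
    {T' : F [⋀^Fin q]→L[ℝ] F₁} {y : Fin q → M → F} {y' : Fin q → F}
    (hT : HasDirDeriv T m v T') (hy : ∀ i, HasDirDeriv (y i) m v (y' i)) :
    HasDirDeriv (fun x => T x (fun i => y i x)) m v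
      (T' (fun i => y i m) + ∑ i, T m (Function.update (fun i => y i m) i (y' i))) := by
  have h1 : HasFDerivAt (fun z : (F [⋀^Fin q]→L[ℝ] F₁) × (Fin q → F) => z.1 (fun i => z.2 i)) _
      (T m, fun i => y i m) :=
    HasFDerivAt.continuousAlternatingMap_apply
      (f := fun z : (F [⋀^Fin q]→L[ℝ] F₁) × (Fin q → F) => z.1) (g := fun i z => z.2 i)
      (f' := ContinuousLinearMap.fst ℝ (F [⋀^Fin q]→L[ℝ] F₁) (Fin q → F))
      hasFDerivAt_fst
      (g' := fun i => (ContinuousLinearMap.proj i).comp (ContinuousLinearMap.snd ℝ _ _))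
      (fun i => ((ContinuousLinearMap.proj (R := ℝ) (φ := fun _ : Fin q => F) i).comp
        (ContinuousLinearMap.snd ℝ (F [⋀^Fin q]→L[ℝ] F₁) (Fin q → F))).hasFDerivAt)
  have h2 := (hT.prodMk (HasDirDeriv.pi hy)).comp h1
  refine ⟨h2.diff, h2.eq.trans ?_⟩
  simp

theorem HasDirDeriv.unique {f'' : F} (h : HasDirDeriv f m v f') (h' : HasDirDeriv f m v f'') :
    f' = f'' := h.eq.symm.trans h'.eq

/-- The derivative of a function along a smooth vector field is smooth. -/
theorem contMDiffAt_mvfderiv [IsManifold 𝓘(ℝ, E) ∞ M] {Y : ∀ x : M, TangentSpace 𝓘(ℝ, E) x}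
    (hf : ContMDiffAt 𝓘(ℝ, E) 𝓘(ℝ, F) ∞ f m)
    (hY : ContMDiffAt 𝓘(ℝ, E) (𝓘(ℝ, E).prod 𝓘(ℝ, E)) ∞
      (fun x => TotalSpace.mk' E (E := TangentSpace 𝓘(ℝ, E)) x (Y x)) m) :
    ContMDiffAt 𝓘(ℝ, E) 𝓘(ℝ, F) ∞ (fun x => mvfderiv 𝓘(ℝ, E) f x (Y x)) m := by
  have : IsManifold 𝓘(ℝ, E) 1 M := IsManifold.of_le (n := ∞) (by exact_mod_cast le_top)
  have h1 := hf.mfderiv_const (m := ∞) (by norm_num)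
  have h2 := ContMDiffAt.clm_apply_of_inCoordinates (IM := 𝓘(ℝ, E)) (E₁ := TangentSpace 𝓘(ℝ, E))
    (E₂ := TangentSpace 𝓘(ℝ, F)) (b₁ := id) (b₂ := f) (v := Y)
    (ϕ := fun x => mfderiv 𝓘(ℝ, E) 𝓘(ℝ, F) f x) h1 hY hf
  exact (contMDiff_snd_tangentBundle_modelSpace F 𝓘(ℝ, F)).contMDiffAt.comp m h2

end Calculus

/-! ### Extension of local sections -/

section Extension

variable {E : Type*} [NormedAddCommGroup E] [NormedSpace ℝ E] [FiniteDimensional ℝ E]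
  {M : Type*} [TopologicalSpace M] [ChartedSpace E M] [IsManifold 𝓘(ℝ, E) ∞ M] [T2Space M]
  {F : Type*} [NormedAddCommGroup F] [NormedSpace ℝ F]
  {V : M → Type*} [TopologicalSpace (TotalSpace F V)] [∀ x, AddCommGroup (V x)]
  [∀ x, Module ℝ (V x)] [∀ x, TopologicalSpace (V x)] [FiberBundle F V] [VectorBundle ℝ F V]

/-- A section that is smooth near `m` agrees near `m` with a globally smooth section. -/
theorem exists_contMDiff_section_eventuallyEq {s : ∀ x, V x} {u : Set M} {m : M} (hu : IsOpen u)
    (hm : m ∈ u) (hs : ContMDiffOn 𝓘(ℝ, E) (𝓘(ℝ, E).prod 𝓘(ℝ, F)) ∞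
      (fun x => TotalSpace.mk' F x (s x)) u) :
    ∃ t : ∀ x, V x, ContMDiff 𝓘(ℝ, E) (𝓘(ℝ, E).prod 𝓘(ℝ, F)) ∞
      (fun x => TotalSpace.mk' F x (t x)) ∧ ∀ᶠ x in 𝓝 m, t x = s x := by
  obtain ⟨ψ, -, hψ⟩ := (SmoothBumpFunction.nhds_basis_tsupport (I := 𝓘(ℝ, E)) m).mem_iff.1
    (hu.mem_nhds hm)
  refine ⟨(ψ : M → ℝ) • s, ContMDiffOn.smul_section_of_tsupport ψ.contMDiff.contMDiffOn hu hψ hs,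
    ?_⟩
  filter_upwards [ψ.eventuallyEq_one] with x hx
  simp [hx]

end Extension

/-! ### Coordinates on the tangent bundle -/

section TangentCoordinates

variable {E : Type*} [NormedAddCommGroup E] [NormedSpace ℝ E]
  {M : Type*} [TopologicalSpace M] [ChartedSpace E M] [IsManifold 𝓘(ℝ, E) ∞ M]

/-- A vector field is smooth at a point. -/
def SmoothVFieldAt (X : VField E M) (m : M) : Prop :=
  ContMDiffAt 𝓘(ℝ, E) (𝓘(ℝ, E).prod 𝓘(ℝ, E)) ∞
    (fun m => TotalSpace.mk' E (E := TangentSpace 𝓘(ℝ, E)) m (X m)) m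

variable (E) in
/-- The coordinates at `x` of tangent vectors in the trivialization of `TM` at `m`. -/
def tangentCoord (m x : M) : TangentSpace 𝓘(ℝ, E) x →L[ℝ] E :=
  (trivializationAt E (TangentSpace 𝓘(ℝ, E)) m).continuousLinearMapAt ℝ x

/-- The tangent vector at `x` with given coordinates in the trivialization of `TM` at `m`. -/
def tangentVec (m x : M) : E →L[ℝ] TangentSpace 𝓘(ℝ, E) x :=
  (trivializationAt E (TangentSpace 𝓘(ℝ, E)) m).symmL ℝ x

theorem tangentVec_tangentCoord {m x : M} (hx : x ∈ (chartAt E m).source)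
    (v : TangentSpace 𝓘(ℝ, E) x) : tangentVec m x (tangentCoord E m x v) = v :=
  (trivializationAt E (TangentSpace 𝓘(ℝ, E)) m).symmL_continuousLinearMapAt hx v

theorem tangentCoord_tangentVec {m x : M} (hx : x ∈ (chartAt E m).source) (w : E) :
    tangentCoord E m x (tangentVec m x w) = w :=
  (trivializationAt E (TangentSpace 𝓘(ℝ, E)) m).continuousLinearMapAt_symmL hx w

theorem eventually_mem_chart_source {m x : M} (hx : x ∈ (chartAt E m).source) :
    ∀ᶠ y in 𝓝 x, y ∈ (chartAt E m).source :=
  (chartAt E m).open_source.mem_nhds hx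

theorem tangentCoord_eq {m x : M} (hx : x ∈ (chartAt E m).source) (v : TangentSpace 𝓘(ℝ, E) x) :
    tangentCoord E m x v
      = ((trivializationAt E (TangentSpace 𝓘(ℝ, E)) m) ⟨x, v⟩).2 := by
  have h : x ∈ (trivializationAt E (TangentSpace 𝓘(ℝ, E)) m).baseSet := hx
  exact congrFun (Trivialization.coe_linearMapAt_of_mem (R := ℝ) _ h) v

theorem smoothVFieldAt_iff {Y : VField E M} {m x : M} (hx : x ∈ (chartAt E m).source) :
    SmoothVFieldAt Y x
      ↔ ContMDiffAt 𝓘(ℝ, E) 𝓘(ℝ, E) ∞ (fun y => tangentCoord E m y (Y y)) x := by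
  have h : x ∈ (trivializationAt E (TangentSpace 𝓘(ℝ, E)) m).baseSet := hx
  have h2 : (fun y => tangentCoord E m y (Y y))
      =ᶠ[𝓝 x] fun y => ((trivializationAt E (TangentSpace 𝓘(ℝ, E)) m) ⟨y, Y y⟩).2 :=
    (eventually_mem_chart_source hx).mono fun y hy => tangentCoord_eq hy _
  rw [h2.contMDiffAt_iff]
  exact Trivialization.contMDiffAt_section_iff _ h

theorem diffVFieldAt_iff {Y : VField E M} {m x : M} (hx : x ∈ (chartAt E m).source) :
    DiffVFieldAt Y x
      ↔ MDifferentiableAt 𝓘(ℝ, E) 𝓘(ℝ, E) (fun y => tangentCoord E m y (Y y)) x := by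
  have h : x ∈ (trivializationAt E (TangentSpace 𝓘(ℝ, E)) m).baseSet := hx
  have : ContMDiffVectorBundle 1 E (TangentSpace 𝓘(ℝ, E) : M → Type _) 𝓘(ℝ, E) :=
    ContMDiffVectorBundle.of_le (n := ∞) (by exact_mod_cast le_top)
  have h2 : (fun y => tangentCoord E m y (Y y))
      =ᶠ[𝓝 x] fun y => ((trivializationAt E (TangentSpace 𝓘(ℝ, E)) m) ⟨y, Y y⟩).2 :=
    (eventually_mem_chart_source hx).mono fun y hy => tangentCoord_eq hy _
  rw [h2.mdifferentiableAt_iff]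
  exact Trivialization.mdifferentiableAt_section_iff 𝓘(ℝ, E) _ Y h

theorem SmoothVFieldAt.diff {Y : VField E M} {x : M} (h : SmoothVFieldAt Y x) :
    DiffVFieldAt Y x := ContMDiffAt.mdifferentiableAt h (by simp)

theorem SmoothVFieldAt.congr {Y Z : VField E M} {x : M} (h : SmoothVFieldAt Y x)
    (hZ : ∀ᶠ y in 𝓝 x, Z y = Y y) : SmoothVFieldAt Z x :=
  ContMDiffAt.congr_of_eventuallyEq h (hZ.mono fun y hy => by simp [hy])

theorem DiffVFieldAt.congr {Y Z : VField E M} {x : M} (h : DiffVFieldAt Y x)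
    (hZ : ∀ᶠ y in 𝓝 x, Z y = Y y) : DiffVFieldAt Z x :=
  MDifferentiableAt.congr_of_eventuallyEq h (hZ.mono fun y hy => by simp [hy])

theorem smoothVFieldAt_tangentVec {m x : M} (hx : x ∈ (chartAt E m).source) (w : E) :
    SmoothVFieldAt (fun y => tangentVec m y w) x := by
  rw [smoothVFieldAt_iff hx]
  refine (contMDiffAt_const (c := w)).congr_of_eventuallyEq ?_
  exact (eventually_mem_chart_source hx).mono fun y hy => tangentCoord_tangentVec hy w

theorem diffVFieldAt_tangentVec {m x : M} (hx : x ∈ (chartAt E m).source) (w : E) :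
    DiffVFieldAt (fun y => tangentVec m y w) x := (smoothVFieldAt_tangentVec hx w).diff

theorem DiffVFieldAt.add {Y Z : VField E M} {x : M} (hY : DiffVFieldAt Y x)
    (hZ : DiffVFieldAt Z x) : DiffVFieldAt (fun y => Y y + Z y) x :=
  mdifferentiableAt_add_section hY hZ

theorem DiffVFieldAt.sub {Y Z : VField E M} {x : M} (hY : DiffVFieldAt Y x)
    (hZ : DiffVFieldAt Z x) : DiffVFieldAt (fun y => Y y - Z y) x :=
  mdifferentiableAt_sub_section hY hZ

theorem DiffVFieldAt.smul {f : M → ℝ} {Y : VField E M} {x : M}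
    (hf : MDifferentiableAt 𝓘(ℝ, E) 𝓘(ℝ, ℝ) f x) (hY : DiffVFieldAt Y x) :
    DiffVFieldAt (fun y => f y • Y y) x := MDifferentiableAt.smul_section hf hY

theorem SmoothVFieldAt.sub {Y Z : VField E M} {x : M} (hY : SmoothVFieldAt Y x)
    (hZ : SmoothVFieldAt Z x) : SmoothVFieldAt (fun y => Y y - Z y) x :=
  ContMDiffAt.sub_section hY hZ

theorem SmoothVFieldAt.smul {f : M → ℝ} {Y : VField E M} {x : M}
    (hf : ContMDiffAt 𝓘(ℝ, E) 𝓘(ℝ, ℝ) ∞ f x) (hY : SmoothVFieldAt Y x) :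
    SmoothVFieldAt (fun y => f y • Y y) x := ContMDiffAt.smul_section hf hY

theorem SmoothVFieldAt.sum {ι : Type*} {s : Finset ι} {Y : ι → VField E M} {x : M}
    (hY : ∀ i ∈ s, SmoothVFieldAt (Y i) x) : SmoothVFieldAt (fun y => ∑ i ∈ s, Y i y) x :=
  ContMDiffAt.sum_section hY

variable [FiniteDimensional ℝ E]

theorem coordField_eq (m : M) (i : Fin (Module.finrank ℝ E)) (x : M) :
    coordField m i x = tangentVec m x (Module.finBasis ℝ E i) := rfl

theorem tangentBasis_apply (m : M) (i : Fin (Module.finrank ℝ E)) :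
    tangentBasis m i = coordField m i m := by
  simp only [tangentBasis, Module.Basis.map_apply, coordField]
  exact congrFun (Trivialization.symm_continuousLinearEquivAt_eq _ _) _

theorem smoothVFieldAt_coordField {m x : M} (hx : x ∈ (chartAt E m).source)
    (i : Fin (Module.finrank ℝ E)) : SmoothVFieldAt (coordField m i) x :=
  smoothVFieldAt_tangentVec hx _

/-- Expansion of a vector field in the frame of coordinate fields. -/
theorem sum_coordField {m x : M} (hx : x ∈ (chartAt E m).source) (v : TangentSpace 𝓘(ℝ, E) x) :
    ∑ i, (Module.finBasis ℝ E).equivFunL (tangentCoord E m x v) i • coordField m i x = v := by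
  conv_rhs => rw [← tangentVec_tangentCoord hx v,
    ← (Module.finBasis ℝ E).sum_equivFun (tangentCoord E m x v), map_sum]
  refine Finset.sum_congr rfl fun i _ => ?_
  rw [map_smul]
  rfl

end TangentCoordinates

/-! ### Coordinates on powers of the line bundle -/

section LineCoordinates

variable {E : Type*} [NormedAddCommGroup E] [NormedSpace ℝ E] [FiniteDimensional ℝ E]
  {M : Type*} [TopologicalSpace M] [ChartedSpace E M] [IsManifold 𝓘(ℝ, E) ∞ M]
  {L : M → Type*} [TopologicalSpace (TotalSpace ℂ L)]
  [∀ m, NormedAddCommGroup (L m)] [∀ m, InnerProductSpace ℂ (L m)]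
  [FiberBundle ℂ L] [VectorBundle ℂ ℂ L] [VectorBundle ℝ ℂ L]

variable (L) in
/-- The coordinate at `x` in the trivialization of `L` at `m`. -/
def lineCoord (m x : M) : L x →L[ℂ] ℂ := (trivializationAt ℂ L m).continuousLinearMapAt ℂ x

theorem lineCoord_localFrame {m x : M} (hx : x ∈ (trivializationAt ℂ L m).baseSet) :
    lineCoord L m x (localFrame L m x) = 1 :=
  (trivializationAt ℂ L m).continuousLinearMapAt_symmL hx 1

theorem lineCoord_smul_localFrame {m x : M} (hx : x ∈ (trivializationAt ℂ L m).baseSet)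
    (l : L x) : lineCoord L m x l • localFrame L m x = l := by
  conv_rhs => rw [← (trivializationAt ℂ L m).symmL_continuousLinearMapAt (R := ℂ) hx l]
  rw [localFrame, ← map_smul, smul_eq_mul, mul_one]
  rfl

theorem lineCoord_eq {m x : M} (hx : x ∈ (trivializationAt ℂ L m).baseSet) (l : L x) :
    lineCoord L m x l = (trivializationAt ℂ L m ⟨x, l⟩).2 :=
  congrFun (Trivialization.coe_linearMapAt_of_mem (R := ℂ) _ hx) l

theorem powCoord_tprod (p : ℕ) (m x : M) (l : Fin p → L x) :
    powCoord L p m x (PiTensorProduct.tprod ℂ l) = ∏ i, lineCoord L m x (l i) := by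
  rw [powCoord, PiTensorProduct.lift.tprod]
  simp [lineCoord]

theorem tprod_localFrame_smul {p : ℕ} {m x : M} (hx : x ∈ (trivializationAt ℂ L m).baseSet)
    (t : LPow L p x) :
    powCoord L p m x t • PiTensorProduct.tprod ℂ (fun _ : Fin p => localFrame L m x) = t := by
  induction t using PiTensorProduct.induction_on with
  | smul_tprod r f =>
    rw [map_smul, powCoord_tprod, smul_assoc, ← MultilinearMap.map_smul_univ]
    simp only [lineCoord_smul_localFrame hx]
  | add a b ha hb => rw [map_add, add_smul, ha, hb]

theorem powCoord_tprod_localFrame {p : ℕ} {m x : M}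
    (hx : x ∈ (trivializationAt ℂ L m).baseSet) :
    powCoord L p m x (PiTensorProduct.tprod ℂ (fun _ : Fin p => localFrame L m x)) = 1 := by
  rw [powCoord_tprod]
  simp [lineCoord_localFrame hx]

theorem powCoord_injective {p : ℕ} {m x : M} (hx : x ∈ (trivializationAt ℂ L m).baseSet) :
    Function.Injective (powCoord L p m x) := fun s t h => by
  rw [← tprod_localFrame_smul hx s, h, tprod_localFrame_smul hx t]

/-- Change of trivialization of `L^p`. -/
theorem powCoord_change {p : ℕ} {m m' x : M} (hx : x ∈ (trivializationAt ℂ L m).baseSet)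
    (t : LPow L p x) : powCoord L p m' x t
      = lineCoord L m' x (localFrame L m x) ^ p * powCoord L p m x t := by
  conv_lhs => rw [← tprod_localFrame_smul hx t, map_smul, powCoord_tprod]
  simp [mul_comm]

theorem toModel_apply (p : ℕ) (m x : M) (q : ℕ)
    (s : TangentSpace 𝓘(ℝ, E) x [⋀^Fin q]→ₗ[ℝ] LPow L p x) (w : Fin q → E) :
    toModel p m x q s w = powCoord L p m x (s (fun i => tangentVec m x (w i))) := rfl

theorem powCoord_fromModel (p : ℕ) (m : M) (q : ℕ) (f : E [⋀^Fin q]→L[ℝ] ℂ)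
    (v : Fin q → TangentSpace 𝓘(ℝ, E) m) :
    powCoord L p m m (fromModel p m q f v) = f (fun i => tangentCoord E m m (v i)) := by
  have : fromModel (L := L) p m q f v = f (fun i => tangentCoord E m m (v i)) •
    PiTensorProduct.tprod ℂ (fun _ : Fin p => localFrame L m m) := rfl
  rw [this, map_smul, powCoord_tprod_localFrame (FiberBundle.mem_baseSet_trivializationAt' m),
    smul_eq_mul, mul_one]

theorem powCoord_eq_toModel {p : ℕ} {m x : M} (hx : x ∈ (chartAt E m).source) {q : ℕ}
    (s : TangentSpace 𝓘(ℝ, E) x [⋀^Fin q]→ₗ[ℝ] LPow L p x)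
    (v : Fin q → TangentSpace 𝓘(ℝ, E) x) :
    powCoord L p m x (s v) = toModel p m x q s (fun i => tangentCoord E m x (v i)) := by
  rw [toModel_apply]
  simp only [tangentVec_tangentCoord hx]

/-- Elements of a fibre of `Λ^* T^*M ⊗ L^p` can be compared in a trivialization of `L`. -/
theorem formFibre_ext {p : ℕ} {m x : M} (hx : x ∈ (trivializationAt ℂ L m).baseSet)
    {s t : FormFibre E L p x} (h : ∀ q w, powCoord L p m x (s q w) = powCoord L p m x (t q w)) :
    s = t := Forms.ext_apply fun q w => powCoord_injective hx (h q w)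

theorem eventually_mem_baseSet {m x : M} (hx : x ∈ (trivializationAt ℂ L m).baseSet) :
    ∀ᶠ y in 𝓝 x, y ∈ (trivializationAt ℂ L m).baseSet :=
  (trivializationAt ℂ L m).open_baseSet.mem_nhds hx

variable [ContMDiffVectorBundle ∞ ℂ L 𝓘(ℝ, E)]

theorem contMDiffAt_lineSection_iff {s : ∀ x, L x} {m x : M}
    (hx : x ∈ (trivializationAt ℂ L m).baseSet) :
    ContMDiffAt 𝓘(ℝ, E) (𝓘(ℝ, E).prod 𝓘(ℝ, ℂ)) ∞ (fun y => TotalSpace.mk' ℂ y (s y)) x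
      ↔ ContMDiffAt 𝓘(ℝ, E) 𝓘(ℝ, ℂ) ∞ (fun y => lineCoord L m y (s y)) x := by
  have h2 : (fun y => lineCoord L m y (s y))
      =ᶠ[𝓝 x] fun y => (trivializationAt ℂ L m ⟨y, s y⟩).2 :=
    (eventually_mem_baseSet hx).mono fun y hy => lineCoord_eq hy _
  rw [h2.contMDiffAt_iff]
  exact Trivialization.contMDiffAt_section_iff _ hx

theorem contMDiffAt_localFrame {m x : M} (hx : x ∈ (trivializationAt ℂ L m).baseSet) :
    ContMDiffAt 𝓘(ℝ, E) (𝓘(ℝ, E).prod 𝓘(ℝ, ℂ)) ∞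
      (fun y => TotalSpace.mk' ℂ y (localFrame L m y)) x := by
  rw [contMDiffAt_lineSection_iff hx]
  refine (contMDiffAt_const (c := (1 : ℂ))).congr_of_eventuallyEq ?_
  exact (eventually_mem_baseSet hx).mono fun y hy => lineCoord_localFrame hy

end LineCoordinates

/-! ### Vectors dual to linear functionals -/

section VecOf

variable {V : Type*} [AddCommGroup V] [Module ℝ V] [FiniteDimensional ℝ V]

/-- Existence of the vector dual to a covector. -/
theorem vecOf_spec {b : V →ₗ[ℝ] V →ₗ[ℝ] ℝ} (hb : ∀ v, b v = 0 → v = 0) (α : V →ₗ[ℝ] ℝ) :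
    b (vecOf b α) = α := by
  have hinj : Function.Injective b := (injective_iff_map_eq_zero b).2 hb
  have hsurj : Function.Surjective b :=
    (LinearMap.injective_iff_surjective_of_finrank_eq_finrank
      (Subspace.dual_finrank_eq (K := ℝ) (V := V)).symm).1 hinj
  exact Function.invFun_eq (hsurj α)

theorem vecOf_eq {b : V →ₗ[ℝ] V →ₗ[ℝ] ℝ} (hb : ∀ v, b v = 0 → v = 0) {α : V →ₗ[ℝ] ℝ} {v : V}
    (h : b v = α) : vecOf b α = v := by
  have hinj : Function.Injective b := (injective_iff_map_eq_zero b).2 hb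
  exact hinj ((vecOf_spec hb α).trans h.symm)

/-- The dual frame of a basis, given by the vectors dual to the coordinates. -/
theorem isDualFrame_vecOf_coord {ι : Type*} [Fintype ι] {g : V →ₗ[ℝ] V →ₗ[ℝ] ℝ}
    (hsymm : ∀ v w, g v w = g w v) (hb : ∀ v, g v = 0 → v = 0)
    (b : Module.Basis ι ℝ V) : IsDualFrame g (fun i => vecOf g (b.coord i)) b := by
  have h1 : ∀ v, ∑ i, g (vecOf g (b.coord i)) v • b i = v := fun v => by
    simp only [vecOf_spec hb, Module.Basis.coord_apply]
    exact b.sum_repr v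
  refine ⟨h1, fun v => ?_⟩
  have : g (∑ i, g (b i) v • vecOf g (b.coord i)) = g v := by
    ext w
    conv_rhs => rw [← h1 w]
    simp [hsymm v, mul_comm]
  exact (injective_iff_map_eq_zero g).2 hb this

end VecOf

/-! ### The metric, the almost complex structure and the symplectic form on tangent spaces -/

section TangentMetric

variable {E : Type*} [NormedAddCommGroup E] [NormedSpace ℝ E] [FiniteDimensional ℝ E]
  {M : Type*} [TopologicalSpace M] [ChartedSpace E M] [IsManifold 𝓘(ℝ, E) ∞ M]

instance (m : M) : FiniteDimensional ℝ (TangentSpace 𝓘(ℝ, E) m) :=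
  inferInstanceAs (FiniteDimensional ℝ E)

namespace AlmostKahler

variable (K : AlmostKahler E M)

theorem metric_apply (m : M) (v w : TangentSpace 𝓘(ℝ, E) m) :
    K.metric m v w = K.form m v (K.J m w) := rfl

theorem formLin_apply (m : M) (v w : TangentSpace 𝓘(ℝ, E) m) :
    K.formLin m v w = K.form m v w := rfl

theorem Jlin_apply (m : M) (v : TangentSpace 𝓘(ℝ, E) m) : K.Jlin m v = K.J m v := rfl

theorem form_skew (m : M) (v w : TangentSpace 𝓘(ℝ, E) m) : K.form m v w = -K.form m w v := by
  have h := K.alternating m (v + w)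
  simp only [map_add, add_apply, K.alternating, zero_add, add_zero] at h
  linarith

theorem hermitianPair (m : M) : IsHermitianPair (K.metric m) (K.Jlin m) where
  symm v w := K.symm m v w
  J_sq v := K.J_sq m v
  isometry v w := by
    change K.form m (K.J m v) (K.J m (K.J m w)) = K.form m v (K.J m w)
    rw [K.J_sq, map_neg, K.form_skew m (K.J m v) w, neg_neg, K.symm]

theorem metric_nondegenerate (m : M) (v : TangentSpace 𝓘(ℝ, E) m) (h : K.metric m v = 0) :
    v = 0 := by
  by_contra hv
  have := K.pos m v hv
  rw [← K.metric_apply, h] at this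
  simp at this

/-- The symplectic form in terms of the metric. -/
theorem form_eq_metric (m : M) (v w : TangentSpace 𝓘(ℝ, E) m) :
    K.form m v w = K.metric m (K.J m v) w := by
  rw [K.metric_apply, K.symm m (K.J m v) w, K.J_sq, map_neg, K.form_skew m w v, neg_neg]

theorem form_nondegenerate (m : M) (v : TangentSpace 𝓘(ℝ, E) m) (h : K.formLin m v = 0) :
    v = 0 := by
  by_contra hv
  have := K.pos m v hv
  rw [← K.formLin_apply, h] at this
  simp at this

end AlmostKahler

variable (K : AlmostKahler E M)

theorem isDualFrame_tangentBasis (m : M) :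
    IsDualFrame (K.metric m) (dualTangentBasis K m) (tangentBasis m) :=
  isDualFrame_vecOf_coord (K.hermitianPair m).symm (K.metric_nondegenerate m) _

/-- At a point of the chart domain at `m`, the frame dual to the frame of coordinate fields. -/
def dualCoordField (m : M) (i : Fin (Module.finrank ℝ E)) : VField E M := fun x =>
  vecOf (K.metric x)
    (((Module.finBasis ℝ E).coord i) ∘ₗ (tangentCoord E m x).toLinearMap)

theorem isDualFrame_coordField {m x : M} (hx : x ∈ (chartAt E m).source) :
    IsDualFrame (K.metric x) (fun i => dualCoordField K m i x) (fun i => coordField m i x) := by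
  -- the basis of the tangent space formed by the coordinate fields
  let b : Module.Basis (Fin (Module.finrank ℝ E)) ℝ (TangentSpace 𝓘(ℝ, E) x) :=
    (Module.finBasis ℝ E).map
      (LinearEquiv.ofLinearMap (tangentVec m x).toLinearMap (tangentCoord E m x).toLinearMap
        (LinearMap.ext fun v => tangentVec_tangentCoord hx v)
        (LinearMap.ext fun v => tangentCoord_tangentVec hx v))
  exact isDualFrame_vecOf_coord (K.hermitianPair x).symm (K.metric_nondegenerate x) b

end TangentMetric

/-! ### Covariant derivatives in coordinates -/

section CovariantDerivatives

variable {E : Type*} [NormedAddCommGroup E] [NormedSpace ℝ E] [FiniteDimensional ℝ E]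
  {M : Type*} [TopologicalSpace M] [ChartedSpace E M] [IsManifold 𝓘(ℝ, E) ∞ M]

variable (D : CovariantDerivative 𝓘(ℝ, E) E (TangentSpace 𝓘(ℝ, E) : M → Type _))

theorem covariantDerivative_add {Y Z : VField E M} {m : M} (hY : DiffVFieldAt Y m)
    (hZ : DiffVFieldAt Z m) : D (fun x => Y x + Z x) m = D Y m + D Z m :=
  D.isCovariantDerivativeOnUniv.add hY hZ

theorem covariantDerivative_smul {f : M → ℝ} {Y : VField E M} {m : M}
    (hf : MDifferentiableAt 𝓘(ℝ, E) 𝓘(ℝ, ℝ) f m) (hY : DiffVFieldAt Y m)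
    (v : TangentSpace 𝓘(ℝ, E) m) :
    D (fun x => f x • Y x) m v = f m • D Y m v + mvfderiv 𝓘(ℝ, E) f m v • Y m := by
  have := D.isCovariantDerivativeOnUniv.leibniz hY hf
  exact congrArg (fun T => T v) this

theorem covariantDerivative_const_smul (a : ℝ) {Y : VField E M} {m : M}
    (hY : DiffVFieldAt Y m) : D (fun x => a • Y x) m = a • D Y m :=
  D.isCovariantDerivativeOnUniv.smul_const a hY

theorem covariantDerivative_sub {Y Z : VField E M} {m : M} (hY : DiffVFieldAt Y m)
    (hZ : DiffVFieldAt Z m) : D (fun x => Y x - Z x) m = D Y m - D Z m := by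
  have h1 : DiffVFieldAt (fun x => (-1 : ℝ) • Z x) m := hZ.smul mdifferentiableAt_const
  have := covariantDerivative_add D hY h1
  rw [covariantDerivative_const_smul D _ hZ] at this
  simpa [sub_eq_add_neg] using this

theorem covariantDerivative_congr {Y Z : VField E M} {m : M} (hY : DiffVFieldAt Y m)
    (h : ∀ᶠ x in 𝓝 m, Z x = Y x) : D Z m = D Y m :=
  D.isCovariantDerivativeOnUniv.congr_of_eventuallyEq (hY.congr h) hY Filter.univ_mem h

theorem covariantDerivative_sum {ι : Type*} (a : Finset ι) {Y : ι → VField E M} {m : M}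
    (hY : ∀ i ∈ a, DiffVFieldAt (Y i) m) :
    DiffVFieldAt (fun x => ∑ i ∈ a, Y i x) m
      ∧ D (fun x => ∑ i ∈ a, Y i x) m = ∑ i ∈ a, D (Y i) m := by
  induction a using Finset.cons_induction with
  | empty =>
    have : (fun x => ∑ i ∈ (∅ : Finset ι), Y i x) = (0 : VField E M) := by
      funext x; simp
    rw [this, D.zero]
    refine ⟨?_, by simp⟩
    exact mdifferentiableAt_zeroSection ..
  | cons i a hi ih =>
    obtain ⟨h1, h2⟩ := ih fun j hj => hY j (Finset.mem_cons_of_mem hj)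
    have h3 := hY i (Finset.mem_cons_self i a)
    simp only [Finset.sum_cons]
    exact ⟨h3.add h1, by rw [covariantDerivative_add D h3 h1, h2]⟩

/-- The derivative of the coordinates of a vector field. -/
theorem hasDirDeriv_tangentCoord {Y : VField E M} {m x : M} (hx : x ∈ (chartAt E m).source)
    (hY : DiffVFieldAt Y x) (v : TangentSpace 𝓘(ℝ, E) x) :
    HasDirDeriv (fun y => tangentCoord E m y (Y y)) x v
      (mvfderiv 𝓘(ℝ, E) (fun y => tangentCoord E m y (Y y)) x v) :=
  hasDirDeriv ((diffVFieldAt_iff hx).1 hY) v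

/-- Expansion of a covariant derivative in the frame of coordinate fields. -/
theorem covariantDerivative_eq {Y : VField E M} {m : M} (hY : DiffVFieldAt Y m)
    (v : TangentSpace 𝓘(ℝ, E) m) :
    D Y m v = tangentVec m m (mvfderiv 𝓘(ℝ, E) (fun y => tangentCoord E m y (Y y)) m v)
      + (tangentBasis m).constr ℝ (fun i => D (coordField m i) m v) (Y m) := by
  have hm := mem_chart_source E m
  let φ : Fin (Module.finrank ℝ E) → E →L[ℝ] ℝ := fun i =>
    (ContinuousLinearMap.proj i).comp
      ((Module.finBasis ℝ E).equivFunL : E →L[ℝ] (Fin (Module.finrank ℝ E) → ℝ))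
  have hφ : ∀ i, HasDirDeriv (fun y => φ i (tangentCoord E m y (Y y))) m v
      (φ i (mvfderiv 𝓘(ℝ, E) (fun y => tangentCoord E m y (Y y)) m v)) := fun i =>
    (hasDirDeriv_tangentCoord hm hY v).clm (φ i)
  have hc : ∀ i, DiffVFieldAt (coordField (E := E) m i) m :=
    fun i => (smoothVFieldAt_coordField hm i).diff
  have h1 : ∀ᶠ x in 𝓝 m, Y x
      = ∑ i, φ i (tangentCoord E m x (Y x)) • coordField m i x :=
    (eventually_mem_chart_source hm).mono fun x hx => (sum_coordField hx (Y x)).symm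
  obtain ⟨h2, h3⟩ := covariantDerivative_sum D Finset.univ
    (Y := fun i x => φ i (tangentCoord E m x (Y x)) • coordField m i x) (m := m)
    fun i _ => (hc i).smul (hφ i).diff
  rw [covariantDerivative_congr D h2 h1, h3, sum_apply]
  simp only [covariantDerivative_smul D (hφ _).diff (hc _), (hφ _).eq]
  rw [Finset.sum_add_distrib, add_comm]
  congr 1
  · set w := mvfderiv 𝓘(ℝ, E) (fun y => tangentCoord E m y (Y y)) m v
    conv_rhs => rw [← (Module.finBasis ℝ E).sum_equivFun w, map_sum]
    refine Finset.sum_congr rfl fun i _ => ?_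
    rw [map_smul]
    rfl
  · conv_rhs => rw [← sum_coordField hm (Y m)]
    rw [map_sum]
    refine Finset.sum_congr rfl fun i _ => ?_
    rw [map_smul, ← tangentBasis_apply, Module.Basis.constr_basis]
    rfl

end CovariantDerivatives

/-! ### The Hermitian connection on the tangent bundle and its intrinsic torsion -/

section ComplexConnection

variable {E : Type*} [NormedAddCommGroup E] [NormedSpace ℝ E] [FiniteDimensional ℝ E]
  {M : Type*} [TopologicalSpace M] [ChartedSpace E M] [IsManifold 𝓘(ℝ, E) ∞ M]
  (K : AlmostKahler E M)

theorem SmoothVFieldAt.map_J {Y : VField E M} {m : M} (hY : SmoothVFieldAt Y m) :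
    SmoothVFieldAt (fun x => K.J x (Y x)) m :=
  ContMDiffAt.clm_bundle_apply (E₁ := TangentSpace 𝓘(ℝ, E)) (E₂ := TangentSpace 𝓘(ℝ, E))
    (b := fun x : M => x) (ϕ := K.J) K.smooth_J.contMDiffAt hY

theorem DiffVFieldAt.map_J {Y : VField E M} {m : M} (hY : DiffVFieldAt Y m) :
    DiffVFieldAt (fun x => K.J x (Y x)) m :=
  MDifferentiableAt.clm_bundle_apply (E₁ := TangentSpace 𝓘(ℝ, E)) (E₂ := TangentSpace 𝓘(ℝ, E))
    (b := fun x : M => x) (ϕ := K.J) (K.smooth_J.contMDiffAt.mdifferentiableAt (by simp)) hY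

theorem contMDiffAt_form {Y Z : VField E M} {m : M} (hY : SmoothVFieldAt Y m)
    (hZ : SmoothVFieldAt Z m) :
    ContMDiffAt 𝓘(ℝ, E) 𝓘(ℝ, ℝ) ∞ (fun x => K.form x (Y x) (Z x)) m := by
  have h := ContMDiffAt.clm_bundle_apply₂ (E₁ := TangentSpace 𝓘(ℝ, E))
    (E₂ := TangentSpace 𝓘(ℝ, E)) (E₃ := Bundle.Trivial M ℝ) (F₃ := ℝ)
    (b := fun x : M => x) (ψ := K.form) (v := Y) (w := Z) K.smooth_form.contMDiffAt hY hZ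
  exact (Bundle.contMDiffAt_section _).1 h

theorem mdifferentiableAt_form {Y Z : VField E M} {m : M} (hY : DiffVFieldAt Y m)
    (hZ : DiffVFieldAt Z m) :
    MDifferentiableAt 𝓘(ℝ, E) 𝓘(ℝ, ℝ) (fun x => K.form x (Y x) (Z x)) m := by
  have h := MDifferentiableAt.clm_bundle_apply₂ (E₁ := TangentSpace 𝓘(ℝ, E))
    (E₂ := TangentSpace 𝓘(ℝ, E)) (E₃ := Bundle.Trivial M ℝ) (F₃ := ℝ)
    (b := fun x : M => x) (ψ := K.form) (v := Y) (w := Z)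
    (K.smooth_form.contMDiffAt.mdifferentiableAt (by simp)) hY hZ
  exact (mdifferentiableAt_section 𝓘(ℝ, E) _).1 h

theorem contMDiffAt_metric {Y Z : VField E M} {m : M} (hY : SmoothVFieldAt Y m)
    (hZ : SmoothVFieldAt Z m) :
    ContMDiffAt 𝓘(ℝ, E) 𝓘(ℝ, ℝ) ∞ (fun x => K.metric x (Y x) (Z x)) m :=
  contMDiffAt_form K hY (hZ.map_J K)

theorem mdifferentiableAt_metric {Y Z : VField E M} {m : M} (hY : DiffVFieldAt Y m)
    (hZ : DiffVFieldAt Z m) :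
    MDifferentiableAt 𝓘(ℝ, E) 𝓘(ℝ, ℝ) (fun x => K.metric x (Y x) (Z x)) m :=
  mdifferentiableAt_form K hY (hZ.map_J K)

variable (nabla : CovariantDerivative 𝓘(ℝ, E) E (TangentSpace 𝓘(ℝ, E) : M → Type _))

/-- The connection `nablaJ`, as a covariant derivative. -/
def nablaJConnection : CovariantDerivative 𝓘(ℝ, E) E (TangentSpace 𝓘(ℝ, E) : M → Type _) where
  toFun Y m := (1 / 2 : ℝ) • (nabla Y m - (K.J m).comp (nabla (fun x => K.J x (Y x)) m))
  isCovariantDerivativeOnUniv := by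
    constructor
    · intro Y Z m hY hZ _
      have h1 : nabla (Y + Z) m = nabla Y m + nabla Z m :=
        nabla.isCovariantDerivativeOnUniv.add hY hZ
      have h2 : nabla (fun x => K.J x ((Y + Z) x)) m
          = nabla (fun x => K.J x (Y x)) m + nabla (fun x => K.J x (Z x)) m := by
        have := covariantDerivative_add nabla (DiffVFieldAt.map_J K hY)
          (DiffVFieldAt.map_J K hZ)
        simpa using this
      rw [h1, h2, ContinuousLinearMap.comp_add]
      module
    · intro Y f m hY hf _
      refine ContinuousLinearMap.ext fun v => ?_
      have h1 : nabla (f • Y) m v = _ := covariantDerivative_smul nabla hf hY v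
      have h2 := covariantDerivative_smul nabla hf (DiffVFieldAt.map_J K hY) v
      simp only [smul_apply, sub_apply, add_apply,
        ContinuousLinearMap.comp_apply, h1, h2, map_add, map_smul, K.J_sq, Pi.smul_apply',
        ContinuousLinearMap.smulRight_apply]
      module

theorem nablaJConnection_apply (Y : VField E M) (m : M) (v : TangentSpace 𝓘(ℝ, E) m) :
    nablaJConnection K nabla Y m v = nablaJ K nabla Y m v := rfl

/-- The one-form `S = ∇ - nablaJ` with values in the endomorphisms of `TM`. -/
def intrinsicTorsion (m : M) (v : TangentSpace 𝓘(ℝ, E) m) :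
    TangentSpace 𝓘(ℝ, E) m →ₗ[ℝ] TangentSpace 𝓘(ℝ, E) m where
  toFun w := nabla.difference (nablaJConnection K nabla) m w v
  map_add' _ _ := by simp
  map_smul' _ _ := by simp

variable {nabla}

theorem nabla_sub_nablaJ {Y : VField E M} {m : M} (hY : DiffVFieldAt Y m)
    (v : TangentSpace 𝓘(ℝ, E) m) :
    nabla Y m v - nablaJ K nabla Y m v = intrinsicTorsion K nabla m v (Y m) := by
  have h : nabla.difference (nablaJConnection K nabla) m (Y m) = nabla Y m
      - nablaJConnection K nabla Y m :=
    IsCovariantDerivativeOn.difference_apply _ _ (Set.mem_univ m) hY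
  exact (congrArg (fun T : TangentSpace 𝓘(ℝ, E) m →L[ℝ] TangentSpace 𝓘(ℝ, E) m => T v) h).symm

/-- Every tangent vector extends to a smooth vector field. -/
theorem exists_smoothVFieldAt_eq (m : M) (w : TangentSpace 𝓘(ℝ, E) m) :
    ∃ Y : VField E M, SmoothVFieldAt Y m ∧ Y m = w :=
  ⟨fun y => tangentVec m y (tangentCoord E m m w),
    smoothVFieldAt_tangentVec (mem_chart_source E m) _,
    tangentVec_tangentCoord (mem_chart_source E m) w⟩

theorem nablaJ_map_J {Y : VField E M} {m : M} (hY : DiffVFieldAt Y m)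
    (v : TangentSpace 𝓘(ℝ, E) m) :
    nablaJ K nabla (fun x => K.J x (Y x)) m v = K.J m (nablaJ K nabla Y m v) := by
  have h : nabla (fun x => K.J x (K.J x (Y x))) m v = -nabla Y m v := by
    have h1 := covariantDerivative_const_smul nabla (-1) hY
    have h2 : (fun x => K.J x (K.J x (Y x))) = fun x => (-1 : ℝ) • Y x :=
      funext fun x => by rw [K.J_sq, neg_one_smul]
    rw [h2, h1, neg_one_smul]
    rfl
  simp only [nablaJ]
  rw [h]
  simp only [map_smul, map_sub, map_neg, K.J_sq]
  module

/-- `S(v) = J (∇_v J) / 2` anticommutes with `J`. -/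
theorem intrinsicTorsion_J (m : M) (v w : TangentSpace 𝓘(ℝ, E) m) :
    intrinsicTorsion K nabla m v (K.J m w) = -K.J m (intrinsicTorsion K nabla m v w) := by
  obtain ⟨Y, hY, rfl⟩ := exists_smoothVFieldAt_eq m w
  have h1 := nabla_sub_nablaJ K (nabla := nabla) hY.diff v
  have h2 := nabla_sub_nablaJ K (nabla := nabla) (hY.diff.map_J K) v
  rw [← h1, ← h2, nablaJ_map_J K hY.diff]
  simp only [nablaJ, map_sub, map_smul, K.J_sq]
  module

variable (hnabla : K.IsLeviCivita nabla)
include hnabla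

theorem hasDirDeriv_metric_nabla {Y Z : VField E M} {m : M} (hY : DiffVFieldAt Y m)
    (hZ : DiffVFieldAt Z m) (v : TangentSpace 𝓘(ℝ, E) m) :
    HasDirDeriv (fun x => K.metric x (Y x) (Z x)) m v
      (K.metric m (nabla Y m v) (Z m) + K.metric m (Y m) (nabla Z m v)) :=
  ⟨mdifferentiableAt_metric K hY hZ, hnabla.metric_compat Y Z m v hY hZ⟩

/-- The connection `nablaJ` is metric. -/
theorem hasDirDeriv_metric_nablaJ {Y Z : VField E M} {m : M} (hY : DiffVFieldAt Y m)
    (hZ : DiffVFieldAt Z m) (v : TangentSpace 𝓘(ℝ, E) m) :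
    HasDirDeriv (fun x => K.metric x (Y x) (Z x)) m v
      (K.metric m (nablaJ K nabla Y m v) (Z m) + K.metric m (Y m) (nablaJ K nabla Z m v)) := by
  have h1 := hasDirDeriv_metric_nabla K hnabla hY hZ v
  have h2 := hasDirDeriv_metric_nabla K hnabla (hY.map_J K) (hZ.map_J K) v
  have h3 : (fun x => K.metric x (K.J x (Y x)) (K.J x (Z x)))
      = fun x => K.metric x (Y x) (Z x) := funext fun x => (K.hermitianPair x).isometry _ _
  rw [h3] at h2
  refine ⟨h1.diff, ?_⟩
  have h4 := h1.eq
  have h5 := h2.eq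
  have H := K.hermitianPair m
  have h6 := H.skew (nabla (fun x => K.J x (Y x)) m v) (Z m)
  have h7 := H.skew (Y m) (nabla (fun x => K.J x (Z x)) m v)
  simp only [K.Jlin_apply] at h6 h7
  simp only [nablaJ, map_smul, map_sub, LinearMap.smul_apply, LinearMap.sub_apply, smul_eq_mul]
  linarith

theorem intrinsicTorsion_skew (m : M) (v w u : TangentSpace 𝓘(ℝ, E) m) :
    K.metric m (intrinsicTorsion K nabla m v w) u
      = -K.metric m w (intrinsicTorsion K nabla m v u) := by
  obtain ⟨Y, hY, rfl⟩ := exists_smoothVFieldAt_eq m w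
  obtain ⟨Z, hZ, rfl⟩ := exists_smoothVFieldAt_eq m u
  have h1 := (hasDirDeriv_metric_nabla K hnabla hY.diff hZ.diff v).unique
    (hasDirDeriv_metric_nablaJ K hnabla hY.diff hZ.diff v)
  rw [← nabla_sub_nablaJ K hY.diff, ← nabla_sub_nablaJ K hZ.diff]
  simp only [map_sub, LinearMap.sub_apply]
  linarith

end ComplexConnection

/-! ### Extensions that are parallel at a point -/

section ParallelExtension

variable {E : Type*} [NormedAddCommGroup E] [NormedSpace ℝ E] [FiniteDimensional ℝ E]
  {M : Type*} [TopologicalSpace M] [ChartedSpace E M] [IsManifold 𝓘(ℝ, E) ∞ M]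

/-- The derivative of a chart gives the coordinates of tangent vectors in the induced
trivialization. -/
theorem hasDirDeriv_chart {m x : M} (hx : x ∈ (chartAt E m).source)
    (v : TangentSpace 𝓘(ℝ, E) x) :
    HasDirDeriv (fun y => extChartAt 𝓘(ℝ, E) m y) x v (tangentCoord E m x v) := by
  refine ⟨mdifferentiableAt_extChartAt hx, ?_⟩
  rw [tangentCoord, TangentBundle.continuousLinearMapAt_trivializationAt hx]
  rfl

/-- A tangent vector extends to a vector field that is parallel at the given point. -/
theorem exists_parallel
    (D : CovariantDerivative 𝓘(ℝ, E) E (TangentSpace 𝓘(ℝ, E) : M → Type _))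
    (m : M) (w : TangentSpace 𝓘(ℝ, E) m) :
    ∃ Y : VField E M, SmoothVFieldAt Y m ∧ Y m = w ∧ D Y m = 0 := by
  have hm := mem_chart_source E m
  -- the extension with constant coordinates, corrected by a field that vanishes at `m`
  let Y₀ : VField E M := fun y => tangentVec m y (tangentCoord E m m w)
  have hY₀ : SmoothVFieldAt Y₀ m := smoothVFieldAt_tangentVec hm _
  let Γ : E →L[ℝ] E := (tangentCoord E m m).comp ((D Y₀ m).comp (tangentVec m m))
  let φ : M → E := fun y => Γ (extChartAt 𝓘(ℝ, E) m y - extChartAt 𝓘(ℝ, E) m m)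
  have hφ : ContMDiffAt 𝓘(ℝ, E) 𝓘(ℝ, E) ∞ φ m :=
    Γ.contMDiff.contMDiffAt.comp m (contMDiffAt_extChartAt.sub contMDiffAt_const)
  let Z : VField E M := fun y => tangentVec m y (φ y)
  have hZc : ∀ᶠ y in 𝓝 m, tangentCoord E m y (Z y) = φ y :=
    (eventually_mem_chart_source hm).mono fun y hy => tangentCoord_tangentVec hy _
  have hZ : SmoothVFieldAt Z m := (smoothVFieldAt_iff hm).2 (hφ.congr_of_eventuallyEq hZc)
  have hφ0 : φ m = 0 := by simp [φ]
  refine ⟨fun y => Y₀ y - Z y, hY₀.sub hZ, ?_, ?_⟩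
  · simp only [Y₀, Z, hφ0, map_zero, sub_zero]
    exact tangentVec_tangentCoord hm w
  · rw [covariantDerivative_sub D hY₀.diff hZ.diff, sub_eq_zero]
    refine ContinuousLinearMap.ext fun v => ?_
    rw [covariantDerivative_eq D hZ.diff]
    have h1 : HasDirDeriv φ m v (Γ (tangentCoord E m m v - 0)) :=
      ((hasDirDeriv_chart hm v).sub (hasDirDeriv_const _)).clm Γ
    rw [(h1.congr hZc).eq]
    simp only [Z, hφ0, map_zero, sub_zero, add_zero, Γ, ContinuousLinearMap.comp_apply,
      tangentVec_tangentCoord hm]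

end ParallelExtension

/-! ### The connection on the powers of the prequantum line bundle -/

section LineConnection

variable {E : Type*} [NormedAddCommGroup E] [NormedSpace ℝ E] [FiniteDimensional ℝ E]
  {M : Type*} [TopologicalSpace M] [ChartedSpace E M] [IsManifold 𝓘(ℝ, E) ∞ M] [T2Space M]
  {L : M → Type*} [TopologicalSpace (TotalSpace ℂ L)]
  [∀ m, NormedAddCommGroup (L m)] [∀ m, InnerProductSpace ℂ (L m)]
  [FiberBundle ℂ L] [VectorBundle ℂ ℂ L] [VectorBundle ℝ ℂ L]
  [ContMDiffVectorBundle ∞ ℂ L 𝓘(ℝ, E)]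
  (K : AlmostKahler E M)
  (nabla : CovariantDerivative 𝓘(ℝ, E) E (TangentSpace 𝓘(ℝ, E) : M → Type _))
  (nablaL : CovariantDerivative 𝓘(ℝ, E) ℂ L)

/-- A section of `L` that is smooth near a point agrees there with a global smooth section. -/
theorem exists_smoothSection_localFrame {m x : M} (hx : x ∈ (trivializationAt ℂ L m).baseSet) :
    ∃ t : ∀ y, L y, SmoothSection E t ∧ ∀ᶠ y in 𝓝 x, t y = localFrame L m y :=
  exists_contMDiff_section_eventuallyEq (F := ℂ) (trivializationAt ℂ L m).open_baseSet hx
    fun _ hy => (contMDiffAt_localFrame hy).contMDiffWithinAt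

/-- The connection form of `∇^L` in the frame `localFrame L m`. -/
def connForm (m x : M) (v : TangentSpace 𝓘(ℝ, E) x) : ℂ :=
  lineCoord L m x (nablaL (localFrame L m) x v)

theorem connForm_self (m : M) (v : TangentSpace 𝓘(ℝ, E) m) :
    connForm nablaL m m v = thetaL nablaL m v := rfl

theorem connForm_smul {m x : M} (hx : x ∈ (trivializationAt ℂ L m).baseSet)
    (v : TangentSpace 𝓘(ℝ, E) x) :
    connForm nablaL m x v • localFrame L m x = nablaL (localFrame L m) x v :=
  lineCoord_smul_localFrame hx _

variable {nablaL} (hL : IsPrequantum K nablaL)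
include hL

/-- The complex Leibniz rule for `∇^L`. The covariant derivative is only real linear by its type;
complex linearity is known for global smooth sections, and the real and imaginary parts of the
coefficient are treated separately. -/
theorem nablaL_smul_localFrame {m x : M} (hx : x ∈ (trivializationAt ℂ L m).baseSet)
    {v : TangentSpace 𝓘(ℝ, E) x} {h : M → ℂ} {h' : ℂ} (hh : HasDirDeriv h x v h') :
    nablaL (fun y => h y • localFrame L m y) x v
      = h x • nablaL (localFrame L m) x v + h' • localFrame L m x := by
  obtain ⟨t, ht, hts⟩ := exists_smoothSection_localFrame (E := E) hx
  have hσ : MDifferentiableAt 𝓘(ℝ, E) (𝓘(ℝ, E).prod 𝓘(ℝ, ℂ))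
      (fun y => TotalSpace.mk' ℂ y (localFrame L m y)) x :=
    (contMDiffAt_localFrame hx).mdifferentiableAt (by simp)
  have hIσ : MDifferentiableAt 𝓘(ℝ, E) (𝓘(ℝ, E).prod 𝓘(ℝ, ℂ))
      (fun y => TotalSpace.mk' ℂ y (Complex.I • localFrame L m y)) x := by
    refine ContMDiffAt.mdifferentiableAt (n := ∞) ?_ (by simp)
    rw [contMDiffAt_lineSection_iff hx]
    refine (contMDiffAt_const (c := Complex.I)).congr_of_eventuallyEq ?_
    refine (eventually_mem_baseSet hx).mono fun y hy => ?_
    simp [map_smul, lineCoord_localFrame hy]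
  have hIt : MDifferentiableAt 𝓘(ℝ, E) (𝓘(ℝ, E).prod 𝓘(ℝ, ℂ))
      (fun y => TotalSpace.mk' ℂ y (Complex.I • t y)) x :=
    hIσ.congr_of_eventuallyEq (hts.mono fun y hy => by simp [hy])
  have hI : nablaL (fun y => Complex.I • localFrame L m y) x v
      = Complex.I • nablaL (localFrame L m) x v := by
    have h1 : nablaL (fun y => Complex.I • localFrame L m y) x
        = nablaL (fun y => Complex.I • t y) x :=
      nablaL.isCovariantDerivativeOnUniv.congr_of_eventuallyEq hIσ hIt Filter.univ_mem
        (hts.mono fun y hy => by simp [hy])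
    have h2 : nablaL (localFrame L m) x = nablaL t x :=
      nablaL.isCovariantDerivativeOnUniv.congr_of_eventuallyEq hσ
        (ht.contMDiffAt.mdifferentiableAt (by simp)) Filter.univ_mem
        (hts.mono fun y hy => hy.symm)
    rw [h1, h2, hL.complex_linear t x v ht]
  have hre := hh.clm Complex.reCLM
  have him := hh.clm Complex.imCLM
  have e1 : (fun y => h y • localFrame L m y)
      = (fun y => (h y).re • localFrame L m y)
        + fun y => (h y).im • Complex.I • localFrame L m y := by
    funext y
    change _ = (h y).re • localFrame L m y + (h y).im • Complex.I • localFrame L m y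
    conv_lhs => rw [← Complex.re_add_im (h y)]
    rw [add_smul, mul_smul, Complex.coe_smul, Complex.coe_smul]
  have l1 := nablaL.isCovariantDerivativeOnUniv.leibniz hσ hre.diff
  have l2 := nablaL.isCovariantDerivativeOnUniv.leibniz hIσ him.diff
  have l1' := congrArg (fun T => T v) l1
  have l2' := congrArg (fun T => T v) l2
  have l3 := nablaL.isCovariantDerivativeOnUniv.add (hre.diff.smul_section hσ)
    (him.diff.smul_section hIσ)
  rw [e1]
  refine (congrArg (fun T => T v) l3).trans ?_
  refine (congrArg₂ (· + ·) l1' l2').trans ?_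
  have d1 := hre.eq
  have d2 := him.eq
  simp only [add_apply, smul_apply, ContinuousLinearMap.smulRight_apply, d1, d2, hI]
  conv_rhs => rw [← Complex.re_add_im (h x), ← Complex.re_add_im h']
  simp only [add_smul, mul_smul, Complex.coe_smul]
  simp only [Complex.reCLM_apply, Complex.imCLM_apply]
  abel

/-- Change of frame for the connection form. -/
theorem hasDirDeriv_lineCoord_localFrame {m m' x : M}
    (hx : x ∈ (trivializationAt ℂ L m).baseSet) (hx' : x ∈ (trivializationAt ℂ L m').baseSet)
    (v : TangentSpace 𝓘(ℝ, E) x) :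
    HasDirDeriv (fun y => lineCoord L m y (localFrame L m' y)) x v
      ((connForm nablaL m' x v - connForm nablaL m x v)
        * lineCoord L m x (localFrame L m' x)) := by
  have hsm := (contMDiffAt_lineSection_iff (E := E) hx).1 (contMDiffAt_localFrame hx')
  have hh := hasDirDeriv (hsm.mdifferentiableAt (by simp)) v
  refine ⟨hh.diff, ?_⟩
  have h1 := nablaL_smul_localFrame K hL hx hh
  have hσ : MDifferentiableAt 𝓘(ℝ, E) (𝓘(ℝ, E).prod 𝓘(ℝ, ℂ))
      (fun y => TotalSpace.mk' ℂ y (localFrame L m' y)) x :=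
    (contMDiffAt_localFrame hx').mdifferentiableAt (by simp)
  have he : ∀ᶠ y in 𝓝 x, lineCoord L m y (localFrame L m' y) • localFrame L m y
      = localFrame L m' y :=
    (eventually_mem_baseSet hx).mono fun y hy => lineCoord_smul_localFrame hy _
  have h2 : nablaL (fun y => lineCoord L m y (localFrame L m' y) • localFrame L m y) x
      = nablaL (localFrame L m') x :=
    nablaL.isCovariantDerivativeOnUniv.congr_of_eventuallyEq
      (hσ.congr_of_eventuallyEq (he.mono fun y hy => by simp [hy])) hσ Filter.univ_mem he
  rw [h2, ← connForm_smul nablaL hx', ← connForm_smul nablaL hx] at h1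
  have h3 := congrArg (lineCoord L m x) h1
  simp only [map_add, map_smul, lineCoord_localFrame hx, smul_eq_mul, mul_one] at h3
  linear_combination -h3

end LineConnection

/-! ### Leibniz rules for forms with values in the line bundle -/

section Leibniz

variable {E : Type*} [NormedAddCommGroup E] [NormedSpace ℝ E] [FiniteDimensional ℝ E]
  {M : Type*} [TopologicalSpace M] [ChartedSpace E M] [IsManifold 𝓘(ℝ, E) ∞ M]
  {L : M → Type*} [TopologicalSpace (TotalSpace ℂ L)]
  [∀ m, NormedAddCommGroup (L m)] [∀ m, InnerProductSpace ℂ (L m)]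
  [FiberBundle ℂ L] [VectorBundle ℂ ℂ L] [VectorBundle ℝ ℂ L]
  (K : AlmostKahler E M)
  (nabla : CovariantDerivative 𝓘(ℝ, E) E (TangentSpace 𝓘(ℝ, E) : M → Type _))
  (nablaL : CovariantDerivative 𝓘(ℝ, E) ℂ L)

/-- A section of `Λ^* T^*M ⊗ L^p` is differentiable at a point. -/
def DiffFormAt (p : ℕ) (s : ∀ m : M, FormFibre E L p m) (m : M) : Prop :=
  ∀ q, MDifferentiableAt 𝓘(ℝ, E) 𝓘(ℝ, E [⋀^Fin q]→L[ℝ] ℂ)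
    (fun x => toModel p m x q (s x q)) m

/-- The connection `nablaForms` in the trivialization at the point of differentiation. -/
theorem powCoord_nablaForms {p : ℕ} {s : ∀ m : M, FormFibre E L p m} {m : M}
    (v : TangentSpace 𝓘(ℝ, E) m) {q : ℕ} (w : Fin q → TangentSpace 𝓘(ℝ, E) m) :
    powCoord L p m m (nablaForms K nabla nablaL p s m v q w)
      = mvfderiv 𝓘(ℝ, E) (fun x => toModel p m x q (s x q)) m v
          (fun i => tangentCoord E m m (w i))
        + p * thetaL nablaL m v * powCoord L p m m (s m q w)
        - ∑ i, powCoord L p m m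
            (s m q (Function.update w i (gammaJ K nabla m v (w i)))) := by
  rw [nablaForms, Forms.sub_apply, map_sub, derivationAct_apply, map_sum, powCoord_fromModel]
  congr 1
  rw [powCoord_eq_toModel (mem_chart_source E m)]
  rfl

/-- The defining Leibniz rule of `nablaForms`, in the trivialization of `L` at the given point. -/
theorem hasDirDeriv_powCoord_self {p : ℕ} {s : ∀ m : M, FormFibre E L p m} {m : M}
    (hs : DiffFormAt p s m) (v : TangentSpace 𝓘(ℝ, E) m) {q : ℕ} {Y : Fin q → VField E M}
    (hY : ∀ i, DiffVFieldAt (Y i) m) :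
    HasDirDeriv (fun y => powCoord L p m y (s y q (fun i => Y i y))) m v
      (powCoord L p m m (nablaForms K nabla nablaL p s m v q (fun i => Y i m))
        - p * thetaL nablaL m v * powCoord L p m m (s m q (fun i => Y i m))
        + ∑ i, powCoord L p m m
            (s m q (Function.update (fun i => Y i m) i (nablaJ K nabla (Y i) m v)))) := by
  have hm := mem_chart_source E m
  have h1 := HasDirDeriv.alternating_apply (hasDirDeriv (hs q) v)
    (fun i => hasDirDeriv_tangentCoord hm (hY i) v)
  have h2 : (fun y => powCoord L p m y (s y q (fun i => Y i y))) =ᶠ[𝓝 m]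
      fun y => toModel p m y q (s y q) (fun i => tangentCoord E m y (Y i y)) :=
    (eventually_mem_chart_source hm).mono fun y hy => powCoord_eq_toModel hy _ _
  have h3 := h1.congr h2
  refine ⟨h3.diff, h3.eq.trans ?_⟩
  have h4 : ∀ i, nablaJ K nabla (Y i) m v
      = tangentVec m m (mvfderiv 𝓘(ℝ, E) (fun y => tangentCoord E m y (Y i y)) m v)
        + gammaJ K nabla m v (Y i m) := fun i =>
    covariantDerivative_eq (nablaJConnection K nabla) (hY i) v
  have h5 : ∀ i, toModel p m m q (s m q)
      (Function.update (fun i => tangentCoord E m m (Y i m)) i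
        (mvfderiv 𝓘(ℝ, E) (fun y => tangentCoord E m y (Y i y)) m v))
      = powCoord L p m m
            (s m q (Function.update (fun i => Y i m) i (nablaJ K nabla (Y i) m v)))
        - powCoord L p m m
            (s m q (Function.update (fun i => Y i m) i (gammaJ K nabla m v (Y i m)))) := by
    intro i
    rw [h4 i, AlternatingMap.map_update_add, map_add, add_sub_cancel_right, toModel_apply]
    congr 2
    funext j
    rcases eq_or_ne j i with rfl | hj
    · simp
    · simp [hj, tangentVec_tangentCoord hm]
  simp only [h5]
  rw [powCoord_nablaForms, Finset.sum_sub_distrib]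
  ring

variable [T2Space M] [ContMDiffVectorBundle ∞ ℂ L 𝓘(ℝ, E)]
variable {nablaL} (hL : IsPrequantum K nablaL)
include hL

/-- The Leibniz rule of `nablaForms`, in a trivialization of `L` around the given point. -/
theorem hasDirDeriv_powCoord {p : ℕ} {s : ∀ m : M, FormFibre E L p m} {m x : M}
    (hx : x ∈ (trivializationAt ℂ L m).baseSet)
    (hs : DiffFormAt p s x) (v : TangentSpace 𝓘(ℝ, E) x) {q : ℕ} {Y : Fin q → VField E M}
    (hY : ∀ i, DiffVFieldAt (Y i) x) :
    HasDirDeriv (fun y => powCoord L p m y (s y q (fun i => Y i y))) x v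
      (powCoord L p m x (nablaForms K nabla nablaL p s x v q (fun i => Y i x))
        - p * connForm nablaL m x v * powCoord L p m x (s x q (fun i => Y i x))
        + ∑ i, powCoord L p m x
            (s x q (Function.update (fun i => Y i x) i (nablaJ K nabla (Y i) x v)))) := by
  have hx' : x ∈ (trivializationAt ℂ L x).baseSet :=
    FiberBundle.mem_baseSet_trivializationAt' x
  have h1 := hasDirDeriv_powCoord_self K nabla nablaL hs v hY
  have h2 := hasDirDeriv_lineCoord_localFrame K hL hx hx' v
  have h3 : (fun y => powCoord L p m y (s y q (fun i => Y i y))) =ᶠ[𝓝 x]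
      fun y => lineCoord L m y (localFrame L x y) ^ p
        * powCoord L p x y (s y q (fun i => Y i y)) :=
    (eventually_mem_baseSet hx').mono fun y hy => powCoord_change hy _
  have h4 := ((h2.pow p).mul h1).congr h3
  refine ⟨h4.diff, h4.eq.trans ?_⟩
  simp only [powCoord_change (m' := m) hx']
  rw [connForm_self]
  cases p with
  | zero => simp
  | succ p =>
    rw [← Finset.mul_sum, Nat.add_sub_cancel]
    ring

end Leibniz

/-! ### Smoothness of functions and fields -/

section SmoothFunctions

variable {E : Type*} [NormedAddCommGroup E] [NormedSpace ℝ E]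
  {M : Type*} [TopologicalSpace M] [ChartedSpace E M]
  {F : Type*} [NormedAddCommGroup F] [NormedSpace ℝ F]
  {F₁ : Type*} [NormedAddCommGroup F₁] [NormedSpace ℝ F₁]
  {F₂ : Type*} [NormedAddCommGroup F₂] [NormedSpace ℝ F₂]

theorem contMDiffAt_contDiff_comp {f : M → F} {m : M} {φ : F → F₁} (hφ : ContDiff ℝ ∞ φ)
    (hf : ContMDiffAt 𝓘(ℝ, E) 𝓘(ℝ, F) ∞ f m) :
    ContMDiffAt 𝓘(ℝ, E) 𝓘(ℝ, F₁) ∞ (fun x => φ (f x)) m :=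
  hφ.contMDiff.contMDiffAt.comp m hf

theorem contMDiffAt_prod_space {f : M → F} {g : M → F₁} {m : M}
    (hf : ContMDiffAt 𝓘(ℝ, E) 𝓘(ℝ, F) ∞ f m) (hg : ContMDiffAt 𝓘(ℝ, E) 𝓘(ℝ, F₁) ∞ g m) :
    ContMDiffAt 𝓘(ℝ, E) 𝓘(ℝ, F × F₁) ∞ (fun x => (f x, g x)) m :=
  hf.prodMk_space hg

theorem contMDiffAt_mul {A : Type*} [NormedRing A] [NormedAlgebra ℝ A] {f g : M → A} {m : M}
    (hf : ContMDiffAt 𝓘(ℝ, E) 𝓘(ℝ, A) ∞ f m) (hg : ContMDiffAt 𝓘(ℝ, E) 𝓘(ℝ, A) ∞ g m) :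
    ContMDiffAt 𝓘(ℝ, E) 𝓘(ℝ, A) ∞ (fun x => f x * g x) m :=
  contMDiffAt_contDiff_comp contDiff_mul (contMDiffAt_prod_space hf hg)

theorem contMDiffAt_ofReal {f : M → ℝ} {m : M} (hf : ContMDiffAt 𝓘(ℝ, E) 𝓘(ℝ, ℝ) ∞ f m) :
    ContMDiffAt 𝓘(ℝ, E) 𝓘(ℝ, ℂ) ∞ (fun x => (f x : ℂ)) m :=
  contMDiffAt_contDiff_comp Complex.ofRealCLM.contDiff hf

variable [FiniteDimensional ℝ E]

theorem alternating_apply_eq_sum {q : ℕ} (f : E [⋀^Fin q]→L[ℝ] ℂ) (z : Fin q → E) :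
    f z = ∑ a : Fin q → Fin (Module.finrank ℝ E),
      (∏ i, (Module.finBasis ℝ E).equivFunL (z i) (a i)) •
        f (fun i => Module.finBasis ℝ E (a i)) := by
  conv_lhs => rw [show z = fun i => ∑ k, (Module.finBasis ℝ E).equivFunL (z i) k •
    Module.finBasis ℝ E k from funext fun i => ((Module.finBasis ℝ E).sum_equivFun (z i)).symm]
  have h1 := f.toMultilinearMap.map_sum
    (fun i k => (Module.finBasis ℝ E).equivFunL (z i) k • Module.finBasis ℝ E k)
  refine h1.trans (Finset.sum_congr rfl fun a _ => ?_)
  exact f.toMultilinearMap.map_smul_univ _ _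

theorem contDiff_alternating_apply (q : ℕ) :
    ContDiff ℝ ∞ (fun z : (E [⋀^Fin q]→L[ℝ] ℂ) × (Fin q → E) => z.1 z.2) := by
  rw [funext fun z : (E [⋀^Fin q]→L[ℝ] ℂ) × (Fin q → E) => alternating_apply_eq_sum z.1 z.2]
  refine ContDiff.sum fun a _ => ?_
  have h1 : ∀ i, ContDiff ℝ ∞ (fun z : (E [⋀^Fin q]→L[ℝ] ℂ) × (Fin q → E) =>
      (Module.finBasis ℝ E).equivFunL (z.2 i) (a i)) := fun i =>
    ((ContinuousLinearMap.proj (R := ℝ) (φ := fun _ => ℝ) (a i)).comp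
      (((Module.finBasis ℝ E).equivFunL : E →L[ℝ] (Fin (Module.finrank ℝ E) → ℝ)).comp
      ((ContinuousLinearMap.proj (R := ℝ) (φ := fun _ : Fin q => E) i).comp
        (ContinuousLinearMap.snd ℝ (E [⋀^Fin q]→L[ℝ] ℂ) (Fin q → E))))).contDiff
  have h2 : ContDiff ℝ ∞ (fun z : (E [⋀^Fin q]→L[ℝ] ℂ) × (Fin q → E) =>
      z.1 (fun i => Module.finBasis ℝ E (a i))) :=
    ((ContinuousAlternatingMap.apply ℝ E ℂ fun i => Module.finBasis ℝ E (a i)).comp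
      (ContinuousLinearMap.fst ℝ (E [⋀^Fin q]→L[ℝ] ℂ) (Fin q → E))).contDiff
  exact (contDiff_prod (t := Finset.univ) fun i _ => h1 i).smul h2

/-- An alternating form depends linearly and continuously on its components. -/
theorem exists_alternating_of_components (q : ℕ) :
    ∃ R : ((Fin q → Fin (Module.finrank ℝ E)) → ℂ) →L[ℝ] (E [⋀^Fin q]→L[ℝ] ℂ),
      ∀ f : E [⋀^Fin q]→L[ℝ] ℂ, R (fun a => f (fun i => Module.finBasis ℝ E (a i))) = f := by
  let C : (E [⋀^Fin q]→L[ℝ] ℂ) →ₗ[ℝ] ((Fin q → Fin (Module.finrank ℝ E)) → ℂ) :=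
    LinearMap.pi fun a =>
      (ContinuousAlternatingMap.apply ℝ E ℂ fun i => Module.finBasis ℝ E (a i)).toLinearMap
  have hC : C.ker = ⊥ := by
    refine LinearMap.ker_eq_bot'.2 fun f hf => ?_
    ext z
    rw [alternating_apply_eq_sum]
    refine Finset.sum_eq_zero fun a _ => ?_
    have : f (fun i => Module.finBasis ℝ E (a i)) = 0 := congrFun hf a
    rw [this, smul_zero]
  obtain ⟨R, hR⟩ := LinearMap.exists_leftInverse_of_injective C hC
  exact ⟨LinearMap.toContinuousLinearMap R, fun f => LinearMap.congr_fun hR f⟩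

end SmoothFunctions

/-! ### Smoothness of dual vector fields -/

section SmoothDuals

variable {E : Type*} [NormedAddCommGroup E] [NormedSpace ℝ E] [FiniteDimensional ℝ E]
  {M : Type*} [TopologicalSpace M] [ChartedSpace E M] [IsManifold 𝓘(ℝ, E) ∞ M]

/-- The vector field dual to a smooth one-form is smooth. -/
theorem smoothVFieldAt_vecOf {m : M}
    {b : ∀ x : M, TangentSpace 𝓘(ℝ, E) x →ₗ[ℝ] TangentSpace 𝓘(ℝ, E) x →ₗ[ℝ] ℝ}
    (hb : ∀ x v, b x v = 0 → v = 0)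
    (hsm : ∀ i j, ContMDiffAt 𝓘(ℝ, E) 𝓘(ℝ, ℝ) ∞
      (fun x => b x (coordField m i x) (coordField m j x)) m)
    {α : ∀ x : M, TangentSpace 𝓘(ℝ, E) x →ₗ[ℝ] ℝ}
    (hα : ∀ j, ContMDiffAt 𝓘(ℝ, E) 𝓘(ℝ, ℝ) ∞ (fun x => α x (coordField m j x)) m) :
    SmoothVFieldAt (fun x => vecOf (b x) (α x)) m := by
  have hm := mem_chart_source E m
  set n := Module.finrank ℝ E
  let φ : Fin n → E →L[ℝ] ℝ := fun i =>
    (ContinuousLinearMap.proj i).comp ((Module.finBasis ℝ E).equivFunL : E →L[ℝ] (Fin n → ℝ))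
  let T : Fin n → Fin n → E →L[ℝ] (Fin n → ℝ) := fun i j => (φ i).smulRight (Pi.single j 1)
  -- the Gram matrix of the frame of coordinate fields; its inverse is smooth
  let B : M → E →L[ℝ] (Fin n → ℝ) := fun x =>
    ∑ i, ∑ j, b x (coordField m i x) (coordField m j x) • T i j
  have hB : ∀ x, ∀ u j, B x u j = b x (tangentVec m x u) (coordField m j x) := fun x u j => by
    have h1 : tangentVec m x u = ∑ i, φ i u • coordField m i x := by
      conv_lhs => rw [← (Module.finBasis ℝ E).sum_equivFun u, map_sum]
      exact Finset.sum_congr rfl fun i _ => by rw [map_smul]; rfl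
    rw [h1]
    simp [B, T, Finset.sum_apply, Pi.single_apply, mul_comm]
    rfl
  have hBsm : ContMDiffAt 𝓘(ℝ, E) 𝓘(ℝ, E →L[ℝ] (Fin n → ℝ)) ∞ B m := by
    refine ContMDiffAt.sum fun i _ => ContMDiffAt.sum fun j _ => ?_
    exact contMDiffAt_contDiff_comp
      (ContinuousLinearMap.toSpanSingleton ℝ (T i j)).contDiff (hsm i j)
  have hinj : ∀ x ∈ (chartAt E m).source, Function.Injective (B x) := fun x hx => by
    refine (injective_iff_map_eq_zero (B x)).2 fun u hu => ?_
    have h1 : b x (tangentVec m x u) = 0 := by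
      ext v
      rw [← sum_coordField hx v, map_sum]
      refine Finset.sum_eq_zero fun j _ => ?_
      rw [map_smul, ← hB x u j, hu]
      simp
    rw [← tangentCoord_tangentVec hx u, hb x _ h1, map_zero]
  have hequiv : ∀ x ∈ (chartAt E m).source, ∃ e : E ≃L[ℝ] (Fin n → ℝ), (e : E →L[ℝ] _) = B x :=
    fun x hx => ⟨(LinearEquiv.ofInjectiveOfFinrankEq (B x).toLinearMap (hinj x hx)
      (by simp [n])).toContinuousLinearEquiv, by ext u j; rfl⟩
  have hinv : ContMDiffAt 𝓘(ℝ, E) 𝓘(ℝ, (Fin n → ℝ) →L[ℝ] E) ∞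
      (fun x => ContinuousLinearMap.inverse (B x)) m := by
    obtain ⟨e, he⟩ := hequiv m hm
    have h1 := contDiffAt_map_inverse (n := ∞) e
    rw [he] at h1
    exact h1.contMDiffAt.comp m hBsm
  have ha : ContMDiffAt 𝓘(ℝ, E) 𝓘(ℝ, Fin n → ℝ) ∞ (fun x j => α x (coordField m j x)) m :=
    contMDiffAt_pi_space.2 hα
  rw [smoothVFieldAt_iff hm]
  refine (hinv.clm_apply ha).congr_of_eventuallyEq ?_
  refine (eventually_mem_chart_source hm).mono fun x hx => ?_
  obtain ⟨e, he⟩ := hequiv x hx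
  change _ = ContinuousLinearMap.inverse (B x) _
  rw [← he, ContinuousLinearMap.inverse_equiv]
  refine (e.symm_apply_eq.2 ?_).symm
  change _ = (e : E →L[ℝ] (Fin n → ℝ)) _
  rw [he]
  funext j
  rw [hB, tangentVec_tangentCoord hx, vecOf_spec (hb x)]

variable (K : AlmostKahler E M)

theorem smoothVFieldAt_metric_dual {m : M} {α : ∀ x : M, TangentSpace 𝓘(ℝ, E) x →ₗ[ℝ] ℝ}
    (hα : ∀ j, ContMDiffAt 𝓘(ℝ, E) 𝓘(ℝ, ℝ) ∞ (fun x => α x (coordField m j x)) m) :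
    SmoothVFieldAt (fun x => vecOf (K.metric x) (α x)) m :=
  have hc := smoothVFieldAt_coordField (E := E) (mem_chart_source E m)
  smoothVFieldAt_vecOf K.metric_nondegenerate (fun i j => contMDiffAt_metric K (hc i) (hc j)) hα

theorem smoothVFieldAt_dualCoordField (m : M) (i : Fin (Module.finrank ℝ E)) :
    SmoothVFieldAt (dualCoordField K m i) m := by
  refine smoothVFieldAt_metric_dual K fun j => ?_
  refine (contMDiffAt_const
    (c := (Module.finBasis ℝ E).coord i (Module.finBasis ℝ E j))).congr_of_eventuallyEq ?_
  refine (eventually_mem_chart_source (mem_chart_source E m)).mono fun x hx => ?_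
  change (Module.finBasis ℝ E).coord i (tangentCoord E m x (coordField m j x)) = _
  rw [coordField_eq, tangentCoord_tangentVec hx]

end SmoothDuals

/-! ### Smooth forms -/

section SmoothForms

variable {E : Type*} [NormedAddCommGroup E] [NormedSpace ℝ E] [FiniteDimensional ℝ E]
  {M : Type*} [TopologicalSpace M] [ChartedSpace E M] [IsManifold 𝓘(ℝ, E) ∞ M]
  {L : M → Type*} [TopologicalSpace (TotalSpace ℂ L)]
  [∀ m, NormedAddCommGroup (L m)] [∀ m, InnerProductSpace ℂ (L m)]
  [FiberBundle ℂ L] [VectorBundle ℂ ℂ L] [VectorBundle ℝ ℂ L]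
  {p : ℕ} {s t : ∀ m : M, FormFibre E L p m} {m : M}

/-- A section of `Λ^* T^*M ⊗ L^p` is smooth at a point. -/
def SmoothFormAt (p : ℕ) (s : ∀ m : M, FormFibre E L p m) (m : M) : Prop :=
  ∀ q, ContMDiffAt 𝓘(ℝ, E) 𝓘(ℝ, E [⋀^Fin q]→L[ℝ] ℂ) ∞
    (fun x => toModel p m x q (s x q)) m

theorem smoothForm_iff : SmoothForm p s ↔ ∀ m, SmoothFormAt p s m := forall_comm

theorem SmoothFormAt.diff (hs : SmoothFormAt p s m) : DiffFormAt p s m :=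
  fun q => (hs q).mdifferentiableAt (by simp)

theorem SmoothFormAt.congr (hs : SmoothFormAt p s m) (h : ∀ᶠ x in 𝓝 m, t x = s x) :
    SmoothFormAt p t m := fun q =>
  (hs q).congr_of_eventuallyEq (h.mono fun x hx => by simp [hx])

/-- The components of a smooth form along smooth vector fields are smooth. -/
theorem SmoothFormAt.eval (hs : SmoothFormAt p s m) {q : ℕ} {Y : Fin q → VField E M}
    (hY : ∀ i, SmoothVFieldAt (Y i) m) : ContMDiffAt 𝓘(ℝ, E) 𝓘(ℝ, ℂ) ∞
      (fun y => powCoord L p m y (s y q (fun i => Y i y))) m := by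
  have hm := mem_chart_source E m
  have h1 : ContMDiffAt 𝓘(ℝ, E) 𝓘(ℝ, Fin q → E) ∞ (fun y i => tangentCoord E m y (Y i y)) m :=
    contMDiffAt_pi_space.2 fun i => (smoothVFieldAt_iff hm).1 (hY i)
  refine (contMDiffAt_contDiff_comp (contDiff_alternating_apply q)
    (contMDiffAt_prod_space (hs q) h1)).congr_of_eventuallyEq ?_
  exact (eventually_mem_chart_source hm).mono fun y hy => powCoord_eq_toModel hy _ _

/-- A form is smooth as soon as its components along coordinate fields are. -/
theorem smoothFormAt_of_eval
    (h : ∀ (q : ℕ) (w : Fin q → E), ContMDiffAt 𝓘(ℝ, E) 𝓘(ℝ, ℂ) ∞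
      (fun y => powCoord L p m y (s y q (fun i => tangentVec m y (w i)))) m) :
    SmoothFormAt p s m := fun q => by
  obtain ⟨R, hR⟩ := exists_alternating_of_components (E := E) q
  have h1 : ContMDiffAt 𝓘(ℝ, E) 𝓘(ℝ, (Fin q → Fin (Module.finrank ℝ E)) → ℂ) ∞
      (fun (y : M) (a : Fin q → Fin (Module.finrank ℝ E)) =>
        toModel p m y q (s y q) (fun i => Module.finBasis ℝ E (a i))) m :=
    contMDiffAt_pi_space.2 fun a => h q fun i => Module.finBasis ℝ E (a i)
  have h2 := contMDiffAt_contDiff_comp R.contDiff h1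
  simp only [hR] at h2
  exact h2

theorem SmoothFormAt.add (hs : SmoothFormAt p s m) (ht : SmoothFormAt p t m) :
    SmoothFormAt p (fun x => s x + t x) m := smoothFormAt_of_eval fun q w => by
  have hw := fun i => smoothVFieldAt_tangentVec (mem_chart_source E m) (w i)
  refine ((hs.eval hw).add (ht.eval hw)).congr_of_eventuallyEq ?_
  exact Filter.Eventually.of_forall fun y => by
    simp only [Forms.add_apply, map_add]; rfl

theorem SmoothFormAt.smul {f : M → ℂ} (hf : ContMDiffAt 𝓘(ℝ, E) 𝓘(ℝ, ℂ) ∞ f m)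
    (hs : SmoothFormAt p s m) :
    SmoothFormAt p (fun x => f x • s x) m := smoothFormAt_of_eval fun q w => by
  have hw := fun i => smoothVFieldAt_tangentVec (mem_chart_source E m) (w i)
  refine (contMDiffAt_mul hf (hs.eval hw)).congr_of_eventuallyEq ?_
  exact Filter.Eventually.of_forall fun y => by
    simp only [Forms.smul_apply, map_smul]; rfl

theorem SmoothFormAt.const_smul (a : ℂ) (hs : SmoothFormAt p s m) :
    SmoothFormAt p (fun x => a • s x) m := SmoothFormAt.smul contMDiffAt_const hs

theorem SmoothFormAt.sub (hs : SmoothFormAt p s m) (ht : SmoothFormAt p t m) :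
    SmoothFormAt p (fun x => s x - t x) m :=
  (hs.add (ht.const_smul (-1))).congr (Filter.Eventually.of_forall fun x => by
    rw [neg_one_smul, sub_eq_add_neg])

theorem SmoothFormAt.sum {ι : Type*} (a : Finset ι) {s : ι → ∀ m : M, FormFibre E L p m}
    (hs : ∀ i ∈ a, SmoothFormAt p (s i) m) : SmoothFormAt p (fun x => ∑ i ∈ a, s i x) m := by
  induction a using Finset.cons_induction with
  | empty =>
    refine smoothFormAt_of_eval fun q w => ?_
    refine (contMDiffAt_const (c := (0 : ℂ))).congr_of_eventuallyEq ?_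
    exact Filter.Eventually.of_forall fun y => by simp
  | cons i a hi ih =>
    simp only [Finset.sum_cons]
    exact (hs i (Finset.mem_cons_self i a)).add
      (ih fun j hj => hs j (Finset.mem_cons_of_mem hj))

theorem SmoothFormAt.contract {Z : VField E M} (hZ : SmoothVFieldAt Z m)
    (hs : SmoothFormAt p s m) : SmoothFormAt p (fun x => contract (Z x) (s x)) m :=
  smoothFormAt_of_eval fun q w => by
  have hw : ∀ i, SmoothVFieldAt (E := E)
      ((Fin.cons Z (fun i y => tangentVec m y (w i)) : Fin (q + 1) → VField E M) i) m := fun i => by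
    refine Fin.cases ?_ (fun i => ?_) i
    · exact hZ
    · exact smoothVFieldAt_tangentVec (mem_chart_source E m) (w i)
  refine (hs.eval hw).congr_of_eventuallyEq (Filter.Eventually.of_forall fun y => ?_)
  simp only [contract_apply]
  congr 2
  funext i
  refine Fin.cases rfl (fun i => rfl) i

theorem SmoothFormAt.wedge {θ : ∀ x : M, TangentSpace 𝓘(ℝ, E) x →ₗ[ℝ] ℂ}
    (hθ : ∀ Y : VField E M, SmoothVFieldAt Y m →
      ContMDiffAt 𝓘(ℝ, E) 𝓘(ℝ, ℂ) ∞ (fun x => θ x (Y x)) m)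
    (hs : SmoothFormAt p s m) : SmoothFormAt p (fun x => wedge (θ x) (s x)) m :=
  smoothFormAt_of_eval fun q w => by
  have hw := fun i => smoothVFieldAt_tangentVec (mem_chart_source E m) (w i)
  cases q with
  | zero =>
    refine (contMDiffAt_const (c := (0 : ℂ))).congr_of_eventuallyEq ?_
    exact Filter.Eventually.of_forall fun y => by simp [wedge_apply_zero]
  | succ q =>
    have h1 : ∀ i : Fin (q + 1), ContMDiffAt 𝓘(ℝ, E) 𝓘(ℝ, ℂ) ∞ (fun y =>
        (-1 : ℂ) ^ (i : ℕ) * (θ y (tangentVec m y (w i)) *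
          powCoord L p m y (s y q (fun j => tangentVec m y (w (i.succAbove j)))))) m := fun i =>
      contMDiffAt_mul contMDiffAt_const (contMDiffAt_mul (hθ _ (hw i))
        (hs.eval fun j => hw (i.succAbove j)))
    refine (ContMDiffAt.sum (t := Finset.univ) fun i _ => h1 i).congr_of_eventuallyEq
      (Filter.Eventually.of_forall fun y => ?_)
    simp only [wedge_apply_succ, map_sum, map_smul, smul_eq_mul]
    rfl

variable (K : AlmostKahler E M)

/-- Clifford multiplication by a smooth vector field preserves smoothness. -/
theorem SmoothFormAt.cl {Z : VField E M} (hZ : SmoothVFieldAt Z m)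
    (hs : SmoothFormAt p s m) : SmoothFormAt p (fun x => cl K (Z x) (s x)) m := by
  refine SmoothFormAt.const_smul _ (SmoothFormAt.sub (SmoothFormAt.wedge (fun Y hY => ?_) hs)
    (SmoothFormAt.const_smul _ (SmoothFormAt.add (hs.contract hZ)
      (SmoothFormAt.const_smul _ (hs.contract (hZ.map_J K))))))
  simp only [dual10_apply]
  exact ((contMDiffAt_mul contMDiffAt_const (contMDiffAt_ofReal (contMDiffAt_metric K hZ hY)))).sub
    (contMDiffAt_mul contMDiffAt_const
      (contMDiffAt_ofReal (contMDiffAt_metric K (hZ.map_J K) hY)))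

/-- A smooth field of endomorphisms acts smoothly through its Clifford trace. The frame in the
definition varies discontinuously with the point, and is replaced by the frame of coordinate fields.
-/
theorem SmoothFormAt.cliffordTrace
    {T : ∀ x : M, TangentSpace 𝓘(ℝ, E) x →ₗ[ℝ] TangentSpace 𝓘(ℝ, E) x}
    (hT : ∀ i, SmoothVFieldAt (fun x => T x (coordField m i x)) m)
    (hs : SmoothFormAt p s m) : SmoothFormAt p (fun x => cliffordTrace (K.metric x) (K.Jlin x)
      (dualTangentBasis K x) (tangentBasis x) (T x) (s x)) m := by
  refine (SmoothFormAt.sum Finset.univ fun i _ =>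
    (hs.cl K (hT i)).cl K (smoothVFieldAt_dualCoordField K m i)).congr ?_
  refine (eventually_mem_chart_source (mem_chart_source E m)).mono fun x hx => ?_
  rw [(isDualFrame_tangentBasis K x).cliffordTrace_eq (K.hermitianPair x).symm
    (isDualFrame_coordField K hx), cliffordTrace_apply]
  rfl

theorem contMDiffAt_trace (K : AlmostKahler E M)
    {T : ∀ x : M, TangentSpace 𝓘(ℝ, E) x →ₗ[ℝ] TangentSpace 𝓘(ℝ, E) x}
    (hT : ∀ i, SmoothVFieldAt (fun x => T x (coordField m i x)) m) :
    ContMDiffAt 𝓘(ℝ, E) 𝓘(ℝ, ℝ) ∞ (fun x => LinearMap.trace ℝ _ (T x)) m := by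
  refine (ContMDiffAt.sum (t := Finset.univ) fun i _ => contMDiffAt_metric K
    (smoothVFieldAt_dualCoordField K m i) (hT i)).congr_of_eventuallyEq ?_
  exact (eventually_mem_chart_source (mem_chart_source E m)).mono fun x hx =>
    (isDualFrame_coordField K hx).trace_eq _

theorem contMDiffAt_trace10 {T : ∀ x : M, TangentSpace 𝓘(ℝ, E) x →ₗ[ℝ] TangentSpace 𝓘(ℝ, E) x}
    (hT : ∀ i, SmoothVFieldAt (fun x => T x (coordField m i x)) m) :
    ContMDiffAt 𝓘(ℝ, E) 𝓘(ℝ, ℂ) ∞ (fun x => trace10 (K.Jlin x) (T x)) m := by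
  have h1 := contMDiffAt_trace K hT
  have h2 := contMDiffAt_trace (T := fun x => K.Jlin x ∘ₗ T x) K fun i => (hT i).map_J K
  exact contMDiffAt_mul contMDiffAt_const ((contMDiffAt_ofReal h1).sub
    (contMDiffAt_mul contMDiffAt_const (contMDiffAt_ofReal h2)))

end SmoothForms

/-! ### The induced connection on forms -/

section FormConnection

variable {E : Type*} [NormedAddCommGroup E] [NormedSpace ℝ E] [FiniteDimensional ℝ E]
  {M : Type*} [TopologicalSpace M] [ChartedSpace E M] [IsManifold 𝓘(ℝ, E) ∞ M]
  {L : M → Type*} [TopologicalSpace (TotalSpace ℂ L)]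
  [∀ m, NormedAddCommGroup (L m)] [∀ m, InnerProductSpace ℂ (L m)]
  [FiberBundle ℂ L] [VectorBundle ℂ ℂ L] [VectorBundle ℝ ℂ L]
  (K : AlmostKahler E M)
  (nabla : CovariantDerivative 𝓘(ℝ, E) E (TangentSpace 𝓘(ℝ, E) : M → Type _))
  (nablaL : CovariantDerivative 𝓘(ℝ, E) ℂ L)
  {p : ℕ} {s t : ∀ m : M, FormFibre E L p m} {m : M}

theorem mem_baseSet_self (L : M → Type*) [TopologicalSpace (TotalSpace ℂ L)]
    [∀ m, NormedAddCommGroup (L m)] [∀ m, InnerProductSpace ℂ (L m)]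
    [FiberBundle ℂ L] [VectorBundle ℂ ℂ L] (m : M) : m ∈ (trivializationAt ℂ L m).baseSet :=
  FiberBundle.mem_baseSet_trivializationAt' m

/-- Along vector fields that are parallel at `m` for `nablaJ`, the connection `nablaForms` is the
derivative of the components. -/
theorem hasDirDeriv_powCoord_parallel (hs : DiffFormAt p s m) (v : TangentSpace 𝓘(ℝ, E) m) {q : ℕ}
    {Y : Fin q → VField E M} (hY : ∀ i, SmoothVFieldAt (Y i) m)
    (hpar : ∀ i, nablaJConnection K nabla (Y i) m = 0) :
    HasDirDeriv (fun y => powCoord L p m y (s y q (fun i => Y i y))) m v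
      (powCoord L p m m (nablaForms K nabla nablaL p s m v q (fun i => Y i m))
        - p * thetaL nablaL m v * powCoord L p m m (s m q (fun i => Y i m))) := by
  have h := hasDirDeriv_powCoord_self K nabla nablaL hs v fun i => (hY i).diff
  refine ⟨h.diff, h.eq.trans ?_⟩
  rw [Finset.sum_eq_zero, add_zero]
  intro i _
  rw [← nablaJConnection_apply, hpar]
  rw [(s m q).map_coord_zero i (by simp), map_zero]

/-- Characterization of `nablaForms` by parallel vector fields. -/
theorem nablaForms_eq_of_parallel (hs : DiffFormAt p s m) (v : TangentSpace 𝓘(ℝ, E) m)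
    {σ : FormFibre E L p m}
    (h : ∀ (q : ℕ) (Y : Fin q → VField E M), (∀ i, SmoothVFieldAt (Y i) m) →
      (∀ i, nablaJConnection K nabla (Y i) m = 0) →
      HasDirDeriv (fun y => powCoord L p m y (s y q (fun i => Y i y))) m v
      (powCoord L p m m (σ q (fun i => Y i m))
        - p * thetaL nablaL m v * powCoord L p m m (s m q (fun i => Y i m)))) :
    nablaForms K nabla nablaL p s m v = σ := by
  refine formFibre_ext (mem_baseSet_self L m) fun q w => ?_
  choose Y hY hYm hpar using fun i => exists_parallel (nablaJConnection K nabla) m (w i)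
  obtain rfl : (fun i => Y i m) = w := funext hYm
  exact sub_left_injective ((hasDirDeriv_powCoord_parallel K nabla nablaL hs v hY hpar).unique
    (h q Y hY hpar))

theorem nablaForms_add (hs : SmoothFormAt p s m) (ht : SmoothFormAt p t m)
    (v : TangentSpace 𝓘(ℝ, E) m) :
    nablaForms K nabla nablaL p (fun x => s x + t x) m v
      = nablaForms K nabla nablaL p s m v + nablaForms K nabla nablaL p t m v := by
  refine nablaForms_eq_of_parallel K nabla nablaL (hs.add ht).diff v fun q Y hY hpar => ?_
  have h := (hasDirDeriv_powCoord_parallel K nabla nablaL hs.diff v hY hpar).add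
    (hasDirDeriv_powCoord_parallel K nabla nablaL ht.diff v hY hpar)
  simp only [Forms.add_apply, map_add]
  refine ⟨h.diff, h.eq.trans ?_⟩
  ring

theorem nablaForms_smul (a : ℂ) (hs : SmoothFormAt p s m) (v : TangentSpace 𝓘(ℝ, E) m) :
    nablaForms K nabla nablaL p (fun x => a • s x) m v
      = a • nablaForms K nabla nablaL p s m v := by
  refine nablaForms_eq_of_parallel K nabla nablaL (hs.const_smul a).diff v fun q Y hY hpar => ?_
  have h := (hasDirDeriv_const a).mul
    (hasDirDeriv_powCoord_parallel K nabla nablaL hs.diff v hY hpar)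
  simp only [Forms.smul_apply, map_smul, smul_eq_mul]
  refine ⟨h.diff, h.eq.trans ?_⟩
  ring

theorem nablaForms_dir_add (hs : SmoothFormAt p s m) (v w : TangentSpace 𝓘(ℝ, E) m) :
    nablaForms K nabla nablaL p s m (v + w)
      = nablaForms K nabla nablaL p s m v + nablaForms K nabla nablaL p s m w := by
  refine nablaForms_eq_of_parallel K nabla nablaL hs.diff (v + w) fun q Y hY hpar => ?_
  have h1 := hasDirDeriv_powCoord_parallel K nabla nablaL hs.diff v hY hpar
  have h2 := hasDirDeriv_powCoord_parallel K nabla nablaL hs.diff w hY hpar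
  refine ⟨h1.diff, ?_⟩
  rw [map_add, h1.eq, h2.eq, Forms.add_apply, map_add, thetaL, thetaL, thetaL, map_add, map_add]
  ring

theorem nablaForms_dir_smul (hs : SmoothFormAt p s m) (a : ℝ) (v : TangentSpace 𝓘(ℝ, E) m) :
    nablaForms K nabla nablaL p s m (a • v) = (a : ℂ) • nablaForms K nabla nablaL p s m v := by
  refine nablaForms_eq_of_parallel K nabla nablaL hs.diff (a • v) fun q Y hY hpar => ?_
  have h1 := hasDirDeriv_powCoord_parallel K nabla nablaL hs.diff v hY hpar
  refine ⟨h1.diff, ?_⟩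
  rw [map_smul, h1.eq, Forms.smul_apply, map_smul, thetaL, thetaL, map_smul,
    ← Complex.coe_smul a (nablaL _ m v), map_smul, Complex.real_smul, smul_eq_mul, smul_eq_mul]
  ring

variable {nabla} (hnabla : K.IsLeviCivita nabla)
include hnabla

/-- The connections `nablaForms` and `nablaJ` are compatible with Clifford multiplication. -/
theorem nablaForms_cl {Z : VField E M} (hZ : SmoothVFieldAt Z m) (hs : SmoothFormAt p s m)
    (v : TangentSpace 𝓘(ℝ, E) m) :
    nablaForms K nabla nablaL p (fun x => cl K (Z x) (s x)) m v
      = cl K (nablaJ K nabla Z m v) (s m) + cl K (Z m) (nablaForms K nabla nablaL p s m v) := by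
  -- Along parallel fields both sides are derivatives of functions, and the ordinary Leibniz rule
  -- applies.
  refine nablaForms_eq_of_parallel K nabla nablaL (hs.cl K hZ).diff v fun q Y hY hpar => ?_
  -- contraction by a vector field
  have hcon : ∀ Z : VField E M, SmoothVFieldAt Z m →
      HasDirDeriv (fun y => powCoord L p m y (contract (Z y) (s y) q (fun i => Y i y))) m v
      (powCoord L p m m ((contract (nablaJ K nabla Z m v) (s m)
          + contract (Z m) (nablaForms K nabla nablaL p s m v)) q (fun i => Y i m))
        - p * thetaL nablaL m v * powCoord L p m m (contract (Z m) (s m) q (fun i => Y i m))) := by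
    intro Z hZ
    let X : Fin (q + 1) → VField E M := Fin.cons Z Y
    have hX : ∀ i, DiffVFieldAt (X i) m := fun i =>
      Fin.cases hZ.diff (fun i => (hY i).diff) i
    have hXx : ∀ x, (fun i => X i x) = Fin.cons (Z x) (fun i => Y i x) := fun x => by
      funext i
      refine Fin.cases rfl (fun i => rfl) i
    have h := hasDirDeriv_powCoord_self K nabla nablaL hs.diff v hX
    rw [Fin.sum_univ_succ, Finset.sum_eq_zero (s := Finset.univ), add_zero] at h
    · simp only [hXx, Fin.update_cons_zero] at h
      refine ⟨h.diff, h.eq.trans ?_⟩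
      simp only [Forms.add_apply, map_add, contract_apply, X, Fin.cons_zero]
      ring
    · intro i _
      have h0 : nablaJ K nabla (X i.succ) m v = 0 := by
        rw [← nablaJConnection_apply]
        simp only [X, Fin.cons_succ, hpar]
        rfl
      rw [h0, (s m (q + 1)).map_coord_zero i.succ (by simp), map_zero]
  -- exterior multiplication by the dual covector
  have hdual : ∀ i, HasDirDeriv (fun y => dual10 (K.metric y) (K.Jlin y) (Z y) (Y i y)) m v
      (dual10 (K.metric m) (K.Jlin m) (nablaJ K nabla Z m v) (Y i m)) := by
    intro i
    have h0 : nablaJ K nabla (Y i) m v = 0 := by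
      rw [← nablaJConnection_apply, hpar]
      rfl
    have h1 := hasDirDeriv_metric_nablaJ K hnabla hZ.diff (hY i).diff v
    have h2 := hasDirDeriv_metric_nablaJ K hnabla (hZ.diff.map_J K) (hY i).diff v
    rw [h0, map_zero, add_zero] at h1 h2
    rw [nablaJ_map_J K hZ.diff] at h2
    have h3 := ((hasDirDeriv_const (1 / 2 : ℂ)).mul (h1.clm Complex.ofRealCLM)).sub
      ((hasDirDeriv_const (Complex.I / 2 : ℂ)).mul (h2.clm Complex.ofRealCLM))
    simp only [dual10_apply]
    refine ⟨h3.diff, h3.eq.trans ?_⟩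
    simp only [zero_mul, zero_add, Complex.ofRealCLM_apply]
    rfl
  have hwed : HasDirDeriv (fun y => powCoord L p m y
        (wedge (dual10 (K.metric y) (K.Jlin y) (Z y)) (s y) q (fun i => Y i y))) m v
      (powCoord L p m m ((wedge (dual10 (K.metric m) (K.Jlin m) (nablaJ K nabla Z m v)) (s m)
          + wedge (dual10 (K.metric m) (K.Jlin m) (Z m))
            (nablaForms K nabla nablaL p s m v)) q (fun i => Y i m))
        - p * thetaL nablaL m v * powCoord L p m m
          (wedge (dual10 (K.metric m) (K.Jlin m) (Z m)) (s m) q (fun i => Y i m))) := by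
    cases q with
    | zero =>
      simp only [wedge_apply_zero, Forms.add_apply, AlternatingMap.zero_apply, map_zero, add_zero,
        mul_zero, sub_zero]
      exact hasDirDeriv_const 0
    | succ q =>
      have h1 : ∀ i : Fin (q + 1), _ := fun i => (hasDirDeriv_const ((-1 : ℂ) ^ (i : ℕ))).mul
        ((hdual i).mul (hasDirDeriv_powCoord_parallel K nabla nablaL hs.diff v
          (Y := fun j => Y (i.succAbove j)) (fun j => hY _) (fun j => hpar _)))
      have h2 := HasDirDeriv.sum Finset.univ fun i _ => h1 i
      simp only [wedge_apply_succ, Forms.add_apply, map_add, map_sum, map_smul, smul_eq_mul]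
      refine ⟨h2.diff, h2.eq.trans ?_⟩
      rw [Finset.mul_sum, ← Finset.sum_add_distrib, ← Finset.sum_sub_distrib]
      refine Finset.sum_congr rfl fun i _ => ?_
      have hr : (i.removeNth fun i => Y i m) = fun j => Y (i.succAbove j) m := rfl
      simp only [hr]
      ring
  have h1 := (hasDirDeriv_const (Real.sqrt 2 : ℂ)).mul (hwed.sub
    ((hasDirDeriv_const (1 / 2 : ℂ)).mul ((hcon Z hZ).add
      ((hasDirDeriv_const Complex.I).mul (hcon _ (hZ.map_J K))))))
  have h2 : ∀ x (Z : TangentSpace 𝓘(ℝ, E) x) (σ : FormFibre E L p x) (w : Fin q → _),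
      powCoord L p m x (cl K Z σ q w) = (Real.sqrt 2 : ℂ) *
        (powCoord L p m x (wedge (dual10 (K.metric x) (K.Jlin x) Z) σ q w)
        - (1 / 2 : ℂ) * (powCoord L p m x (contract Z σ q w)
          + Complex.I * powCoord L p m x (contract (K.J x Z) σ q w))) := fun x Z σ w => by
    simp only [cl, clifford_apply, contract01_apply, Forms.smul_apply, Forms.sub_apply,
      Forms.add_apply, map_smul, map_sub, map_add, smul_eq_mul, K.Jlin_apply]
  simp only [h2, Forms.add_apply, map_add]
  refine ⟨h1.diff, h1.eq.trans ?_⟩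
  simp only [nablaJ_map_J K hZ.diff, Forms.add_apply, map_add]
  ring

end FormConnection

/-! ### The Clifford connection -/

section SpinorConnection

variable {E : Type*} [NormedAddCommGroup E] [NormedSpace ℝ E] [FiniteDimensional ℝ E]
  {M : Type*} [TopologicalSpace M] [ChartedSpace E M] [IsManifold 𝓘(ℝ, E) ∞ M]
  {L : M → Type*} [TopologicalSpace (TotalSpace ℂ L)]
  [∀ m, NormedAddCommGroup (L m)] [∀ m, InnerProductSpace ℂ (L m)]
  [FiberBundle ℂ L] [VectorBundle ℂ ℂ L] [VectorBundle ℝ ℂ L]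
  (K : AlmostKahler E M)
  (nabla : CovariantDerivative 𝓘(ℝ, E) E (TangentSpace 𝓘(ℝ, E) : M → Type _))
  (nablaL : CovariantDerivative 𝓘(ℝ, E) ℂ L)
  {p : ℕ} {s t : ∀ m : M, FormFibre E L p m} {m : M}

theorem cl_add (v w : TangentSpace 𝓘(ℝ, E) m) (σ : FormFibre E L p m) :
    cl K (v + w) σ = cl K v σ + cl K w σ := clifford_add v w σ

theorem cl_smul (a : ℝ) (v : TangentSpace 𝓘(ℝ, E) m) (σ : FormFibre E L p m) :
    cl K (a • v) σ = (a : ℂ) • cl K v σ := clifford_smul a v σ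

theorem cl_cl_self (v : TangentSpace 𝓘(ℝ, E) m) (σ : FormFibre E L p m) :
    cl K v (cl K v σ) = -((K.metric m v v : ℂ) • σ) :=
  (K.hermitianPair m).clifford_clifford_self v σ

theorem cl_anticomm (v w : TangentSpace 𝓘(ℝ, E) m) (σ : FormFibre E L p m) :
    cl K v (cl K w σ) + cl K w (cl K v σ) = -((2 * K.metric m v w : ℂ) • σ) :=
  (K.hermitianPair m).clifford_anticomm v w σ

theorem cl_mem (v : TangentSpace 𝓘(ℝ, E) m) {σ : FormFibre E L p m}
    (hσ : σ ∈ SpinorFibre K L p m) : cl K v σ ∈ SpinorFibre K L p m :=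
  (K.hermitianPair m).clifford_mem_forms01 v hσ

/-- The endomorphism `∑ c(b^i) c(T b_i)` of a fibre of `Λ^* T^*M ⊗ L^p`. -/
def clTrace (L : M → Type*) [∀ m, NormedAddCommGroup (L m)] [∀ m, InnerProductSpace ℂ (L m)]
    (p : ℕ) (m : M) (T : TangentSpace 𝓘(ℝ, E) m →ₗ[ℝ] TangentSpace 𝓘(ℝ, E) m) :
    Module.End ℂ (FormFibre E L p m) :=
  cliffordTrace (K.metric m) (K.Jlin m) (dualTangentBasis K m) (tangentBasis m) T

theorem clTrace_apply (T : TangentSpace 𝓘(ℝ, E) m →ₗ[ℝ] TangentSpace 𝓘(ℝ, E) m)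
    (σ : FormFibre E L p m) :
    clTrace K L p m T σ = ∑ i, cl K (dualTangentBasis K m i) (cl K (T (tangentBasis m i)) σ) :=
  cliffordTrace_apply T σ

theorem clTrace_eq_sum {e : Fin (Module.finrank ℝ E) → TangentSpace 𝓘(ℝ, E) m}
    (he : IsDualFrame (K.metric m) e e)
    (T : TangentSpace 𝓘(ℝ, E) m →ₗ[ℝ] TangentSpace 𝓘(ℝ, E) m) :
    clTrace K L p m T = ∑ k, cl K (e k) * cl K (T (e k)) :=
  (isDualFrame_tangentBasis K m).cliffordTrace_eq (K.hermitianPair m).symm he T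

theorem clTrace_mem (T : TangentSpace 𝓘(ℝ, E) m →ₗ[ℝ] TangentSpace 𝓘(ℝ, E) m)
    {σ : FormFibre E L p m} (hσ : σ ∈ SpinorFibre K L p m) :
    clTrace K L p m T σ ∈ SpinorFibre K L p m := by
  rw [clTrace_apply]
  exact (SpinorFibre K L p m).sum_mem fun i _ => cl_mem K _ (cl_mem K _ hσ)

/-- The Clifford connection is the connection `nablaForms` corrected by the spin representation of
the intrinsic torsion. -/
theorem nablaSpinor_eq (v : TangentSpace 𝓘(ℝ, E) m) :
    nablaSpinor K nabla nablaL p s m v = nablaForms K nabla nablaL p s m v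
      + (1 / 4 : ℂ) • clTrace K L p m (intrinsicTorsion K nabla m v) (s m) := by
  have h : ∀ i, nabla (coordField m i) m v - nablaJ K nabla (coordField m i) m v
      = intrinsicTorsion K nabla m v (tangentBasis m i) := fun i => by
    rw [nabla_sub_nablaJ K (smoothVFieldAt_coordField (mem_chart_source E m) i).diff,
      tangentBasis_apply]
  rw [clTrace_apply]
  simp only [← h]
  rfl

theorem nablaSpinor_add (hs : SmoothFormAt p s m) (ht : SmoothFormAt p t m)
    (v : TangentSpace 𝓘(ℝ, E) m) :
    nablaSpinor K nabla nablaL p (fun x => s x + t x) m v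
      = nablaSpinor K nabla nablaL p s m v + nablaSpinor K nabla nablaL p t m v := by
  rw [nablaSpinor_eq, nablaSpinor_eq, nablaSpinor_eq, nablaForms_add K nabla nablaL hs ht, map_add]
  module

theorem nablaSpinor_smul (a : ℂ) (hs : SmoothFormAt p s m) (v : TangentSpace 𝓘(ℝ, E) m) :
    nablaSpinor K nabla nablaL p (fun x => a • s x) m v
      = a • nablaSpinor K nabla nablaL p s m v := by
  rw [nablaSpinor_eq, nablaSpinor_eq, nablaForms_smul K nabla nablaL a hs, map_smul]
  module

theorem intrinsicTorsion_dir_add (v w : TangentSpace 𝓘(ℝ, E) m) :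
    intrinsicTorsion K nabla m (v + w)
      = intrinsicTorsion K nabla m v + intrinsicTorsion K nabla m w := by
  ext u
  simp [intrinsicTorsion]

theorem intrinsicTorsion_dir_smul (a : ℝ) (v : TangentSpace 𝓘(ℝ, E) m) :
    intrinsicTorsion K nabla m (a • v) = a • intrinsicTorsion K nabla m v := by
  ext u
  simp [intrinsicTorsion]

/-- The spinor connection as a linear map on tangent vectors. -/
def nablaSpinorL (hs : SmoothFormAt p s m) :
    TangentSpace 𝓘(ℝ, E) m →ₗ[ℝ] FormFibre E L p m where
  toFun := nablaSpinor K nabla nablaL p s m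
  map_add' v w := by
    rw [nablaSpinor_eq, nablaSpinor_eq, nablaSpinor_eq, nablaForms_dir_add K nabla nablaL hs,
      intrinsicTorsion_dir_add, clTrace, cliffordTrace_add, LinearMap.add_apply]
    simp only [clTrace]
    module
  map_smul' a v := by
    rw [nablaSpinor_eq, nablaSpinor_eq, nablaForms_dir_smul K nabla nablaL hs,
      intrinsicTorsion_dir_smul, clTrace, cliffordTrace_smul, LinearMap.smul_apply]
    change _ = a • _
    rw [← Complex.coe_smul a]
    simp only [clTrace]
    module

theorem dirac_add (hs : SmoothFormAt p s m) (ht : SmoothFormAt p t m) :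
    dirac K nabla nablaL p (fun x => s x + t x) m
      = dirac K nabla nablaL p s m + dirac K nabla nablaL p t m := by
  simp only [dirac, nablaSpinor_add K nabla nablaL hs ht, map_add, Finset.sum_add_distrib]

theorem dirac_smul (a : ℂ) (hs : SmoothFormAt p s m) :
    dirac K nabla nablaL p (fun x => a • s x) m = a • dirac K nabla nablaL p s m := by
  simp only [dirac, nablaSpinor_smul K nabla nablaL a hs, map_smul, Finset.smul_sum]

/-- The Dirac operator in terms of arbitrary dual frames. -/
theorem dirac_eq_sum (hs : SmoothFormAt p s m) {ι : Type*} [Fintype ι]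
    {b' b : ι → TangentSpace 𝓘(ℝ, E) m} (hb : IsDualFrame (K.metric m) b' b) :
    dirac K nabla nablaL p s m = ∑ i, cl K (b' i) (nablaSpinor K nabla nablaL p s m (b i)) := by
  let β : TangentSpace 𝓘(ℝ, E) m →ₗ[ℝ] TangentSpace 𝓘(ℝ, E) m →ₗ[ℝ] FormFibre E L p m :=
    LinearMap.mk₂ ℝ (fun v w => cl K v (nablaSpinorL K nabla nablaL hs w))
      (fun _ _ _ => cl_add K _ _ _) (fun a _ _ => (cl_smul K a _ _).trans (Complex.coe_smul a _))
      (fun _ _ _ => by rw [map_add, map_add])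
      (fun a v w => by
        rw [map_smul, ← Complex.coe_smul a, ← Complex.coe_smul a, map_smul])
  exact (isDualFrame_tangentBasis K m).sum_eq (K.hermitianPair m).symm hb β

variable {nabla} (hnabla : K.IsLeviCivita nabla)
include hnabla

/-- The spinor connection is a Clifford connection. -/
theorem nablaSpinor_cl {Z : VField E M} (hZ : SmoothVFieldAt Z m) (hs : SmoothFormAt p s m)
    (v : TangentSpace 𝓘(ℝ, E) m) :
    nablaSpinor K nabla nablaL p (fun x => cl K (Z x) (s x)) m v
      = cl K (nabla Z m v) (s m) + cl K (Z m) (nablaSpinor K nabla nablaL p s m v) := by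
  have h1 : nabla Z m v = nablaJ K nabla Z m v + intrinsicTorsion K nabla m v (Z m) := by
    rw [← nabla_sub_nablaJ K hZ.diff v]
    abel
  have h2 : clTrace K L p m (intrinsicTorsion K nabla m v) (cl K (Z m) (s m))
      = cl K (Z m) (clTrace K L p m (intrinsicTorsion K nabla m v) (s m))
        + (4 : ℂ) • cl K (intrinsicTorsion K nabla m v (Z m)) (s m) :=
    (isDualFrame_tangentBasis K m).cliffordTrace_clifford (K.hermitianPair m)
      (intrinsicTorsion_skew K hnabla m v) (Z m) (s m)
  rw [nablaSpinor_eq, nablaSpinor_eq, nablaForms_cl K nablaL hnabla hZ hs, h2, h1, cl_add, map_add,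
    map_smul]
  module

/-- The anticommutator of the Dirac operator and Clifford multiplication by a vector field. -/
theorem dirac_cl_add_cl_dirac {Z : VField E M} (hZ : SmoothVFieldAt Z m)
    (hs : SmoothFormAt p s m) :
    dirac K nabla nablaL p (fun x => cl K (Z x) (s x)) m + cl K (Z m) (dirac K nabla nablaL p s m)
      = clTrace K L p m (nabla Z m).toLinearMap (s m)
        - (2 : ℂ) • nablaSpinor K nabla nablaL p s m (Z m) := by
  have h1 : nablaSpinor K nabla nablaL p s m (Z m)
      = ∑ i, (K.metric m (dualTangentBasis K m i) (Z m) : ℂ) •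
        nablaSpinor K nabla nablaL p s m (tangentBasis m i) := by
    have h2 := congrArg (nablaSpinorL K nabla nablaL hs)
      ((isDualFrame_tangentBasis K m).expand (Z m))
    rw [map_sum] at h2
    refine h2.symm.trans (Finset.sum_congr rfl fun i _ => ?_)
    rw [map_smul]
    exact (Complex.coe_smul _ _).symm
  rw [h1, clTrace_apply, dirac, dirac, map_sum, Finset.smul_sum, ← Finset.sum_add_distrib,
    ← Finset.sum_sub_distrib]
  refine Finset.sum_congr rfl fun i _ => ?_
  rw [nablaSpinor_cl K nablaL hnabla hZ hs, map_add, smul_smul, add_assoc, cl_anticomm]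
  rw [sub_eq_add_neg]
  rfl

end SpinorConnection

/-! ### The square of the deformed Dirac operator -/

section SmoothDirac

variable {E : Type*} [NormedAddCommGroup E] [NormedSpace ℝ E] [FiniteDimensional ℝ E]
  {M : Type*} [TopologicalSpace M] [ChartedSpace E M] [IsManifold 𝓘(ℝ, E) ∞ M] [T2Space M]
  {L : M → Type*} [TopologicalSpace (TotalSpace ℂ L)]
  [∀ m, NormedAddCommGroup (L m)] [∀ m, InnerProductSpace ℂ (L m)]
  [FiberBundle ℂ L] [VectorBundle ℂ ℂ L] [VectorBundle ℝ ℂ L]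
  [ContMDiffVectorBundle ∞ ℂ L 𝓘(ℝ, E)]
  (K : AlmostKahler E M)
  {nabla : CovariantDerivative 𝓘(ℝ, E) E (TangentSpace 𝓘(ℝ, E) : M → Type _)}
  {nablaL : CovariantDerivative 𝓘(ℝ, E) ℂ L}
  {p : ℕ} {s : ∀ m : M, FormFibre E L p m} {m : M}

/-- A vector field that is smooth near `m` agrees near `m` with a global smooth vector field. This
is needed since smoothness of a connection is a statement about global smooth sections. -/
theorem exists_smooth_extension {Y : VField E M} (hY : ∀ᶠ x in 𝓝 m, SmoothVFieldAt Y x) :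
    ∃ Z : VField E M, (∀ x, SmoothVFieldAt Z x) ∧ ∀ᶠ x in 𝓝 m, Z x = Y x := by
  obtain ⟨u, hu, huo, hmu⟩ := eventually_nhds_iff.1 hY
  obtain ⟨Z, hZ, h⟩ := exists_contMDiff_section_eventuallyEq (F := E) huo hmu
    (s := Y) fun x hx => (hu x hx).contMDiffWithinAt
  exact ⟨Z, fun x => hZ x, h⟩

/-- The covariant derivative of a smooth vector field along a smooth vector field is smooth. -/
theorem SmoothVFieldAt.covariantDerivative (hnabla : K.IsLeviCivita nabla) {Y Z : VField E M}
    (hY : ∀ᶠ x in 𝓝 m, SmoothVFieldAt Y x) (hZ : SmoothVFieldAt Z m) :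
    SmoothVFieldAt (fun x => nabla Y x (Z x)) m := by
  obtain ⟨Y', hY', h⟩ := exists_smooth_extension hY
  have h1 : ContMDiff 𝓘(ℝ, E) (𝓘(ℝ, E).prod 𝓘(ℝ, E)) (∞ + 1)
      (fun x => TotalSpace.mk' E (E := TangentSpace 𝓘(ℝ, E)) x (Y' x)) := hY'
  have h2 := hnabla.smooth.contMDiff.contMDiff h1.contMDiffOn
  have h3 : SmoothVFieldAt (fun x => nabla Y' x (Z x)) m :=
    ContMDiffAt.clm_bundle_apply (E₁ := TangentSpace 𝓘(ℝ, E)) (E₂ := TangentSpace 𝓘(ℝ, E))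
      (b := fun x : M => x) (ϕ := fun x => nabla Y' x)
      (h2.contMDiffAt Filter.univ_mem) hZ
  refine h3.congr ?_
  filter_upwards [eventually_eventually_nhds.2 h] with x hx
  rw [covariantDerivative_congr nabla (hY' x).diff (hx.mono fun y hy => hy.symm)]

theorem SmoothVFieldAt.nablaJ (hnabla : K.IsLeviCivita nabla) {Y Z : VField E M}
    (hY : ∀ᶠ x in 𝓝 m, SmoothVFieldAt Y x) (hZ : SmoothVFieldAt Z m) :
    SmoothVFieldAt (fun x => nablaJ K nabla Y x (Z x)) m :=
  SmoothVFieldAt.smul (f := fun _ => (1 / 2 : ℝ)) contMDiffAt_const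
    ((SmoothVFieldAt.covariantDerivative K hnabla hY hZ).sub
      ((SmoothVFieldAt.covariantDerivative K hnabla (hY.mono fun _ hx => hx.map_J K) hZ).map_J K))

theorem eventually_smoothVFieldAt_coordField (m : M) (i : Fin (Module.finrank ℝ E)) :
    ∀ᶠ x in 𝓝 m, SmoothVFieldAt (coordField m i) x :=
  (eventually_mem_chart_source (mem_chart_source E m)).mono fun _ hx =>
    smoothVFieldAt_coordField hx i

theorem eventually_smoothVFieldAt_tangentVec (m : M) (w : E) :
    ∀ᶠ x in 𝓝 m, SmoothVFieldAt (fun y => tangentVec m y w) x :=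
  (eventually_mem_chart_source (mem_chart_source E m)).mono fun _ hx =>
    smoothVFieldAt_tangentVec hx w

theorem SmoothVFieldAt.intrinsicTorsion (hnabla : K.IsLeviCivita nabla) {Y Z : VField E M}
    (hY : ∀ᶠ x in 𝓝 m, SmoothVFieldAt Y x) (hZ : SmoothVFieldAt Z m) :
    SmoothVFieldAt (fun x => intrinsicTorsion K nabla x (Z x) (Y x)) m :=
  ((SmoothVFieldAt.covariantDerivative K hnabla hY hZ).sub
    (SmoothVFieldAt.nablaJ K hnabla hY hZ)).congr
    (hY.mono fun _ hx => (nabla_sub_nablaJ K hx.diff _).symm)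

theorem contMDiffAt_connForm (hL : IsPrequantum K nablaL) {Z : VField E M}
    (hZ : SmoothVFieldAt Z m) :
    ContMDiffAt 𝓘(ℝ, E) 𝓘(ℝ, ℂ) ∞ (fun x => connForm nablaL m x (Z x)) m := by
  obtain ⟨t, ht, hts⟩ := exists_smoothSection_localFrame (E := E) (mem_baseSet_self L m)
  have h1 : ContMDiff 𝓘(ℝ, E) (𝓘(ℝ, E).prod 𝓘(ℝ, ℂ)) (∞ + 1)
      (fun x => TotalSpace.mk' ℂ x (t x)) := ht
  have h2 := hL.smooth.contMDiff.contMDiff h1.contMDiffOn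
  have h3 : ContMDiffAt 𝓘(ℝ, E) (𝓘(ℝ, E).prod 𝓘(ℝ, ℂ)) ∞
      (fun x => TotalSpace.mk' ℂ x (nablaL t x (Z x))) m :=
    ContMDiffAt.clm_bundle_apply (E₁ := TangentSpace 𝓘(ℝ, E)) (E₂ := L)
      (b := fun x : M => x) (ϕ := fun x => nablaL t x)
      (h2.contMDiffAt Filter.univ_mem) hZ
  rw [contMDiffAt_lineSection_iff (mem_baseSet_self L m)] at h3
  refine h3.congr_of_eventuallyEq ?_
  filter_upwards [eventually_eventually_nhds.2 hts, eventually_mem_baseSet (mem_baseSet_self L m)]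
    with x hx hxb
  have hσ : MDifferentiableAt 𝓘(ℝ, E) (𝓘(ℝ, E).prod 𝓘(ℝ, ℂ))
      (fun y => TotalSpace.mk' ℂ y (localFrame L m y)) x :=
    (contMDiffAt_localFrame hxb).mdifferentiableAt (by simp)
  rw [connForm, nablaL.isCovariantDerivativeOnUniv.congr_of_eventuallyEq hσ
    (ht.contMDiffAt.mdifferentiableAt (by simp)) Filter.univ_mem (hx.mono fun y hy => hy.symm)]

/-- The covariant derivative of a smooth form is smooth. The definition uses a different
trivialization at each point; the Leibniz rule `hasDirDeriv_powCoord` expresses it in a fixed one.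
-/
theorem SmoothForm.nablaForms (hnabla : K.IsLeviCivita nabla) (hL : IsPrequantum K nablaL)
    (hs : SmoothForm p s) {Z : VField E M} (hZ : SmoothVFieldAt Z m) :
    SmoothFormAt p (fun x => nablaForms K nabla nablaL p s x (Z x)) m := by
  have hs' := smoothForm_iff.1 hs
  refine smoothFormAt_of_eval fun q w => ?_
  have hw := fun i => eventually_smoothVFieldAt_tangentVec (E := E) m (w i)
  have h1 : ContMDiffAt 𝓘(ℝ, E) 𝓘(ℝ, ℂ) ∞ (fun x =>
      mvfderiv 𝓘(ℝ, E) (fun y => powCoord L p m y (s y q (fun i => tangentVec m y (w i)))) x (Z x)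
      + p * connForm nablaL m x (Z x) *
        powCoord L p m x (s x q (fun i => tangentVec m x (w i)))
      - ∑ i, powCoord L p m x (s x q (fun j => Function.update (fun j x => tangentVec m x (w j)) i
          (fun x => nablaJ K nabla (fun y => tangentVec m y (w i)) x (Z x)) j x))) m := by
    refine ContMDiffAt.sub (ContMDiffAt.add (contMDiffAt_mvfderiv
      ((hs' m).eval fun i => (hw i).self_of_nhds) hZ) (contMDiffAt_mul (contMDiffAt_mul
        contMDiffAt_const (contMDiffAt_connForm K hL hZ))
        ((hs' m).eval fun i => (hw i).self_of_nhds)))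
      (ContMDiffAt.sum fun i _ => (hs' m).eval fun j => ?_)
    rcases eq_or_ne j i with rfl | hj
    · rw [Function.update_self]
      exact SmoothVFieldAt.nablaJ K hnabla (hw j) hZ
    · rw [Function.update_of_ne hj]
      exact (hw j).self_of_nhds
  refine h1.congr_of_eventuallyEq ?_
  filter_upwards [eventually_mem_chart_source (mem_chart_source E m),
    eventually_mem_baseSet (mem_baseSet_self L m)] with x hx hxb
  have h2 := (hasDirDeriv_powCoord K nabla hL hxb (hs' x).diff (Z x)
    (Y := fun i y => tangentVec m y (w i)) fun i => diffVFieldAt_tangentVec hx (w i)).eq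
  rw [h2]
  have h3 : ∀ i, (fun j => Function.update (fun j x => tangentVec m x (w j)) i
      (fun x => nablaJ K nabla (fun y => tangentVec m y (w i)) x (Z x)) j x)
      = Function.update (fun j => tangentVec m x (w j)) i
        (nablaJ K nabla (fun y => tangentVec m y (w i)) x (Z x)) := fun i => by
    funext j
    rcases eq_or_ne j i with rfl | hj
    · simp
    · simp [hj]
  simp only [h3]
  ring

theorem SmoothForm.nablaSpinor (hnabla : K.IsLeviCivita nabla) (hL : IsPrequantum K nablaL)
    (hs : SmoothForm p s) {Z : VField E M} (hZ : SmoothVFieldAt Z m) :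
    SmoothFormAt p (fun x => nablaSpinor K nabla nablaL p s x (Z x)) m := by
  simp only [nablaSpinor_eq]
  refine (hs.nablaForms K hnabla hL hZ).add (SmoothFormAt.const_smul _ ?_)
  exact SmoothFormAt.cliffordTrace K (T := fun x => SpincBochner.intrinsicTorsion K nabla x (Z x))
    (fun i => SmoothVFieldAt.intrinsicTorsion K hnabla
      (eventually_smoothVFieldAt_coordField m i) hZ) (smoothForm_iff.1 hs m)

theorem SmoothForm.dirac (hnabla : K.IsLeviCivita nabla) (hL : IsPrequantum K nablaL)
    (hs : SmoothForm p s) : SmoothForm p (dirac K nabla nablaL p s) := by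
  refine smoothForm_iff.2 fun m => ?_
  refine (SmoothFormAt.sum Finset.univ fun i _ => SmoothFormAt.cl K
    (smoothVFieldAt_dualCoordField K m i) (hs.nablaSpinor K hnabla hL
      (eventually_smoothVFieldAt_coordField m i).self_of_nhds)).congr ?_
  exact (eventually_mem_chart_source (mem_chart_source E m)).mono fun x hx =>
    dirac_eq_sum K nabla nablaL (smoothForm_iff.1 hs x) (isDualFrame_coordField K hx)

/-- The square of a deformed Dirac operator. -/
theorem deformedDirac_deformedDirac (hnabla : K.IsLeviCivita nabla) (hL : IsPrequantum K nablaL)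
    {X : VField E M} (hX : SmoothVFieldAt X m) (hs : SmoothForm p s) (t : ℝ) :
    deformedDirac K nabla nablaL p X t (deformedDirac K nabla nablaL p X t s) m
      = SpincBochner.dirac K nabla nablaL p (SpincBochner.dirac K nabla nablaL p s) m
        + (Complex.I * t / 2) • (clTrace K L p m (nabla X m).toLinearMap (s m)
          - (2 : ℂ) • SpincBochner.nablaSpinor K nabla nablaL p s m (X m))
        + (t ^ 2 / 4 * K.metric m (X m) (X m) : ℂ) • s m := by
  have h1 := dirac_cl_add_cl_dirac K nablaL hnabla hX (smoothForm_iff.1 hs m)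
  have h2 : deformedDirac K nabla nablaL p X t s = fun x => SpincBochner.dirac K nabla nablaL p s x
      + (Complex.I * t / 2) • cl K (X x) (s x) := rfl
  have hc := (smoothForm_iff.1 hs m).cl K hX
  rw [h2, deformedDirac, dirac_add K nabla nablaL (smoothForm_iff.1 (hs.dirac K hnabla hL) m)
    (hc.const_smul _), dirac_smul K nabla nablaL _ hc, map_add, map_smul, cl_cl_self, ← h1]
  have h3 : (Complex.I * t / 2) * (Complex.I * t / 2) = -(t ^ 2 / 4 : ℂ) := by
    linear_combination (t ^ 2 / 4 : ℂ) * Complex.I_mul_I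
  have h4 : (Complex.I * t / 2) • (Complex.I * t / 2) • -((K.metric m (X m) (X m) : ℂ) • s m)
      = (t ^ 2 / 4 * K.metric m (X m) (X m) : ℂ) • s m := by
    rw [smul_smul, h3, smul_neg, smul_smul, neg_mul, neg_smul, neg_neg]
  rw [← h4]
  module

end SmoothDirac

/-! ### Derivatives of operator-valued functions -/

section OperatorCalculus

variable {E : Type*} [NormedAddCommGroup E] [NormedSpace ℝ E]
  {M : Type*} [TopologicalSpace M] [ChartedSpace E M]
  {F : Type*} [NormedAddCommGroup F] [NormedSpace ℝ F]
  {F₁ : Type*} [NormedAddCommGroup F₁] [NormedSpace ℝ F₁] {m : M} {v : TangentSpace 𝓘(ℝ, E) m}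

/-- Differentiability of an operator valued function is tested on vectors. -/
theorem hasDirDeriv_clm_of_apply [FiniteDimensional ℝ F] {T : M → F →L[ℝ] F₁} {T' : F →L[ℝ] F₁}
    (h : ∀ u, HasDirDeriv (fun x => T x u) m v (T' u)) : HasDirDeriv T m v T' := by
  let b := Module.finBasis ℝ F
  let φ : Fin (Module.finrank ℝ F) → F →L[ℝ] ℝ := fun i =>
    (ContinuousLinearMap.proj i).comp (b.equivFunL : F →L[ℝ] (Fin (Module.finrank ℝ F) → ℝ))
  have hexp : ∀ S : F →L[ℝ] F₁, S = ∑ i, ContinuousLinearMap.smulRightL ℝ F F₁ (φ i) (S (b i)) := by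
    intro S
    ext u
    conv_lhs => rw [← b.sum_equivFun u, map_sum]
    rw [sum_apply]
    refine Finset.sum_congr rfl fun i _ => ?_
    rw [map_smul]
    rfl
  have h1 := HasDirDeriv.sum Finset.univ fun i _ =>
    (h (b i)).clm (ContinuousLinearMap.smulRightL ℝ F F₁ (φ i))
  rw [← hexp] at h1
  exact h1.congr (Filter.Eventually.of_forall fun x => hexp (T x))

theorem HasDirDeriv.clm_apply {T : M → F →L[ℝ] F₁} {T' : F →L[ℝ] F₁} {y : M → F} {y' : F}
    (hT : HasDirDeriv T m v T') (hy : HasDirDeriv y m v y') :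
    HasDirDeriv (fun x => T x (y x)) m v (T' (y m) + T m y') :=
  hT.bilin (ContinuousLinearMap.id ℝ (F →L[ℝ] F₁)) hy

/-- The derivative of a form valued function is computed on vectors. -/
theorem mvfderiv_alternating_apply [FiniteDimensional ℝ F] {q : ℕ} {T : M → F [⋀^Fin q]→L[ℝ] ℂ}
    {d : (Fin q → F) → ℂ} (h : ∀ w, HasDirDeriv (fun x => T x w) m v (d w)) (w : Fin q → F) :
    mvfderiv 𝓘(ℝ, E) T m v w = d w := by
  obtain ⟨R, hR⟩ := exists_alternating_of_components (E := F) q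
  have h1 := (HasDirDeriv.pi fun a : Fin q → Fin (Module.finrank ℝ F) =>
    h fun i => Module.finBasis ℝ F (a i)).clm R
  simp only [hR] at h1
  have h2 := (hasDirDeriv h1.diff v).clm (ContinuousAlternatingMap.apply ℝ F ℂ w)
  exact h2.unique (h w)

end OperatorCalculus

/-! ### Connection matrices and fields with constant coordinates -/

section Christoffel

variable {E : Type*} [NormedAddCommGroup E] [NormedSpace ℝ E] [FiniteDimensional ℝ E]
  {M : Type*} [TopologicalSpace M] [ChartedSpace E M] [IsManifold 𝓘(ℝ, E) ∞ M]
  (K : AlmostKahler E M)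
  {nabla : CovariantDerivative 𝓘(ℝ, E) E (TangentSpace 𝓘(ℝ, E) : M → Type _)}

/-- Vector fields that are constant in a chart commute. -/
theorem mlieBracket_tangentVec (m : M) (u w : E) :
    VectorField.mlieBracket 𝓘(ℝ, E) (fun y => tangentVec m y u) (fun y => tangentVec m y w) m
      = 0 := by
  have hpull : ∀ u : E, VectorField.mpullbackWithin 𝓘(ℝ, E) 𝓘(ℝ, E) (extChartAt 𝓘(ℝ, E) m).symm
      (fun y => tangentVec m y u) (Set.range 𝓘(ℝ, E)) =ᶠ[𝓝 (extChartAt 𝓘(ℝ, E) m m)]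
      fun _ => u := by
    intro u
    filter_upwards [extChartAt_target_mem_nhds (I := 𝓘(ℝ, E)) m] with z hz
    have hx : (extChartAt 𝓘(ℝ, E) m).symm z ∈ (chartAt E m).source := by
      have := (extChartAt 𝓘(ℝ, E) m).map_target hz
      rwa [extChartAt_source] at this
    have h1 := TangentBundle.symmL_trivializationAt (I := 𝓘(ℝ, E)) hx
    rw [(extChartAt 𝓘(ℝ, E) m).right_inv hz] at h1
    rw [VectorField.mpullbackWithin_apply, tangentVec, h1]
    exact (isInvertible_mfderivWithin_extChartAt_symm hz).inverse_apply_eq.2 rfl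
  rw [← VectorField.mlieBracketWithin_univ, VectorField.mlieBracketWithin_apply]
  have h2 : VectorField.lieBracketWithin ℝ (VectorField.mpullbackWithin 𝓘(ℝ, E) 𝓘(ℝ, E)
      (extChartAt 𝓘(ℝ, E) m).symm (fun y => tangentVec m y u) (Set.range 𝓘(ℝ, E)))
      (VectorField.mpullbackWithin 𝓘(ℝ, E) 𝓘(ℝ, E)
      (extChartAt 𝓘(ℝ, E) m).symm (fun y => tangentVec m y w) (Set.range 𝓘(ℝ, E)))
      ((extChartAt 𝓘(ℝ, E) m).symm ⁻¹' Set.univ ∩ Set.range 𝓘(ℝ, E)) (extChartAt 𝓘(ℝ, E) m m)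
      = (0 : E) := by
    refine (Filter.EventuallyEq.lieBracketWithin_vectorField_eq
      (𝕜 := ℝ) (E := E) (V₁ := VectorField.mpullbackWithin 𝓘(ℝ, E) 𝓘(ℝ, E)
      (extChartAt 𝓘(ℝ, E) m).symm (fun y => tangentVec m y u) (Set.range 𝓘(ℝ, E)))
      (V := fun _ => u)
      (W₁ := VectorField.mpullbackWithin 𝓘(ℝ, E) 𝓘(ℝ, E)
      (extChartAt 𝓘(ℝ, E) m).symm (fun y => tangentVec m y w) (Set.range 𝓘(ℝ, E)))
      (W := fun _ => w) ((hpull u).filter_mono nhdsWithin_le_nhds) (hpull u).self_of_nhds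
      ((hpull w).filter_mono nhdsWithin_le_nhds) (hpull w).self_of_nhds).trans ?_
    simp [VectorField.lieBracketWithin]
  exact (congrArg _ h2).trans (map_zero _)

/-- The vector field with constant coordinates that extends a tangent vector. -/
def constField {m : M} (w : TangentSpace 𝓘(ℝ, E) m) : VField E M :=
  fun y => tangentVec m y (tangentCoord E m m w)

theorem constField_self {m : M} (w : TangentSpace 𝓘(ℝ, E) m) : constField w m = w :=
  tangentVec_tangentCoord (mem_chart_source E m) w

theorem smoothVFieldAt_constField {m : M} (w : TangentSpace 𝓘(ℝ, E) m) :
    SmoothVFieldAt (constField w) m := smoothVFieldAt_tangentVec (mem_chart_source E m) _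

theorem tangentCoord_constField {m : M} (w : TangentSpace 𝓘(ℝ, E) m) :
    (fun y => tangentCoord E m y (constField w y)) =ᶠ[𝓝 m] fun _ => tangentCoord E m m w :=
  (eventually_mem_chart_source (mem_chart_source E m)).mono fun _ hy => tangentCoord_tangentVec hy _

/-- On a field with constant coordinates, a connection acts by its connection matrix. -/
theorem covariantDerivative_constField
    (D : CovariantDerivative 𝓘(ℝ, E) E (TangentSpace 𝓘(ℝ, E) : M → Type _)) {m : M}
    (v w : TangentSpace 𝓘(ℝ, E) m) :
    (tangentBasis m).constr ℝ (fun i => D (coordField m i) m v) w = D (constField w) m v := by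
  have h := covariantDerivative_eq D (smoothVFieldAt_constField w).diff v
  rw [((hasDirDeriv_const _).congr (tangentCoord_constField w)).eq, map_zero, zero_add,
    constField_self] at h
  exact h.symm

theorem gammaJ_apply {m : M} (v w : TangentSpace 𝓘(ℝ, E) m) :
    gammaJ K nabla m v w = nablaJ K nabla (constField w) m v :=
  covariantDerivative_constField (nablaJConnection K nabla) v w

variable (hnabla : K.IsLeviCivita nabla)
include hnabla

/-- The Levi-Civita connection, in terms of `gammaJ` and the intrinsic torsion, with the direction
of differentiation as the argument of these endomorphisms. -/
theorem nabla_eq_gammaJ {Y : VField E M} {m : M} (hY : DiffVFieldAt Y m)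
    (v : TangentSpace 𝓘(ℝ, E) m) :
    nabla Y m v = tangentVec m m (mvfderiv 𝓘(ℝ, E) (fun y => tangentCoord E m y (Y y)) m v)
      + gammaJ K nabla m (Y m) v + intrinsicTorsion K nabla m (Y m) v := by
  have h1 := hnabla.torsion_free (constField v) (constField (Y m)) m
    (smoothVFieldAt_constField v).diff (smoothVFieldAt_constField (Y m)).diff
  have h3 : VectorField.mlieBracket 𝓘(ℝ, E) (constField v) (constField (Y m)) m = 0 :=
    mlieBracket_tangentVec m _ _
  rw [h3, constField_self, constField_self, sub_eq_zero] at h1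
  have h2 := nabla_sub_nablaJ K (nabla := nabla) (smoothVFieldAt_constField v).diff (Y m)
  rw [constField_self] at h2
  rw [covariantDerivative_eq nabla hY, covariantDerivative_constField, h1, ← h2, gammaJ_apply]
  abel

end Christoffel

/-! ### The group action in coordinates -/

section ActionCoordinates

variable {E : Type*} [NormedAddCommGroup E] [NormedSpace ℝ E] [FiniteDimensional ℝ E]
  {M : Type*} [TopologicalSpace M] [ChartedSpace E M] [IsManifold 𝓘(ℝ, E) ∞ M]
  {EG : Type*} [NormedAddCommGroup EG] [NormedSpace ℝ EG] [FiniteDimensional ℝ EG]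
  {G : Type*} [TopologicalSpace G] [ChartedSpace EG G] [Group G] [LieGroup 𝓘(ℝ, EG) ∞ G]
  [MulAction G M] [ContMDiffSMul 𝓘(ℝ, EG) 𝓘(ℝ, E) ∞ G M]

variable (EG E G) in
/-- The action in the charts of `G` at the identity and of `M` at `m`. -/
def chartAction (m : M) (z : EG × E) : E :=
  extChartAt 𝓘(ℝ, E) m ((extChartAt 𝓘(ℝ, EG) (1 : G)).symm z.1 • (extChartAt 𝓘(ℝ, E) m).symm z.2)

variable (EG E G) in
/-- The point with chart coordinates those of the identity and of `y`. -/
def chartPoint (m y : M) : EG × E :=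
  (extChartAt 𝓘(ℝ, EG) (1 : G) 1, extChartAt 𝓘(ℝ, E) m y)

theorem contDiffAt_chartAction (m : M) :
    ContDiffAt ℝ ∞ (chartAction E EG G m) (chartPoint E EG G m m) := by
  rw [← contMDiffAt_iff_contDiffAt]
  have h1 : ContMDiffAt 𝓘(ℝ, EG × E) 𝓘(ℝ, EG) ∞
      (fun z : EG × E => (extChartAt 𝓘(ℝ, EG) (1 : G)).symm z.1) (chartPoint E EG G m m) :=
    ContMDiffAt.comp (g := (extChartAt 𝓘(ℝ, EG) (1 : G)).symm) (chartPoint E EG G m m)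
      ((contMDiffOn_extChartAt_symm (1 : G)).contMDiffAt
        (extChartAt_target_mem_nhds (I := 𝓘(ℝ, EG)) (1 : G)))
      (contDiff_fst (𝕜 := ℝ) (E := EG) (F := E)).contMDiff.contMDiffAt
  have h2 : ContMDiffAt 𝓘(ℝ, EG × E) 𝓘(ℝ, E) ∞
      (fun z : EG × E => (extChartAt 𝓘(ℝ, E) m).symm z.2) (chartPoint E EG G m m) :=
    ContMDiffAt.comp (g := (extChartAt 𝓘(ℝ, E) m).symm) (chartPoint E EG G m m)
      ((contMDiffOn_extChartAt_symm m).contMDiffAt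
        (extChartAt_target_mem_nhds (I := 𝓘(ℝ, E)) m))
      (contDiff_snd (𝕜 := ℝ) (E := EG) (F := E)).contMDiff.contMDiffAt
  have h3 : ContMDiffAt 𝓘(ℝ, EG × E) 𝓘(ℝ, E) ∞ (fun z : EG × E =>
      (extChartAt 𝓘(ℝ, EG) (1 : G)).symm z.1 • (extChartAt 𝓘(ℝ, E) m).symm z.2)
      (chartPoint E EG G m m) := h1.smul h2
  refine ContMDiffAt.comp (g := extChartAt 𝓘(ℝ, E) m) (chartPoint E EG G m m) ?_ h3
  refine contMDiffAt_extChartAt' ?_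
  simp [chartPoint]

/-- Near the identity and near `m`, the map `chartAction` represents the action. -/
theorem eventually_chartAction (m : M) : ∀ᶠ z : G × M in 𝓝 ((1 : G), m),
    z.1 • z.2 ∈ (chartAt E m).source ∧
    chartAction E EG G m (extChartAt 𝓘(ℝ, EG) (1 : G) z.1, extChartAt 𝓘(ℝ, E) m z.2)
      = extChartAt 𝓘(ℝ, E) m (z.1 • z.2) ∧
    ContDiffAt ℝ 2 (chartAction E EG G m)
      (extChartAt 𝓘(ℝ, EG) (1 : G) z.1, extChartAt 𝓘(ℝ, E) m z.2) := by
  have hcont : Continuous fun z : G × M => z.1 • z.2 :=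
    (contMDiff_smul (I := 𝓘(ℝ, EG)) (I' := 𝓘(ℝ, E)) (n := ∞)).continuous
  have h1 : ∀ᶠ z : G × M in 𝓝 ((1 : G), m), z.1 • z.2 ∈ (chartAt E m).source :=
    hcont.continuousAt.eventually_mem ((chartAt E m).open_source.mem_nhds (by simp))
  have h2 : ∀ᶠ z : G × M in 𝓝 ((1 : G), m), z.1 ∈ (chartAt EG (1 : G)).source :=
    continuous_fst.continuousAt.eventually_mem
      ((chartAt EG (1 : G)).open_source.mem_nhds (mem_chart_source EG (1 : G)))
  have h3 : ∀ᶠ z : G × M in 𝓝 ((1 : G), m), z.2 ∈ (chartAt E m).source :=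
    continuous_snd.continuousAt.eventually_mem
      ((chartAt E m).open_source.mem_nhds (mem_chart_source E m))
  have h4 : ContinuousAt (fun z : G × M =>
      (extChartAt 𝓘(ℝ, EG) (1 : G) z.1, extChartAt 𝓘(ℝ, E) m z.2)) ((1 : G), m) :=
    ((continuousAt_extChartAt (1 : G)).comp (x := ((1 : G), m)) (f := Prod.fst)
      continuous_fst.continuousAt).prodMk
      ((continuousAt_extChartAt m).comp (x := ((1 : G), m)) (f := Prod.snd)
      continuous_snd.continuousAt)
  have h5 := h4.eventually (((contDiffAt_chartAction (EG := EG) (G := G) m).of_le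
    (m := 2) (by norm_cast)).eventually (by simp))
  filter_upwards [h1, h2, h3, h5] with z hz1 hz2 hz3 hz5
  refine ⟨hz1, ?_, hz5⟩
  rw [chartAction, (extChartAt 𝓘(ℝ, EG) (1 : G)).left_inv (by rwa [extChartAt_source]),
    (extChartAt 𝓘(ℝ, E) m).left_inv (by rwa [extChartAt_source])]

theorem mdifferentiableAt_orbit (m : M) (g : G) :
    MDifferentiableAt 𝓘(ℝ, EG) 𝓘(ℝ, E) (fun g : G => g • m) g :=
  ((contMDiff_id (I := 𝓘(ℝ, EG)) (M := G) (n := ∞)).smul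
    (contMDiff_const (c := m) (I := 𝓘(ℝ, EG)) (I' := 𝓘(ℝ, E)))).contMDiffAt.mdifferentiableAt
    (by simp)

variable (EG) in
include EG in
theorem mdifferentiableAt_act (g : G) (m : M) :
    MDifferentiableAt 𝓘(ℝ, E) 𝓘(ℝ, E) (fun x : M => g • x) m :=
  ((contMDiff_const (c := g) (I := 𝓘(ℝ, E)) (I' := 𝓘(ℝ, EG))).smul
    (contMDiff_id (I := 𝓘(ℝ, E)) (M := M) (n := ∞))).contMDiffAt.mdifferentiableAt (by simp)

/-- The derivative along an orbit. -/
theorem HasDirDeriv.orbit {F : Type*} [NormedAddCommGroup F] [NormedSpace ℝ F] {f : M → F} {f' : F}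
    {m : M} {ξ : EG} (hf : HasDirDeriv f m (fundVF E G ξ m) f') :
    HasDirDeriv (E := EG) (fun g : G => f (g • m)) 1 ξ f' := by
  have h1 : ∀ x, x = m → HasMFDerivAt 𝓘(ℝ, E) 𝓘(ℝ, F) f x (mfderiv 𝓘(ℝ, E) 𝓘(ℝ, F) f m :
      E →L[ℝ] F) := by
    rintro x rfl
    exact hf.diff.hasMFDerivAt
  have h2 := (h1 ((1 : G) • m) (one_smul G m)).comp (1 : G)
    (mdifferentiableAt_orbit (EG := EG) (E := E) m 1).hasMFDerivAt
  refine ⟨h2.mdifferentiableAt, ?_⟩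
  have h3 := h2.mfderiv
  rw [← hf.eq]
  exact congrArg (fun L : EG →L[ℝ] F => L ξ) h3

/-- The induced vector field in a chart. -/
theorem tangentCoord_fundVF (m : M) : ∀ᶠ y in 𝓝 m, ∀ ξ : EG,
    tangentCoord E m y (fundVF E G ξ y) = fderiv ℝ (chartAction E EG G m) (chartPoint E EG G m y)
      (tangentCoord EG (1 : G) (1 : G) ξ, 0) := by
  have h1 := (eventually_chartAction (E := E) (EG := EG) (G := G) m).curry_nhds
  have h1' := Filter.Eventually.curry_nhds (x := m) (y := (1 : G))
    (p := fun z : M × G => _) (continuous_swap.continuousAt.eventually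
      (eventually_chartAction (E := E) (EG := EG) (G := G) m))
  filter_upwards [h1', eventually_mem_chart_source (mem_chart_source E m)] with y hy hym ξ
  have h2 : HasDirDeriv (E := EG) (fun g : G => extChartAt 𝓘(ℝ, E) m (g • y)) 1 ξ
      (tangentCoord E m y (fundVF E G ξ y)) := (hasDirDeriv_chart hym _).orbit
  have h3 : HasDirDeriv (E := EG) (fun g : G => (extChartAt 𝓘(ℝ, EG) (1 : G) g,
      extChartAt 𝓘(ℝ, E) m y)) 1 ξ (tangentCoord EG (1 : G) (1 : G) ξ, 0) :=
    (hasDirDeriv_chart (mem_chart_source EG (1 : G)) ξ).prodMk (hasDirDeriv_const _)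
  have h4 := h3.comp (φ := chartAction E EG G m)
    (hy.self_of_nhds.2.2.differentiableAt (by norm_num)).hasFDerivAt
  exact h2.unique (h4.congr (hy.mono fun g hg => hg.2.1.symm))

variable (EG) in
include EG in
/-- The derivative of the action by a group element, in a chart. -/
theorem tangentCoord_dAct (m : M) : ∀ᶠ g in 𝓝 (1 : G), ∀ w : TangentSpace 𝓘(ℝ, E) m,
    tangentCoord E m (g • m) (dAct E g m w) = fderiv ℝ (chartAction E EG G m)
      (extChartAt 𝓘(ℝ, EG) (1 : G) g, extChartAt 𝓘(ℝ, E) m m) (0, tangentCoord E m m w) := by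
  have h1 := (eventually_chartAction (E := E) (EG := EG) (G := G) m).curry_nhds
  filter_upwards [h1] with g hg w
  have h2 : HasDirDeriv (fun y => extChartAt 𝓘(ℝ, E) m (g • y)) m w
      (tangentCoord E m (g • m) (dAct E g m w)) := by
    have h3 := hasDirDeriv_chart hg.self_of_nhds.1 (dAct E g m w)
    have h4 := h3.diff.hasMFDerivAt.comp m
      (mdifferentiableAt_act EG g m).hasMFDerivAt
    refine ⟨h4.mdifferentiableAt, ?_⟩
    rw [← h3.eq]
    exact congrArg (fun L : E →L[ℝ] E => L w) h4.mfderiv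
  have h3 : HasDirDeriv (fun y => (extChartAt 𝓘(ℝ, EG) (1 : G) g,
      extChartAt 𝓘(ℝ, E) m y)) m w (0, tangentCoord E m m w) :=
    (hasDirDeriv_const _).prodMk (hasDirDeriv_chart (mem_chart_source E m) w)
  have h4 := h3.comp (φ := chartAction E EG G m)
    (hg.self_of_nhds.2.2.differentiableAt (by norm_num)).hasFDerivAt
  exact h2.unique (h4.congr (hg.mono fun y hy => hy.2.1.symm))

variable (EG) in
include EG in
theorem eventually_smul_mem_chart_source (m : M) :
    ∀ᶠ g in 𝓝 (1 : G), g • m ∈ (chartAt E m).source :=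
  (eventually_chartAction (E := E) (EG := EG) (G := G) m).curry_nhds.mono
    fun _ hg => hg.self_of_nhds.1

variable (EG) in
include EG in
/-- The derivative of the action by the identity; the point `1 • m` equals `m` only propositionally.
-/
theorem tangentCoord_dAct_one (m : M) (w : TangentSpace 𝓘(ℝ, E) m) :
    tangentCoord E m ((1 : G) • m) (dAct E (1 : G) m w) = tangentCoord E m m w := by
  have h : (1 : G) • m ∈ (chartAt E m).source := by simp
  have h3 := hasDirDeriv_chart h (dAct E (1 : G) m w)
  have h4 := h3.diff.hasMFDerivAt.comp m
    (mdifferentiableAt_act EG (1 : G) m).hasMFDerivAt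
  have h2 : HasDirDeriv (fun y => extChartAt 𝓘(ℝ, E) m ((1 : G) • y)) m w
      (tangentCoord E m ((1 : G) • m) (dAct E (1 : G) m w)) := by
    refine ⟨h4.mdifferentiableAt, ?_⟩
    rw [← h3.eq]
    exact congrArg (fun L : E →L[ℝ] E => L w) h4.mfderiv
  simp only [one_smul] at h2
  exact h2.unique (hasDirDeriv_chart (mem_chart_source E m) w)

/-- Induced vector fields are smooth, also with a smoothly varying element of the Lie algebra. -/
theorem smoothVFieldAt_fundVF {m : M} {f : M → EG} (hf : ContMDiffAt 𝓘(ℝ, E) 𝓘(ℝ, EG) ∞ f m) :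
    SmoothVFieldAt (fun y => fundVF E G (f y) y) m := by
  have hm := mem_chart_source E m
  rw [smoothVFieldAt_iff hm]
  have h1 : ContDiffAt ℝ ∞ (fderiv ℝ (chartAction E EG G m)) (chartPoint E EG G m m) :=
    (contDiffAt_chartAction m).fderiv_right (by norm_num)
  have h2 : ContMDiffAt 𝓘(ℝ, E) 𝓘(ℝ, EG × E) ∞ (fun y => chartPoint E EG G m y) m :=
    contMDiffAt_const.prodMk_space contMDiffAt_extChartAt
  have h3 : ContMDiffAt 𝓘(ℝ, E) 𝓘(ℝ, (EG × E) →L[ℝ] E) ∞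
      (fun y => fderiv ℝ (chartAction E EG G m) (chartPoint E EG G m y)) m :=
    h1.contMDiffAt.comp m h2
  let T : EG →L[ℝ] EG := tangentCoord EG (1 : G) (1 : G)
  have h4 : ContMDiffAt 𝓘(ℝ, E) 𝓘(ℝ, EG × E) ∞
      (fun y => (T (f y), (0 : E))) m :=
    (contMDiffAt_contDiff_comp T.contDiff hf).prodMk_space contMDiffAt_const
  refine (h3.clm_apply h4).congr_of_eventuallyEq ?_
  exact (tangentCoord_fundVF m).mono fun y hy => hy (f y)

/-- The derivative of the vector field induced by `ξ`, in the coordinates at `m`. -/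
def coordDeriv (G : Type*) [TopologicalSpace G] [ChartedSpace EG G] [Group G]
    [LieGroup 𝓘(ℝ, EG) ∞ G] [MulAction G M] (ξ : EG) (m : M) :
    TangentSpace 𝓘(ℝ, E) m →ₗ[ℝ] TangentSpace 𝓘(ℝ, E) m :=
  (tangentVec m m).toLinearMap ∘ₗ
    (mvfderiv 𝓘(ℝ, E) (fun y => tangentCoord E m y (fundVF E G ξ y)) m).toLinearMap

theorem coordDeriv_apply (ξ : EG) (m : M) (w : TangentSpace 𝓘(ℝ, E) m) :
    coordDeriv G ξ m w = tangentVec m m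
      (mvfderiv 𝓘(ℝ, E) (fun y => tangentCoord E m y (fundVF E G ξ y)) m w) := rfl

/-- The derivative of the action by `G` on tangent vectors is the derivative of the induced vector
field, by the symmetry of second derivatives. -/
theorem hasDirDeriv_dAct (ξ : EG) (m : M) (w : TangentSpace 𝓘(ℝ, E) m) :
    HasDirDeriv (E := EG) (fun g : G => tangentCoord E m (g • m) (dAct E g m w)) 1 ξ
      (tangentCoord E m m (coordDeriv G ξ m w)) := by
  have hm := mem_chart_source E m
  set ψ := chartAction E EG G m
  have hψ := contDiffAt_chartAction (E := E) (EG := EG) (G := G) m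
  have h1 : HasFDerivAt (fderiv ℝ ψ) (fderiv ℝ (fderiv ℝ ψ) (chartPoint E EG G m m))
      (chartPoint E EG G m m) :=
    ((hψ.fderiv_right (m := 1) (by norm_cast)).differentiableAt (by norm_num)).hasFDerivAt
  -- the mixed second derivative of the action, taken in either order
  have hsymm : IsSymmSndFDerivAt ℝ ψ (chartPoint E EG G m m) :=
    hψ.isSymmSndFDerivAt (by rw [minSmoothness_of_isRCLikeNormedField]; norm_cast)
  have h2 : HasDirDeriv (E := EG) (fun g : G => (extChartAt 𝓘(ℝ, EG) (1 : G) g,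
      extChartAt 𝓘(ℝ, E) m m)) 1 ξ (tangentCoord EG (1 : G) (1 : G) ξ, 0) :=
    (hasDirDeriv_chart (mem_chart_source EG (1 : G)) ξ).prodMk (hasDirDeriv_const _)
  have h3 : HasDirDeriv (fun y => chartPoint E EG G m y) m w (0, tangentCoord E m m w) :=
    (hasDirDeriv_const _).prodMk (hasDirDeriv_chart hm w)
  have h4 := (h2.comp h1).clm_apply (hasDirDeriv_const ((0 : EG), tangentCoord E m m w))
  have h5 := (h3.comp h1).clm_apply (hasDirDeriv_const (tangentCoord EG (1 : G) (1 : G) ξ, (0 : E)))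
  have h6 := h5.congr ((tangentCoord_fundVF (E := E) (EG := EG) (G := G) m).mono fun y hy => hy ξ)
  have h7 := h4.congr ((tangentCoord_dAct (E := E) EG (G := G) m).mono fun g hg => hg w)
  refine ⟨h7.diff, h7.eq.trans ?_⟩
  rw [coordDeriv_apply, tangentCoord_tangentVec hm, h6.eq]
  simp only [map_zero, add_zero]
  exact hsymm _ _

end ActionCoordinates

/-! ### Infinitesimal invariance of the structures -/

section InvariantStructures

variable {E : Type*} [NormedAddCommGroup E] [NormedSpace ℝ E] [FiniteDimensional ℝ E]
  {M : Type*} [TopologicalSpace M] [ChartedSpace E M] [IsManifold 𝓘(ℝ, E) ∞ M]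
  {EG : Type*} [NormedAddCommGroup EG] [NormedSpace ℝ EG] [FiniteDimensional ℝ EG]
  {G : Type*} [TopologicalSpace G] [ChartedSpace EG G] [Group G] [LieGroup 𝓘(ℝ, EG) ∞ G]
  [MulAction G M] [ContMDiffSMul 𝓘(ℝ, EG) 𝓘(ℝ, E) ∞ G M]
  (K : AlmostKahler E M)
  {nabla : CovariantDerivative 𝓘(ℝ, E) E (TangentSpace 𝓘(ℝ, E) : M → Type _)}

/-- The endomorphism by which `nablaJ`, along the vector field `ξ^M` induced by `ξ`, differs from
the commutator with `ξ^M`. In coordinates it is the derivative of `ξ^M` plus the connection matrix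
in the direction `ξ^M`. -/
def momentEnd (nabla : CovariantDerivative 𝓘(ℝ, E) E (TangentSpace 𝓘(ℝ, E) : M → Type _))
    (G : Type*) [TopologicalSpace G] [ChartedSpace EG G] [Group G]
    [LieGroup 𝓘(ℝ, EG) ∞ G] [MulAction G M] (ξ : EG) (m : M) :
    TangentSpace 𝓘(ℝ, E) m →ₗ[ℝ] TangentSpace 𝓘(ℝ, E) m :=
  coordDeriv G ξ m + gammaJ K nabla m (fundVF E G ξ m)

/-- The decomposition of `∇ ξ^M` into a part that commutes with `J` and one that anticommutes with
it. -/
theorem nabla_fundVF (hnabla : K.IsLeviCivita nabla) (ξ : EG) (m : M) :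
    (nabla (fundVF E G ξ) m).toLinearMap = momentEnd K nabla G ξ m
      + intrinsicTorsion K nabla m (fundVF E G ξ m) := by
  ext v
  exact nabla_eq_gammaJ K hnabla (smoothVFieldAt_fundVF (f := fun _ => ξ) contMDiffAt_const).diff v

/-- The almost complex structure in coordinates, as an operator valued function. -/
def coordJ (m y : M) : E →L[ℝ] E := (tangentCoord E m y).comp ((K.J y).comp (tangentVec m y))

/-- The derivative of `J` in coordinates, which expresses that `J` is parallel for `nablaJ`. -/
theorem hasDirDeriv_coordJ (m : M) (v : TangentSpace 𝓘(ℝ, E) m) : ∃ B' : E →L[ℝ] E,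
    HasDirDeriv (coordJ K m) m v B' ∧ ∀ w : TangentSpace 𝓘(ℝ, E) m, B' (tangentCoord E m m w)
      = tangentCoord E m m (K.J m (gammaJ K nabla m v w) - gammaJ K nabla m v (K.J m w)) := by
  have hm := mem_chart_source E m
  let B' : E →L[ℝ] E := LinearMap.toContinuousLinearMap
    ((tangentCoord E m m).toLinearMap ∘ₗ (K.Jlin m ∘ₗ gammaJ K nabla m v
      - gammaJ K nabla m v ∘ₗ K.Jlin m) ∘ₗ (tangentVec m m).toLinearMap)
  have hB : ∀ u : E, B' u = tangentCoord E m m (K.J m (gammaJ K nabla m v (tangentVec m m u))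
      - gammaJ K nabla m v (K.J m (tangentVec m m u))) := fun u => rfl
  refine ⟨B', hasDirDeriv_clm_of_apply fun u => ?_, fun w => ?_⟩
  · obtain ⟨w, rfl⟩ : ∃ w : TangentSpace 𝓘(ℝ, E) m, tangentCoord E m m w = u :=
      ⟨tangentVec m m u, tangentCoord_tangentVec hm u⟩
    have h1 : DiffVFieldAt (fun y => K.J y (constField w y)) m :=
      (smoothVFieldAt_constField w).diff.map_J K
    have h2 := hasDirDeriv_tangentCoord hm h1 v
    refine ⟨h2.diff, h2.eq.trans ?_⟩
    have h3 := covariantDerivative_eq (nablaJConnection K nabla) h1 v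
    rw [covariantDerivative_constField, nablaJConnection_apply, nablaJConnection_apply,
      nablaJ_map_J K (smoothVFieldAt_constField w).diff, ← gammaJ_apply, ← gammaJ_apply,
      constField_self] at h3
    have h4 := congrArg (tangentCoord E m m) h3
    rw [map_add, tangentCoord_tangentVec hm] at h4
    rw [eq_sub_of_add_eq h4.symm, ← map_sub, hB, tangentVec_tangentCoord hm]
  · rw [hB, tangentVec_tangentCoord hm]

/-- The metric in coordinates, as an operator valued function. -/
def coordMetric (m y : M) : E →L[ℝ] E →L[ℝ] ℝ :=
  LinearMap.toContinuousLinearMap (LinearMap.toContinuousLinearMap.toLinearMap ∘ₗ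
    ((K.metric y).compl₁₂ (tangentVec m y).toLinearMap (tangentVec m y).toLinearMap))

theorem coordMetric_apply (m y : M) (u w : E) :
    coordMetric K m y u w = K.metric y (tangentVec m y u) (tangentVec m y w) := rfl

/-- The derivative of the metric in coordinates, which expresses that the metric is parallel for
`nablaJ`. -/
theorem hasDirDeriv_coordMetric (hnabla : K.IsLeviCivita nabla) (m : M)
    (v : TangentSpace 𝓘(ℝ, E) m) : ∃ B' : E →L[ℝ] E →L[ℝ] ℝ,
    HasDirDeriv (coordMetric K m) m v B' ∧ ∀ u w : TangentSpace 𝓘(ℝ, E) m,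
      B' (tangentCoord E m m u) (tangentCoord E m m w)
        = K.metric m (gammaJ K nabla m v u) w + K.metric m u (gammaJ K nabla m v w) := by
  have hm := mem_chart_source E m
  let γ : TangentSpace 𝓘(ℝ, E) m →ₗ[ℝ] TangentSpace 𝓘(ℝ, E) m := gammaJ K nabla m v
  let T : E →ₗ[ℝ] TangentSpace 𝓘(ℝ, E) m := (tangentVec m m).toLinearMap
  let B' : E →L[ℝ] E →L[ℝ] ℝ :=
    LinearMap.toContinuousLinearMap (LinearMap.toContinuousLinearMap.toLinearMap ∘ₗ
      ((K.metric m).compl₁₂ (γ ∘ₗ T) T + (K.metric m).compl₁₂ T (γ ∘ₗ T)))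
  have hB : ∀ u w, B' u w = K.metric m (γ (tangentVec m m u)) (tangentVec m m w)
      + K.metric m (tangentVec m m u) (γ (tangentVec m m w)) := fun u w => rfl
  refine ⟨B', ?_, fun u w => ?_⟩
  · refine hasDirDeriv_clm_of_apply fun u => hasDirDeriv_clm_of_apply fun w => ?_
    have h1 : ∀ u : E, SmoothVFieldAt (fun y => tangentVec m y u) m :=
      smoothVFieldAt_tangentVec hm
    have h2 := hasDirDeriv_metric_nablaJ K hnabla (h1 u).diff (h1 w).diff v
    refine ⟨h2.diff, h2.eq.trans ?_⟩
    have h3 : ∀ u : E, nablaJ K nabla (fun y => tangentVec m y u) m v = γ (tangentVec m m u) :=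
      fun u => by
        simp only [γ, gammaJ_apply]
        unfold constField
        rw [tangentCoord_tangentVec hm]
    rw [hB, h3, h3]
  · rw [hB, tangentVec_tangentCoord hm, tangentVec_tangentCoord hm]

variable {L : M → Type*} [TopologicalSpace (TotalSpace ℂ L)]
  [∀ m, NormedAddCommGroup (L m)] [∀ m, InnerProductSpace ℂ (L m)]
  [FiberBundle ℂ L] [VectorBundle ℂ ℂ L] [VectorBundle ℝ ℂ L]
  {nablaL : CovariantDerivative 𝓘(ℝ, E) ℂ L} {actL : ∀ (g : G) (m : M), L m ≃ₗ[ℂ] L (g • m)}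

/-- The endomorphism `momentEnd` is complex linear, since the action preserves `J`. -/
theorem momentEnd_J (hact : IsPrequantumAction EG K nablaL actL) (ξ : EG) (m : M)
    (w : TangentSpace 𝓘(ℝ, E) m) :
    momentEnd K nabla G ξ m (K.J m w) = K.J m (momentEnd K nabla G ξ m w) := by
  have hm := mem_chart_source E m
  obtain ⟨B', hB', hB⟩ := hasDirDeriv_coordJ K (nabla := nabla) m (fundVF E G ξ m)
  have h1 := hB'.orbit.clm_apply
    (hasDirDeriv_dAct ξ m w)
  have h2 := hasDirDeriv_dAct (E := E) (G := G) ξ m (K.J m w)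
  -- invariance of `J` under `g`, differentiated at `g = 1`
  have h3 : (fun g : G => tangentCoord E m (g • m) (dAct E g m (K.J m w))) =ᶠ[𝓝 1]
      fun g => coordJ K m (g • m) (tangentCoord E m (g • m) (dAct E g m w)) :=
    (eventually_smul_mem_chart_source (E := E) (G := G) EG m).mono fun g hg => by
      simp only [coordJ, ContinuousLinearMap.comp_apply, tangentVec_tangentCoord hg,
        hact.invariant_J]
  have h4 := h2.unique (h1.congr h3)
  have h5 : ∀ x, x = m → coordJ K m x = coordJ K m m := by rintro x rfl; rfl
  rw [tangentCoord_dAct_one EG, h5 _ (one_smul G m), hB] at h4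
  simp only [coordJ, ContinuousLinearMap.comp_apply, tangentVec_tangentCoord hm] at h4
  rw [← map_add] at h4
  have h6 := congrArg (tangentVec m m) h4
  rw [tangentVec_tangentCoord hm, tangentVec_tangentCoord hm] at h6
  simp only [momentEnd, LinearMap.add_apply, h6, map_add]
  abel

/-- The endomorphism `momentEnd` is skew-symmetric, since the action preserves the metric. -/
theorem momentEnd_skew (hnabla : K.IsLeviCivita nabla)
    (hact : IsPrequantumAction EG K nablaL actL) (ξ : EG) (m : M)
    (w u : TangentSpace 𝓘(ℝ, E) m) :
    K.metric m (momentEnd K nabla G ξ m w) u = -K.metric m w (momentEnd K nabla G ξ m u) := by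
  have hm := mem_chart_source E m
  obtain ⟨B', hB', hB⟩ := hasDirDeriv_coordMetric K hnabla m (fundVF E G ξ m)
  have h1 := (hB'.orbit.clm_apply (hasDirDeriv_dAct ξ m w)).clm_apply (hasDirDeriv_dAct ξ m u)
  -- invariance of the metric under `g`, differentiated at `g = 1`
  have h3 : (fun _ : G => K.metric m w u) =ᶠ[𝓝 1] fun g => coordMetric K m (g • m)
      (tangentCoord E m (g • m) (dAct E g m w)) (tangentCoord E m (g • m) (dAct E g m u)) :=
    (eventually_smul_mem_chart_source (E := E) (G := G) EG m).mono fun g hg => by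
      simp only [coordMetric_apply, tangentVec_tangentCoord hg, K.metric_apply,
        hact.invariant_J, hact.invariant_form]
  have h4 := (hasDirDeriv_const (E := EG) (M := G) (v := ξ) (m := (1 : G)) (K.metric m w u)).unique
    (h1.congr h3)
  have h5 : ∀ x, x = m → coordMetric K m x = coordMetric K m m := by rintro x rfl; rfl
  rw [tangentCoord_dAct_one EG, tangentCoord_dAct_one EG, h5 _ (one_smul G m)] at h4
  simp only [add_apply, hB, coordMetric_apply, tangentVec_tangentCoord hm] at h4
  simp only [momentEnd, LinearMap.add_apply, map_add]
  linarith

end InvariantStructures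

/-! ### The Lie derivative of forms -/

section LieDerivative

variable {E : Type*} [NormedAddCommGroup E] [NormedSpace ℝ E] [FiniteDimensional ℝ E]
  {M : Type*} [TopologicalSpace M] [ChartedSpace E M] [IsManifold 𝓘(ℝ, E) ∞ M] [T2Space M]
  {EG : Type*} [NormedAddCommGroup EG] [NormedSpace ℝ EG] [FiniteDimensional ℝ EG]
  {G : Type*} [TopologicalSpace G] [ChartedSpace EG G] [Group G] [LieGroup 𝓘(ℝ, EG) ∞ G]
  [MulAction G M] [ContMDiffSMul 𝓘(ℝ, EG) 𝓘(ℝ, E) ∞ G M]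
  {K : AlmostKahler E M}
  {nabla : CovariantDerivative 𝓘(ℝ, E) E (TangentSpace 𝓘(ℝ, E) : M → Type _)}
  {L : M → Type*} [TopologicalSpace (TotalSpace ℂ L)]
  [∀ m, NormedAddCommGroup (L m)] [∀ m, InnerProductSpace ℂ (L m)]
  [FiberBundle ℂ L] [VectorBundle ℂ ℂ L] [VectorBundle ℝ ℂ L]
  [ContMDiffVectorBundle ∞ ℂ L 𝓘(ℝ, E)]
  {nablaL : CovariantDerivative 𝓘(ℝ, E) ℂ L} {actL : ∀ (g : G) (m : M), L m ≃ₗ[ℂ] L (g • m)}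
  {μ : M → (EG →L[ℝ] ℝ)}

/-- The coordinate of the action on `L` near the identity, in the trivialization at `m`. -/
def lineCocycle (actL : ∀ (g : G) (m : M), L m ≃ₗ[ℂ] L (g • m)) (m : M) (g : G) : ℂ :=
  lineCoord L m m ((actL g m).symm (localFrame L m (g • m)))

/-- The inverse of the action of `g` on a fibre is the action of `g⁻¹`, as an identity in the total
space since the two fibres are equal only propositionally. -/
theorem actL_symm_eq (hact : IsPrequantumAction EG K nablaL actL) (g : G) (m : M) (l : L (g • m)) :
    TotalSpace.mk' ℂ (g⁻¹ • g • m) (actL g⁻¹ (g • m) l)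
      = TotalSpace.mk' ℂ m ((actL g m).symm l) := by
  obtain ⟨l', rfl⟩ := (actL g m).surjective l
  rw [← hact.map_mul, LinearEquiv.symm_apply_apply]
  have h : ∀ k : G, k = 1 → TotalSpace.mk' ℂ (k • m) (actL k m l') = TotalSpace.mk' ℂ m l' := by
    rintro k rfl
    exact hact.map_one m l'
  exact h _ (inv_mul_cancel g)

theorem contMDiffAt_lineCocycle (hact : IsPrequantumAction EG K nablaL actL) (m : M) :
    ContMDiffAt 𝓘(ℝ, EG) 𝓘(ℝ, ℂ) ∞ (lineCocycle actL m) 1 := by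
  have hm := mem_baseSet_self L m
  have h1 : ContMDiffAt 𝓘(ℝ, EG) 𝓘(ℝ, E) ∞ (fun g : G => g • m) 1 :=
    ((contMDiff_id (I := 𝓘(ℝ, EG)) (M := G) (n := ∞)).smul
      (contMDiff_const (c := m) (I := 𝓘(ℝ, EG)) (I' := 𝓘(ℝ, E)))).contMDiffAt
  have h2 : ContMDiffAt 𝓘(ℝ, EG) (𝓘(ℝ, E).prod 𝓘(ℝ, ℂ)) ∞
      (fun g : G => TotalSpace.mk' ℂ (g • m) (localFrame L m (g • m))) 1 :=
    ContMDiffAt.comp (g := fun y => TotalSpace.mk' ℂ y (localFrame L m y)) (1 : G)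
      (contMDiffAt_localFrame (by rwa [one_smul])) h1
  have h3 : ContMDiffAt 𝓘(ℝ, EG) (𝓘(ℝ, EG).prod (𝓘(ℝ, E).prod 𝓘(ℝ, ℂ))) ∞
      (fun g : G => (g⁻¹, TotalSpace.mk' ℂ (g • m) (localFrame L m (g • m)))) 1 :=
    ContMDiffAt.prodMk (contMDiff_inv 𝓘(ℝ, EG) ∞).contMDiffAt h2
  have h4 := hact.smooth.contMDiffAt.comp (1 : G) h3
  have h5 : ContMDiffAt 𝓘(ℝ, EG) (𝓘(ℝ, E).prod 𝓘(ℝ, ℂ)) ∞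
      (fun g : G => TotalSpace.mk' ℂ m ((actL g m).symm (localFrame L m (g • m)))) 1 := by
    refine h4.congr_of_eventuallyEq (Filter.Eventually.of_forall fun g => ?_)
    exact (actL_symm_eq hact g m _).symm
  refine (contMDiffAt_totalSpace.1 h5).2.congr_of_eventuallyEq ?_
  exact Filter.Eventually.of_forall fun g => lineCoord_eq hm _

theorem lineCocycle_one (hact : IsPrequantumAction EG K nablaL actL) (m : M) :
    lineCocycle actL m 1 = 1 := by
  have hm := mem_baseSet_self L m
  have hm' : (1 : G) • m ∈ (trivializationAt ℂ L m).baseSet := by rwa [one_smul]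
  have h := hact.map_one m ((actL 1 m).symm (localFrame L m ((1 : G) • m)))
  rw [LinearEquiv.apply_symm_apply] at h
  rw [lineCocycle, lineCoord_eq hm, ← lineCoord_localFrame hm', lineCoord_eq hm']
  exact congrArg (fun z => (trivializationAt ℂ L m z).2) h.symm

/-- Kostant's formula for the cocycle of the action on `L`. -/
theorem hasDirDeriv_lineCocycle (hact : IsPrequantumAction EG K nablaL actL)
    (hμ : IsMomentumMap K nablaL actL μ) (ξ : EG) (m : M) :
    HasDirDeriv (E := EG) (lineCocycle actL m) 1 ξ
      (thetaL nablaL m (fundVF E G ξ m) - 2 * Real.pi * Complex.I * μ m ξ) := by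
  have hm := mem_baseSet_self L m
  have hdiff := hasDirDeriv (E := EG)
    ((contMDiffAt_lineCocycle hact m).mdifferentiableAt (by simp)) ξ
  refine ⟨hdiff.diff, ?_⟩
  obtain ⟨t, ht, hts⟩ := exists_smoothSection_localFrame (E := E) hm
  have hcont : ContinuousAt (fun g : G => g • m) 1 :=
    (mdifferentiableAt_orbit (EG := EG) (E := E) m 1).continuousAt
  have hev : ∀ᶠ g in 𝓝 (1 : G), t (g • m) = localFrame L m (g • m) :=
    hcont.eventually (by simpa only [one_smul] using hts)
  have h1 := hμ.kostant ξ t m ht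
  have h2 : HasDirDeriv (E := EG) (fun g : G => lineCocycle actL m g • localFrame L m m) 1 ξ
      (mvfderiv 𝓘(ℝ, EG) (lineCocycle actL m) 1 ξ • localFrame L m m) :=
    hdiff.clm (((1 : ℂ →L[ℂ] ℂ).smulRight (localFrame L m m)).restrictScalars ℝ)
  have h3 := h2.congr (hev.mono fun g hg => show (actL g m).symm (t (g • m)) = _ by
    rw [hg]; exact (lineCoord_smul_localFrame hm _).symm)
  have h4 : lieDerivL actL ξ t m = mvfderiv 𝓘(ℝ, EG) (lineCocycle actL m) 1 ξ • localFrame L m m :=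
    h3.eq
  have h5 := congrArg (lineCoord L m m) (h4.symm.trans h1)
  rw [hts.self_of_nhds, nablaL.isCovariantDerivativeOnUniv.congr_of_eventuallyEq
    (ht.contMDiffAt.mdifferentiableAt (by simp))
    ((contMDiffAt_localFrame hm).mdifferentiableAt (by simp)) Filter.univ_mem hts] at h5
  simp only [map_smul, map_sub, lineCoord_localFrame hm, smul_eq_mul, mul_one] at h5
  exact h5

theorem powCoord_pullbackForm {p : ℕ} {s : ∀ m : M, FormFibre E L p m} {g : G} {m : M}
    (hg : g • m ∈ (trivializationAt ℂ L m).baseSet) {q : ℕ}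
    (w : Fin q → TangentSpace 𝓘(ℝ, E) m) :
    powCoord L p m m (pullbackForm actL p s g m q w)
      = lineCocycle actL m g ^ p
        * powCoord L p m (g • m) (s (g • m) q (fun i => dAct E g m (w i))) := by
  have h1 : pullbackForm actL p s g m q w = PiTensorProduct.map (R := ℂ)
      (fun _ : Fin p => (actL g m).symm.toLinearMap)
      (s (g • m) q (fun i => dAct E g m (w i))) := rfl
  rw [h1]
  conv_lhs => rw [← tprod_localFrame_smul hg (s (g • m) q (fun i => dAct E g m (w i)))]
  rw [map_smul, PiTensorProduct.map_tprod, map_smul, powCoord_tprod, smul_eq_mul, mul_comm]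
  congr 1
  simp [lineCocycle]

/-- The Lie derivative differs from the connection by the action of `momentEnd` on forms and the
scalar of Kostant's formula. -/
theorem lieDerivForm_eq_nablaForms (hact : IsPrequantumAction EG K nablaL actL)
    (hμ : IsMomentumMap K nablaL actL μ) {p : ℕ} {s : ∀ m : M, FormFibre E L p m} {m : M}
    (hs : DiffFormAt p s m) (ξ : EG) :
    lieDerivForm actL p ξ s m = nablaForms K nabla nablaL p s m (fundVF E G ξ m)
      + derivationAct (momentEnd K nabla G ξ m) (s m)
      - (2 * Real.pi * Complex.I * p * μ m ξ) • s m := by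
  have hm := mem_chart_source E m
  have hmL := mem_baseSet_self L m
  have hcont : ContinuousAt (fun g : G => g • m) 1 :=
    (mdifferentiableAt_orbit (EG := EG) (E := E) m 1).continuousAt
  have hevL : ∀ᶠ g in 𝓝 (1 : G), g • m ∈ (trivializationAt ℂ L m).baseSet :=
    hcont.eventually (by simpa only [one_smul] using eventually_mem_baseSet hmL)
  have hev := eventually_smul_mem_chart_source (E := E) (G := G) EG m
  refine formFibre_ext hmL fun q w => ?_
  have hone : ∀ x, x = m → toModel p m x q (s x q) = toModel p m m q (s m q) := by
    rintro x rfl; rfl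
  -- the derivative of the pullback by `g`: a product of the cocycle, the coefficients along the
  -- orbit, and the derivative of the action on the arguments
  have key : ∀ u : Fin q → E, HasDirDeriv (E := EG)
      (fun g : G => toModel p m m q (pullbackForm actL p s g m q) u) 1 ξ
      (mvfderiv 𝓘(ℝ, E) (fun x => toModel p m x q (s x q)) m (fundVF E G ξ m) u
        + ∑ i, toModel p m m q (s m q) (Function.update u i
            (tangentCoord E m m (coordDeriv G ξ m (tangentVec m m (u i)))))
        + p * (thetaL nablaL m (fundVF E G ξ m) - 2 * Real.pi * Complex.I * μ m ξ)
          * toModel p m m q (s m q) u) := by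
    intro u
    have h1 := (hasDirDeriv_lineCocycle hact hμ ξ m).pow p
    have h2 := HasDirDeriv.alternating_apply ((hasDirDeriv (hs q) (fundVF E G ξ m)).orbit)
      (fun i => hasDirDeriv_dAct (E := E) (G := G) ξ m (tangentVec m m (u i)))
    have h3 := (h1.mul h2).congr ((hevL.and hev).mono fun g hg => show
        toModel p m m q (pullbackForm actL p s g m q) u = _ by
      rw [toModel_apply, powCoord_pullbackForm hg.1, powCoord_eq_toModel hg.2])
    refine ⟨h3.diff, h3.eq.trans ?_⟩
    simp only [tangentCoord_dAct_one EG, tangentCoord_tangentVec hm, lineCocycle_one hact, one_pow,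
      hone _ (one_smul G m)]
    ring
  rw [lieDerivForm, powCoord_fromModel, mvfderiv_alternating_apply key]
  rw [Forms.sub_apply, Forms.add_apply, Forms.smul_apply, map_sub, map_add, powCoord_nablaForms,
    derivationAct_apply, map_sum, map_smul, smul_eq_mul]
  have h6 : ∀ i, powCoord L p m m (s m q (Function.update w i (momentEnd K nabla G ξ m (w i))))
      = toModel p m m q (s m q) (Function.update (fun i => tangentCoord E m m (w i)) i
          (tangentCoord E m m (coordDeriv G ξ m (w i))))
        + powCoord L p m m (s m q (Function.update w i
            (gammaJ K nabla m (fundVF E G ξ m) (w i)))) := by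
    intro i
    have h7 : (Function.update (fun i => tangentCoord E m m (w i)) i
          (tangentCoord E m m (coordDeriv G ξ m (w i))))
        = fun k => tangentCoord E m m (Function.update w i (coordDeriv G ξ m (w i)) k) := by
      funext k
      by_cases hk : k = i
      · subst hk; simp
      · simp [hk]
    rw [h7, ← powCoord_eq_toModel hm, momentEnd, LinearMap.add_apply,
      AlternatingMap.map_update_add, map_add]
  simp only [tangentVec_tangentCoord hm, h6, Finset.sum_add_distrib,
    powCoord_eq_toModel hm (s m q) w]
  ring

end LieDerivative

/-! ### Lie derivative and Clifford connection along a fundamental vector field -/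

section SpinorLieDerivative

variable {E : Type*} [NormedAddCommGroup E] [NormedSpace ℝ E] [FiniteDimensional ℝ E]
  {M : Type*} [TopologicalSpace M] [ChartedSpace E M] [IsManifold 𝓘(ℝ, E) ∞ M] [T2Space M]
  {EG : Type*} [NormedAddCommGroup EG] [NormedSpace ℝ EG] [FiniteDimensional ℝ EG]
  {G : Type*} [TopologicalSpace G] [ChartedSpace EG G] [Group G] [LieGroup 𝓘(ℝ, EG) ∞ G]
  [MulAction G M] [ContMDiffSMul 𝓘(ℝ, EG) 𝓘(ℝ, E) ∞ G M]
  (K : AlmostKahler E M)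
  {nabla : CovariantDerivative 𝓘(ℝ, E) E (TangentSpace 𝓘(ℝ, E) : M → Type _)}
  {L : M → Type*} [TopologicalSpace (TotalSpace ℂ L)]
  [∀ m, NormedAddCommGroup (L m)] [∀ m, InnerProductSpace ℂ (L m)]
  [FiberBundle ℂ L] [VectorBundle ℂ ℂ L] [VectorBundle ℝ ℂ L]
  [ContMDiffVectorBundle ∞ ℂ L 𝓘(ℝ, E)]
  {nablaL : CovariantDerivative 𝓘(ℝ, E) ℂ L} {actL : ∀ (g : G) (m : M), L m ≃ₗ[ℂ] L (g • m)}
  {μ : M → (EG →L[ℝ] ℝ)}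

/-- The Kostant formula for the spin-c connection: `∇_{ξ^M} - L_ξ` acts through the spin
representation of `∇ ξ^M`, its trace over `T^{1,0}M`, and the momentum map. -/
theorem nablaSpinor_fundVF (hnabla : K.IsLeviCivita nabla)
    (hact : IsPrequantumAction EG K nablaL actL) (hμ : IsMomentumMap K nablaL actL μ) {p : ℕ}
    {s : ∀ m : M, FormFibre E L p m} {m : M} (hs : DiffFormAt p s m)
    (hsm : s m ∈ SpinorFibre K L p m) (ξ : EG) :
    nablaSpinor K nabla nablaL p s m (fundVF E G ξ m) = lieDerivForm actL p ξ s m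
      + (1 / 4 : ℂ) • clTrace K L p m (nabla (fundVF E G ξ) m).toLinearMap (s m)
      + ((1 / 2 : ℂ) * trace10 (K.Jlin m) (nabla (fundVF E G ξ) m).toLinearMap) • s m
      + (2 * Real.pi * Complex.I * p * μ m ξ) • s m := by
  have h1 := (isDualFrame_tangentBasis K m).derivationAct_eq_cliffordTrace (K.hermitianPair m)
    (momentEnd_skew K hnabla hact ξ m) (momentEnd_J K (nabla := nabla) hact ξ m) hsm
  have h2 : trace10 (K.Jlin m) (intrinsicTorsion K nabla m (fundVF E G ξ m)) = 0 :=
    trace10_eq_zero_of_anticomm (K.J_sq m) (intrinsicTorsion_J K m _)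
  rw [nablaSpinor_eq, lieDerivForm_eq_nablaForms hact hμ hs, nabla_fundVF K hnabla, trace10_add, h2,
    h1, clTrace, clTrace, cliffordTrace_add, LinearMap.add_apply]
  module

end SpinorLieDerivative

/-! ### The quasi-Kähler identity -/

section QuasiKahler

variable {E : Type*} [NormedAddCommGroup E] [NormedSpace ℝ E] [FiniteDimensional ℝ E]
  {M : Type*} [TopologicalSpace M] [ChartedSpace E M] [IsManifold 𝓘(ℝ, E) ∞ M]
  (K : AlmostKahler E M)
  {nabla : CovariantDerivative 𝓘(ℝ, E) E (TangentSpace 𝓘(ℝ, E) : M → Type _)}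

/-- The derivative of `J` in terms of the intrinsic torsion. -/
theorem nabla_map_J {Y : VField E M} {m : M} (hY : DiffVFieldAt Y m)
    (v : TangentSpace 𝓘(ℝ, E) m) :
    nabla (fun x => K.J x (Y x)) m v
      = K.J m (nabla Y m v) - (2 : ℝ) • K.J m (intrinsicTorsion K nabla m v (Y m)) := by
  have h1 := nabla_sub_nablaJ K (nabla := nabla) hY v
  have h2 := nabla_sub_nablaJ K (nabla := nabla) (hY.map_J K) v
  rw [nablaJ_map_J K hY, intrinsicTorsion_J] at h2
  rw [eq_add_of_sub_eq h2, eq_add_of_sub_eq h1, map_add]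
  module

variable (hnabla : K.IsLeviCivita nabla)
include hnabla

/-- The cyclic sum of the covariant derivative of the symplectic form vanishes, since the form is
closed and the connection is torsion-free. -/
theorem cyclic_sum_nabla_form (m : M) (u v w : TangentSpace 𝓘(ℝ, E) m) :
    K.metric m (K.J m (intrinsicTorsion K nabla m u v)) w
      + K.metric m (K.J m (intrinsicTorsion K nabla m v w)) u
      + K.metric m (K.J m (intrinsicTorsion K nabla m w u)) v = 0 := by
  have hd : ∀ a : TangentSpace 𝓘(ℝ, E) m, DiffVFieldAt (constField a) m := fun a =>
    (smoothVFieldAt_constField a).diff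
  have hb : ∀ a b : TangentSpace 𝓘(ℝ, E) m,
      VectorField.mlieBracket 𝓘(ℝ, E) (constField a) (constField b) m = 0 := fun a b =>
    mlieBracket_tangentVec m _ _
  have ht : ∀ a b : TangentSpace 𝓘(ℝ, E) m,
      nabla (constField b) m a = nabla (constField a) m b := fun a b => by
    have := hnabla.torsion_free (constField a) (constField b) m (hd a) (hd b)
    rw [hb, constField_self, constField_self] at this
    exact sub_eq_zero.1 this
  have hder : ∀ a b c : TangentSpace 𝓘(ℝ, E) m,
      mvfderiv 𝓘(ℝ, E) (fun x => K.form x (constField b x) (constField c x)) m a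
        = K.metric m (K.J m (nabla (constField b) m a)) c
          - 2 * K.metric m (K.J m (intrinsicTorsion K nabla m a b)) c
          + K.metric m (K.J m b) (nabla (constField c) m a) := fun a b c => by
    have h1 := (hasDirDeriv_metric_nabla K hnabla ((hd b).map_J K) (hd c) a).eq
    simp only [K.form_eq_metric]
    rw [h1, nabla_map_J K (hd b), constField_self, constField_self]
    simp only [map_sub, map_smul, LinearMap.sub_apply, LinearMap.smul_apply, smul_eq_mul]
  have h := K.closed (constField u) (constField v) (constField w) m (hd u) (hd v) (hd w)
  simp only [hb, map_zero, zero_apply, constField_self, hder, ht u v, ht v w, ht w u] at h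
  have hsk : ∀ a b : TangentSpace 𝓘(ℝ, E) m,
      K.metric m (K.J m a) b = -K.metric m (K.J m b) a := fun a b => by
    rw [← K.form_eq_metric, ← K.form_eq_metric, K.form_skew]
  have h1 := hsk (nabla (constField u) m v) w
  have h2 := hsk (nabla (constField v) m w) u
  have h3 := hsk (nabla (constField w) m u) v
  linarith

/-- An almost Kähler manifold is quasi-Kähler: the intrinsic torsion is antilinear in the direction
of differentiation. -/
theorem intrinsicTorsion_J_left (m : M) (u v : TangentSpace 𝓘(ℝ, E) m) :
    intrinsicTorsion K nabla m (K.J m u) v = -K.J m (intrinsicTorsion K nabla m u v) := by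
  have H := K.hermitianPair m
  have hc := cyclic_sum_nabla_form K hnabla m
  have key : ∀ a b c : TangentSpace 𝓘(ℝ, E) m,
      K.metric m (K.J m (intrinsicTorsion K nabla m a (K.J m b))) c
        = K.metric m (K.J m (intrinsicTorsion K nabla m a b)) (K.J m c) := fun a b c => by
    rw [intrinsicTorsion_J, map_neg, map_neg, LinearMap.neg_apply]
    have := H.skew (K.J m (intrinsicTorsion K nabla m a b)) c
    simp only [K.Jlin_apply] at this
    linarith
  have key' : ∀ a b c : TangentSpace 𝓘(ℝ, E) m,
      K.metric m (K.J m (intrinsicTorsion K nabla m a (K.J m b))) (K.J m c)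
        = -K.metric m (K.J m (intrinsicTorsion K nabla m a b)) c := fun a b c => by
    rw [key, K.J_sq, map_neg]
  have hw : ∀ w, K.metric m (intrinsicTorsion K nabla m (K.J m u) v
      + K.J m (intrinsicTorsion K nabla m u v)) w = 0 := fun w => by
    have e : K.metric m (intrinsicTorsion K nabla m (K.J m u) v) w
        = K.metric m (K.J m (intrinsicTorsion K nabla m (K.J m u) (K.J m v))) w := by
      rw [intrinsicTorsion_J, map_neg, K.J_sq, neg_neg]
    -- the cyclic identity with `J` inserted in each pair of arguments; a signed sum of the four
    -- relations isolates the terms with `u` as direction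
    have c0 := hc u v w
    have c1 := hc (K.J m u) (K.J m v) w
    have c2 := hc (K.J m u) v (K.J m w)
    have c3 := hc u (K.J m v) (K.J m w)
    rw [map_add, LinearMap.add_apply, e]
    rw [key'] at c1 c2 c3
    rw [key (K.J m v) w u] at c3
    rw [key (K.J m u) v w] at c1 ⊢
    rw [key (K.J m w) u v] at c2
    linarith
  have h0 := K.metric_nondegenerate m _ (LinearMap.ext hw)
  exact eq_neg_of_add_eq_zero_left h0

/-- The trace over `T^{1,0}M` of the projected derivative of a vector field. The derivative of
`X^{1,0} = (X - i J X) / 2` involves `∇J`, whose contribution is traceless by the quasi-Kähler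
identity. -/
theorem trace_nabla10 {X : VField E M} {m : M} (hX : DiffVFieldAt X m) :
    LinearMap.trace ℂ _ (nabla10 K nabla X m)
      = trace10 (K.Jlin m) (nabla X m).toLinearMap := by
  -- the endomorphism `v ↦ (∇_v J) X`
  let N : TangentSpace 𝓘(ℝ, E) m →ₗ[ℝ] TangentSpace 𝓘(ℝ, E) m :=
    (nabla (fun x => K.J x (X x)) m).toLinearMap - K.Jlin m ∘ₗ (nabla X m).toLinearMap
  have hN : ∀ v, N v = -((2 : ℝ) • K.J m (intrinsicTorsion K nabla m v (X m))) := fun v => by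
    change nabla (fun x => K.J x (X x)) m v - K.J m (nabla X m v) = _
    rw [nabla_map_J K hX]
    abel
  have hJ : ∀ v, K.Jlin m (K.Jlin m v) = -v := K.J_sq m
  have h1 : trace10 (K.Jlin m) N = 0 := by
    refine trace10_eq_zero_of_anticomm hJ fun v => ?_
    rw [hN, hN, K.Jlin_apply, K.Jlin_apply, intrinsicTorsion_J_left K hnabla]
    simp only [map_neg, map_smul, smul_neg]
  have h2 : (nabla (fun x => K.J x (X x)) m).toLinearMap
      = N + K.Jlin m ∘ₗ (nabla X m).toLinearMap := (sub_add_cancel _ _).symm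
  rw [nabla10, trace_proj10_comp hJ, h2, trace10_add, h1, trace10_J_comp hJ]
  linear_combination (-(1 / 2 : ℂ) * trace10 (K.Jlin m) (nabla X m).toLinearMap) * Complex.I_mul_I

end QuasiKahler

/-! ### Invariant forms and point-dependent generators -/

section InvariantForms

variable {E : Type*} [NormedAddCommGroup E] [NormedSpace ℝ E] [FiniteDimensional ℝ E]
  {M : Type*} [TopologicalSpace M] [ChartedSpace E M] [IsManifold 𝓘(ℝ, E) ∞ M]
  {EG : Type*} [NormedAddCommGroup EG] [NormedSpace ℝ EG] [FiniteDimensional ℝ EG]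
  {G : Type*} [TopologicalSpace G] [ChartedSpace EG G] [Group G] [LieGroup 𝓘(ℝ, EG) ∞ G]
  [MulAction G M] [ContMDiffSMul 𝓘(ℝ, EG) 𝓘(ℝ, E) ∞ G M]
  {L : M → Type*} [TopologicalSpace (TotalSpace ℂ L)]
  [∀ m, NormedAddCommGroup (L m)] [∀ m, InnerProductSpace ℂ (L m)]
  [FiberBundle ℂ L] [VectorBundle ℂ ℂ L] [VectorBundle ℝ ℂ L]
  {actL : ∀ (g : G) (m : M), L m ≃ₗ[ℂ] L (g • m)}

/-- Pullbacks of an invariant form do not depend on the group element. -/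
theorem IsInvariantForm.lieDerivForm_eq_zero {p : ℕ} {s : ∀ m : M, FormFibre E L p m}
    (hs : IsInvariantForm actL p s) (ξ : EG) (m : M) : lieDerivForm actL p ξ s m = 0 := by
  refine formFibre_ext (mem_baseSet_self L m) fun q w => ?_
  rw [lieDerivForm, powCoord_fromModel]
  simp only [hs _ m, mvfderiv_const]
  exact (map_zero (powCoord L p m m)).symm

/-- Induced vector fields depend linearly on the element of the Lie algebra. -/
def fundVFL (E : Type*) [NormedAddCommGroup E] [NormedSpace ℝ E] {M : Type*} [TopologicalSpace M]
    [ChartedSpace E M] (G : Type*) [TopologicalSpace G] [ChartedSpace EG G] [Group G]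
    [MulAction G M] (m : M) : EG →L[ℝ] E :=
  mfderiv 𝓘(ℝ, EG) 𝓘(ℝ, E) (fun g : G => g • m) 1

theorem fundVF_smul (a : ℝ) (ξ : EG) (m : M) :
    fundVF E G (a • ξ) m = a • fundVF E G ξ m := map_smul (fundVFL E G m) a ξ

theorem fundVF_sum {α : Type*} (a : Finset α) (ξ : α → EG) (m : M) :
    fundVF E G (∑ i ∈ a, ξ i) m = ∑ i ∈ a, fundVF E G (ξ i) m := map_sum (fundVFL E G m) ξ a

/-- The covariant derivative of the vector field `y ↦ f(y)^M_y` is that of the field induced by the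
fixed element `f(m)` plus the contribution of the variation of `f`. -/
theorem covariantDerivative_fundVF
    (D : CovariantDerivative 𝓘(ℝ, E) E (TangentSpace 𝓘(ℝ, E) : M → Type _)) {f : M → EG} {m : M}
    (hf : ContMDiffAt 𝓘(ℝ, E) 𝓘(ℝ, EG) ∞ f m) (v : TangentSpace 𝓘(ℝ, E) m) :
    D (fun y => fundVF E G (f y) y) m v
      = D (fundVF E G (f m)) m v + fundVF E G (mvfderiv 𝓘(ℝ, E) f m v) m := by
  let b := Module.finBasis ℝ EG
  let φ : Fin (Module.finrank ℝ EG) → EG →L[ℝ] ℝ := fun i =>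
    (ContinuousLinearMap.proj i).comp (b.equivFunL : EG →L[ℝ] (Fin (Module.finrank ℝ EG) → ℝ))
  have hexp : ∀ ξ : EG, ξ = ∑ i, φ i ξ • b i := fun ξ => (b.sum_equivFun ξ).symm
  have hfun : ∀ (ξ : EG) (y : M), fundVF E G ξ y = ∑ i, φ i ξ • fundVF E G (b i) y := fun ξ y => by
    conv_lhs => rw [hexp ξ]
    rw [fundVF_sum]
    simp only [fundVF_smul]
  have hd : ∀ i, DiffVFieldAt (fundVF E G (b i)) m := fun i =>
    (smoothVFieldAt_fundVF (f := fun _ => b i) contMDiffAt_const).diff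
  have hφ : ∀ i, HasDirDeriv (fun y => φ i (f y)) m v (φ i (mvfderiv 𝓘(ℝ, E) f m v)) := fun i =>
    (hasDirDeriv (hf.mdifferentiableAt (by simp)) v).clm (φ i)
  have h1 := (covariantDerivative_sum D Finset.univ
    fun i _ => (hd i).smul (hφ i).diff).2
  have h2 := (covariantDerivative_sum D Finset.univ
    (Y := fun i y => φ i (f m) • fundVF E G (b i) y)
    fun i _ => (hd i).smul mdifferentiableAt_const).2
  have e1 : (fun y => fundVF E G (f y) y) = fun y => ∑ i, φ i (f y) • fundVF E G (b i) y :=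
    funext fun y => hfun (f y) y
  have e2 : fundVF E G (f m) = fun y => ∑ i, φ i (f m) • fundVF E G (b i) y :=
    funext fun y => hfun (f m) y
  rw [e1, e2, h1, h2, hfun (mvfderiv 𝓘(ℝ, E) f m v)]
  simp only [sum_apply]
  rw [← Finset.sum_add_distrib]
  refine Finset.sum_congr rfl fun i _ => ?_
  rw [covariantDerivative_smul D (hφ i).diff (hd i), covariantDerivative_const_smul D _ (hd i),
    (hφ i).eq]
  rfl

end InvariantForms

/-! ### Orthonormal frames of the dual Lie algebra bundle -/

section DualMaps

variable {E : Type*} [NormedAddCommGroup E] [NormedSpace ℝ E] [FiniteDimensional ℝ E]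
  {M : Type*} [TopologicalSpace M] [ChartedSpace E M] [IsManifold 𝓘(ℝ, E) ∞ M]
  {EG : Type*} [NormedAddCommGroup EG] [NormedSpace ℝ EG] [FiniteDimensional ℝ EG]
  {κ : M → LinearMap.BilinForm ℝ (EG →L[ℝ] ℝ)} {μ : M → (EG →L[ℝ] ℝ)}
  {ι : Type*} [Fintype ι] [DecidableEq ι] {h : ι → M → (EG →L[ℝ] ℝ)} {c : ι → M → ℝ}

/-- A linear functional on the dual of `EG` is the evaluation at an element of `EG`. -/
theorem exists_eval_eq (φ : (EG →L[ℝ] ℝ) →ₗ[ℝ] ℝ) : ∃ X : EG, ∀ ξ : EG →L[ℝ] ℝ, ξ X = φ ξ := by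
  let T : Module.Dual ℝ EG →ₗ[ℝ] (EG →L[ℝ] ℝ) := LinearMap.toContinuousLinearMap.toLinearMap
  refine ⟨(Module.evalEquiv ℝ EG).symm (φ ∘ₗ T), fun ξ => ?_⟩
  have h := Module.apply_evalEquiv_symm_apply ℝ EG ξ.toLinearMap (φ ∘ₗ T)
  exact h

theorem dualMap_spec (f : M → (EG →L[ℝ] ℝ)) (m : M) (ξ : EG →L[ℝ] ℝ) :
    ξ (dualMap κ f m) = κ m (f m) ξ := by
  obtain ⟨X, hX⟩ := exists_eval_eq (κ m (f m))
  have : (fun ξ : EG →L[ℝ] ℝ => ξ (dualMap κ f m)) = fun ξ => κ m (f m) ξ :=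
    Function.invFun_eq (f := fun (X : EG) (ξ : EG →L[ℝ] ℝ) => ξ X) ⟨X, funext hX⟩
  exact congrFun this ξ

theorem contMDiffAt_dualMap (hκ : ∀ ξ η, ContMDiff 𝓘(ℝ, E) 𝓘(ℝ, ℝ) ∞ (fun m => κ m ξ η))
    {f : M → (EG →L[ℝ] ℝ)} (hf : ContMDiff 𝓘(ℝ, E) 𝓘(ℝ, EG →L[ℝ] ℝ) ∞ f) (m : M) :
    ContMDiffAt 𝓘(ℝ, E) 𝓘(ℝ, EG) ∞ (dualMap κ f) m := by
  let b := Module.finBasis ℝ EG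
  let φ : Fin (Module.finrank ℝ EG) → EG →L[ℝ] ℝ := fun i =>
    (ContinuousLinearMap.proj i).comp (b.equivFunL : EG →L[ℝ] (Fin (Module.finrank ℝ EG) → ℝ))
  have hexp : ∀ ξ : EG, ξ = ∑ i, φ i ξ • b i := fun ξ => (b.sum_equivFun ξ).symm
  have hexp' : ∀ ξ : EG →L[ℝ] ℝ, ξ = ∑ i, ξ (b i) • φ i := fun ξ => by
    ext X
    conv_lhs => rw [hexp X]
    simp [mul_comm]
  have h1 : ∀ x, dualMap κ f x = ∑ i, (∑ j, f x (b j) * κ x (φ j) (φ i)) • b i := fun x => by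
    rw [hexp (dualMap κ f x)]
    refine Finset.sum_congr rfl fun i _ => ?_
    rw [dualMap_spec]
    conv_lhs => rw [hexp' (f x)]
    simp
  have h2 : ∀ j, ContMDiffAt 𝓘(ℝ, E) 𝓘(ℝ, ℝ) ∞ (fun x => f x (b j)) m := fun j =>
    contMDiffAt_contDiff_comp (ContinuousLinearMap.apply ℝ ℝ (b j)).contDiff hf.contMDiffAt
  have h3 : ∀ i j, ContMDiffAt 𝓘(ℝ, E) 𝓘(ℝ, ℝ) ∞ (fun x => f x (b j) * κ x (φ j) (φ i)) m :=
    fun i j => contMDiffAt_mul (h2 j) (hκ _ _).contMDiffAt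
  have h4 : ∀ i, ContMDiffAt 𝓘(ℝ, E) 𝓘(ℝ, ℝ) ∞ (fun x => ∑ j, f x (b j) * κ x (φ j) (φ i)) m :=
    fun i => ContMDiffAt.sum (t := Finset.univ) fun j _ => h3 i j
  have h5 : ∀ i, ContMDiffAt 𝓘(ℝ, E) 𝓘(ℝ, EG) ∞
      (fun x => (∑ j, f x (b j) * κ x (φ j) (φ i)) • b i) m := fun i =>
    contMDiffAt_contDiff_comp (contDiff_id.smul contDiff_const) (h4 i)
  have h6 : ContMDiffAt 𝓘(ℝ, E) 𝓘(ℝ, EG) ∞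
      (fun x => ∑ i, (∑ j, f x (b j) * κ x (φ j) (φ i)) • b i) m :=
    ContMDiffAt.sum (t := Finset.univ) fun i _ => h5 i
  exact h6.congr_of_eventuallyEq (Filter.Eventually.of_forall h1)

theorem IsOrthonormalFrame.coeff_eq (hh : IsOrthonormalFrame E κ h)
    (hc : ∀ m, μ m = ∑ j, c j m • h j m) (j : ι) (m : M) : c j m = κ m (h j m) (μ m) := by
  rw [hc, map_sum]
  simp [hh.orthonormal]

theorem metric_apply_eq_sum_dualMap (hc : ∀ m, μ m = ∑ j, c j m • h j m) (m : M) (ξ : EG →L[ℝ] ℝ) :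
    κ m (μ m) ξ = ∑ j, c j m * ξ (dualMap κ (h j) m) := by
  simp only [dualMap_spec]
  conv_lhs => rw [hc m]
  simp

theorem IsOrthonormalFrame.apply_dualMap (hh : IsOrthonormalFrame E κ h)
    (hc : ∀ m, μ m = ∑ j, c j m • h j m) (j : ι) (m : M) : μ m (dualMap κ (h j) m) = c j m := by
  rw [dualMap_spec, hh.coeff_eq hc]

theorem IsOrthonormalFrame.normSqMu_eq (hh : IsOrthonormalFrame E κ h)
    (hc : ∀ m, μ m = ∑ j, c j m • h j m) (m : M) : normSqMu κ μ m = ∑ j, c j m * c j m := by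
  rw [normSqMu, metric_apply_eq_sum_dualMap hc]
  simp only [hh.apply_dualMap hc]

theorem HasDirDeriv.bilinForm {M : Type*} [TopologicalSpace M] [ChartedSpace E M]
    {F : Type*} [NormedAddCommGroup F] [NormedSpace ℝ F] [FiniteDimensional ℝ F]
    {f : M → F} {f' : F} {m : M} {v : TangentSpace 𝓘(ℝ, E) m} (B : LinearMap.BilinForm ℝ F)
    (hf : HasDirDeriv f m v f') :
    HasDirDeriv (fun x => B (f x) (f x)) m v (B f' (f m) + B (f m) f') :=
  hf.bilin (LinearMap.toContinuousLinearMap (LinearMap.toContinuousLinearMap.toLinearMap ∘ₗ B)) hf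

end DualMaps

/-! ### The Hamiltonian vector field of the squared momentum map -/

section Hamiltonian

variable {E : Type*} [NormedAddCommGroup E] [NormedSpace ℝ E] [FiniteDimensional ℝ E]
  {M : Type*} [TopologicalSpace M] [ChartedSpace E M] [IsManifold 𝓘(ℝ, E) ∞ M]
  {EG : Type*} [NormedAddCommGroup EG] [NormedSpace ℝ EG] [FiniteDimensional ℝ EG]
  {G : Type*} [TopologicalSpace G] [ChartedSpace EG G] [Group G] [LieGroup 𝓘(ℝ, EG) ∞ G]
  [MulAction G M] [ContMDiffSMul 𝓘(ℝ, EG) 𝓘(ℝ, E) ∞ G M]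
  {K : AlmostKahler E M}
  {nabla : CovariantDerivative 𝓘(ℝ, E) E (TangentSpace 𝓘(ℝ, E) : M → Type _)}
  {L : M → Type*} [TopologicalSpace (TotalSpace ℂ L)]
  [∀ m, NormedAddCommGroup (L m)] [∀ m, InnerProductSpace ℂ (L m)]
  [FiberBundle ℂ L] [VectorBundle ℂ ℂ L] [VectorBundle ℝ ℂ L]
  {nablaL : CovariantDerivative 𝓘(ℝ, E) ℂ L} {actL : ∀ (g : G) (m : M), L m ≃ₗ[ℂ] L (g • m)}
  {κ : M → LinearMap.BilinForm ℝ (EG →L[ℝ] ℝ)} {μ : M → (EG →L[ℝ] ℝ)}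
  {ι : Type*} [Fintype ι] [DecidableEq ι] {h : ι → M → (EG →L[ℝ] ℝ)} {c : ι → M → ℝ}

theorem IsMomentumMap.mvfderiv_apply (hμ : IsMomentumMap K nablaL actL μ) (m : M)
    (v : TangentSpace 𝓘(ℝ, E) m) (ξ : EG) :
    mvfderiv 𝓘(ℝ, E) μ m v ξ = K.form m (fundVF E G ξ m) v := by
  have h1 := (hasDirDeriv (hμ.smooth.contMDiffAt.mdifferentiableAt (by simp)) v).clm
    (ContinuousLinearMap.apply ℝ ℝ ξ)
  rw [← hμ.deriv_eq ξ m v]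
  exact h1.eq.symm

variable (hκ : IsInvariantMetric E G κ) (hh : IsOrthonormalFrame E κ h)
  (hc : ∀ m, μ m = ∑ j, c j m • h j m) (hμ : IsMomentumMap K nablaL actL μ)

include hκ hh in
theorem contMDiffAt_dualMap_frame (j : ι) (m : M) :
    ContMDiffAt 𝓘(ℝ, E) 𝓘(ℝ, EG) ∞ (dualMap κ (h j)) m :=
  contMDiffAt_dualMap hκ.smooth (hh.smooth j) m

include hκ hh in
theorem smoothVFieldAt_inducedVF (j : ι) (m : M) :
    SmoothVFieldAt (inducedVF E G κ (h j)) m :=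
  smoothVFieldAt_fundVF (contMDiffAt_dualMap_frame hκ hh j m)

include hκ hh hc hμ in
theorem contMDiffAt_coeff (j : ι) (m : M) : ContMDiffAt 𝓘(ℝ, E) 𝓘(ℝ, ℝ) ∞ (c j) m := by
  refine (hμ.smooth.contMDiffAt.clm_apply
    (contMDiffAt_dualMap_frame hκ hh j m)).congr_of_eventuallyEq ?_
  exact Filter.Eventually.of_forall fun x => (hh.apply_dualMap hc j x).symm

include hκ hh hc hμ in
/-- The derivative of the coefficient `μ_j = ⟨μ, h_j^*⟩`. -/
theorem mvfderiv_coeff (j : ι) (m : M) (v : TangentSpace 𝓘(ℝ, E) m) :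
    mvfderiv 𝓘(ℝ, E) (c j) m v = K.metric m (K.J m (inducedVF E G κ (h j) m)) v
      + K.metric m (vecOf (K.metric m) (pairDeriv μ (dualMap κ (h j)) m)) v := by
  have h1 := (hasDirDeriv (hμ.smooth.contMDiffAt.mdifferentiableAt (by simp)) v).clm_apply
    (hasDirDeriv ((contMDiffAt_dualMap_frame hκ hh j m).mdifferentiableAt (by simp)) v)
  have h2 : (fun x => μ x (dualMap κ (h j) x)) = c j := funext fun x => hh.apply_dualMap hc j x
  rw [h2] at h1
  rw [h1.eq, hμ.mvfderiv_apply, K.form_eq_metric, vecOf_spec (K.metric_nondegenerate m)]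
  rfl

include hκ hh hc hμ in
/-- The vector field `X_1^H` equals `2 ∑_j μ_j V_j`: as the metric is frozen in `d_1 H`, only the
derivative of `μ` contributes. -/
theorem X1_eq (m : M) : X1 K κ μ m = (2 : ℝ) • ∑ j, c j m • inducedVF E G κ (h j) m := by
  refine vecOf_eq (K.form_nondegenerate m) (LinearMap.ext fun v => ?_)
  have h1 := (hasDirDeriv (hμ.smooth.contMDiffAt.mdifferentiableAt (by simp)) v).bilinForm (κ m)
  have h2 : d1 κ μ m v = 2 * κ m (μ m) (mvfderiv 𝓘(ℝ, E) μ m v) := by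
    refine h1.eq.trans ?_
    rw [hκ.symm m _ (μ m)]
    ring
  rw [h2, metric_apply_eq_sum_dualMap hc]
  simp only [hμ.mvfderiv_apply, map_smul, map_sum, LinearMap.smul_apply, LinearMap.sum_apply,
    smul_eq_mul, K.formLin_apply]
  rfl

include hκ hh hc hμ in
theorem smoothVFieldAt_X1 (m : M) : SmoothVFieldAt (X1 K κ μ) m := by
  have h1 : SmoothVFieldAt (fun x => (2 : ℝ) • ∑ j, c j x • inducedVF E G κ (h j) x) m :=
    SmoothVFieldAt.smul (f := fun _ => (2 : ℝ)) contMDiffAt_const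
      (SmoothVFieldAt.sum fun j _ => SmoothVFieldAt.smul (contMDiffAt_coeff hκ hh hc hμ j m)
        (smoothVFieldAt_inducedVF hκ hh j m))
  exact h1.congr (Filter.Eventually.of_forall fun x => X1_eq hκ hh hc hμ x)

/-- The endomorphism `v ↦ -(T f(v))^M` of the tangent space, for `f : M → 𝔤`. -/
def variationEnd (E : Type*) [NormedAddCommGroup E] [NormedSpace ℝ E] {M : Type*}
    [TopologicalSpace M] [ChartedSpace E M] (G : Type*) [TopologicalSpace G] [ChartedSpace EG G]
    [Group G] [MulAction G M] (f : M → EG) (m : M) :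
    TangentSpace 𝓘(ℝ, E) m →ₗ[ℝ] TangentSpace 𝓘(ℝ, E) m :=
  -((fundVFL E G m).toLinearMap ∘ₗ (mvfderiv 𝓘(ℝ, E) f m).toLinearMap)

theorem variationEnd_apply (f : M → EG) (m : M) (v : TangentSpace 𝓘(ℝ, E) m) :
    variationEnd E G f m v = -fundVF E G (mvfderiv 𝓘(ℝ, E) f m v) m := rfl

/-- The commutator with `f(m)^M - V`, for `V = f(·)^M`, is tensorial since this field vanishes
at `m`. -/
theorem bracketDiff_eq (hnabla : K.IsLeviCivita nabla) {f : M → EG} {m : M}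
    (hf : ContMDiffAt 𝓘(ℝ, E) 𝓘(ℝ, EG) ∞ f m) {Y : VField E M} (hY : DiffVFieldAt Y m) :
    bracketDiff E G f Y m = variationEnd E G f m (Y m) := by
  have h1 : DiffVFieldAt (fundVF E G (f m)) m :=
    (smoothVFieldAt_fundVF (f := fun _ => f m) contMDiffAt_const).diff
  have h2 : DiffVFieldAt (fun x => fundVF E G (f x) x) m := (smoothVFieldAt_fundVF hf).diff
  have h3 := hnabla.torsion_free Y (fun x => fundVF E G (f m) x - fundVF E G (f x) x) m hY
    (h1.sub h2)
  rw [sub_self, map_zero, sub_zero, covariantDerivative_sub nabla h1 h2] at h3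
  rw [bracketDiff, ← h3, variationEnd_apply]
  change nabla (fundVF E G (f m)) m (Y m) - nabla (fun x => fundVF E G (f x) x) m (Y m) = _
  rw [covariantDerivative_fundVF nabla hf]
  abel

theorem smoothVFieldAt_variationEnd {f : M → EG} {m : M}
    (hf : ContMDiffAt 𝓘(ℝ, E) 𝓘(ℝ, EG) ∞ f m) {Y : VField E M} (hY : SmoothVFieldAt Y m) :
    SmoothVFieldAt (fun x => variationEnd E G f x (Y x)) m := by
  have h1 := SmoothVFieldAt.smul (f := fun _ => (-1 : ℝ)) contMDiffAt_const
    (smoothVFieldAt_fundVF (G := G) (contMDiffAt_mvfderiv hf hY))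
  exact h1.congr (Filter.Eventually.of_forall fun x => by
    rw [variationEnd_apply, neg_one_smul])

include hκ hh hc hμ in
/-- The covariant derivative of `X_1^H`. -/
theorem nabla_X1 (m : M) : (nabla (X1 K κ μ) m).toLinearMap
    = (2 : ℝ) • ∑ j,
      ((K.metric m (K.J m (inducedVF E G κ (h j) m))).smulRight (inducedVF E G κ (h j) m)
      + (K.metric m (vecOf (K.metric m) (pairDeriv μ (dualMap κ (h j)) m))).smulRight
          (inducedVF E G κ (h j) m)
      + c j m • ((nabla (fundVF E G (dualMap κ (h j) m)) m).toLinearMap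
          - variationEnd E G (dualMap κ (h j)) m)) := by
  have hcd : ∀ j, MDifferentiableAt 𝓘(ℝ, E) 𝓘(ℝ, ℝ) (c j) m := fun j =>
    (contMDiffAt_coeff hκ hh hc hμ j m).mdifferentiableAt (by simp)
  have hVd : ∀ j, DiffVFieldAt (inducedVF E G κ (h j)) m := fun j =>
    (smoothVFieldAt_inducedVF hκ hh j m).diff
  have h1 := covariantDerivative_sum nabla Finset.univ fun j _ => (hVd j).smul (hcd j)
  have h2 : X1 K κ μ = fun x => (2 : ℝ) • ∑ j, c j x • inducedVF E G κ (h j) x :=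
    funext fun x => X1_eq hκ hh hc hμ x
  have h3 := covariantDerivative_const_smul nabla 2 h1.1
  ext v
  rw [h2]
  change nabla (fun x => (2 : ℝ) • ∑ j, c j x • inducedVF E G κ (h j) x) m v = _
  rw [h3, h1.2]
  simp only [smul_apply, sum_apply, LinearMap.smul_apply, LinearMap.sum_apply]
  congr 1
  refine Finset.sum_congr rfl fun j _ => ?_
  have h4 : nabla (inducedVF E G κ (h j)) m v
      = nabla (fundVF E G (dualMap κ (h j) m)) m v - variationEnd E G (dualMap κ (h j)) m v := by
    rw [variationEnd_apply, sub_neg_eq_add]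
    exact covariantDerivative_fundVF nabla (contMDiffAt_dualMap_frame hκ hh j m) v
  rw [covariantDerivative_smul nabla (hcd j) (hVd j), mvfderiv_coeff hκ hh hc hμ, h4]
  simp only [LinearMap.add_apply, LinearMap.smul_apply, LinearMap.sub_apply,
    LinearMap.smulRight_apply]
  change _ = _ + _ + c j m • (nabla (fundVF E G (dualMap κ (h j) m)) m v - _)
  module

end Hamiltonian

/-! ### The zeroth-order terms -/

section Endomorphisms

variable {E : Type*} [NormedAddCommGroup E] [NormedSpace ℝ E] [FiniteDimensional ℝ E]
  {M : Type*} [TopologicalSpace M] [ChartedSpace E M] [IsManifold 𝓘(ℝ, E) ∞ M]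
  (K : AlmostKahler E M)
  (nabla : CovariantDerivative 𝓘(ℝ, E) E (TangentSpace 𝓘(ℝ, E) : M → Type _))
  {ι : Type*} [Fintype ι]

/-- The frame independent form of the endomorphism `A₁`, for vector fields `X` and `V_j`. -/
def endA1 (L : M → Type*) [∀ m, NormedAddCommGroup (L m)] [∀ m, InnerProductSpace ℂ (L m)] (p : ℕ)
    (X : VField E M) (V : ι → VField E M) (m : M) : Module.End ℂ (FormFibre E L p m) :=
  (Complex.I / 4) • clTrace K L p m (nabla X m).toLinearMap
  - (Complex.I / 2 * trace10 (K.Jlin m) (nabla X m).toLinearMap) • 1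
  + (1 / 2 : ℂ) • ∑ j, (Complex.I • (cl K (K.J m (V j m)) * cl K (V j m))
      + (K.metric m (V j m) (V j m) : ℂ) • 1)

/-- The frame independent form of the endomorphism `A₂`, for one-forms `α_j` and vector
fields `V_j`. -/
def endA2 (L : M → Type*) [∀ m, NormedAddCommGroup (L m)] [∀ m, InnerProductSpace ℂ (L m)] (p : ℕ)
    (α : ι → ∀ m : M, TangentSpace 𝓘(ℝ, E) m →ₗ[ℝ] ℝ) (V : ι → VField E M) (m : M) :
    Module.End ℂ (FormFibre E L p m) :=
  (Complex.I / 2) • ∑ j, cl K (vecOf (K.metric m) (α j m)) * cl K (V j m)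
  + (Complex.I * ∑ j, trace10 (K.Jlin m) ((α j m).smulRight (V j m))) • 1

/-- The frame independent form of the endomorphism `A₃`, for endomorphisms `W_j` of the tangent
spaces. -/
def endA3 (L : M → Type*) [∀ m, NormedAddCommGroup (L m)] [∀ m, InnerProductSpace ℂ (L m)] (p : ℕ)
    (c : ι → M → ℝ) (W : ι → ∀ m : M, TangentSpace 𝓘(ℝ, E) m →ₗ[ℝ] TangentSpace 𝓘(ℝ, E) m)
    (m : M) : Module.End ℂ (FormFibre E L p m) :=
  -((Complex.I / 2) • ∑ j, (c j m : ℂ) • clTrace K L p m (W j m))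
  - (Complex.I * ∑ j, (c j m : ℂ) * trace10 (K.Jlin m) (W j m)) • 1

variable {L : M → Type*} [TopologicalSpace (TotalSpace ℂ L)]
  [∀ m, NormedAddCommGroup (L m)] [∀ m, InnerProductSpace ℂ (L m)]
  [FiberBundle ℂ L] [VectorBundle ℂ ℂ L] [VectorBundle ℝ ℂ L] {p : ℕ}

theorem endA1_apply (X : VField E M) (V : ι → VField E M) (m : M) (σ : FormFibre E L p m) :
    endA1 K nabla L p X V m σ = (Complex.I / 4) • clTrace K L p m (nabla X m).toLinearMap σ
      - (Complex.I / 2 * trace10 (K.Jlin m) (nabla X m).toLinearMap) • σ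
      + (1 / 2 : ℂ) • ∑ j, (Complex.I • cl K (K.J m (V j m)) (cl K (V j m) σ)
        + (K.metric m (V j m) (V j m) : ℂ) • σ) := by
  simp only [endA1, LinearMap.add_apply, LinearMap.sub_apply, LinearMap.smul_apply,
    LinearMap.sum_apply, Module.End.mul_apply, Module.End.one_apply]

theorem endA2_apply (α : ι → ∀ m : M, TangentSpace 𝓘(ℝ, E) m →ₗ[ℝ] ℝ) (V : ι → VField E M) (m : M)
    (σ : FormFibre E L p m) : endA2 K L p α V m σ
      = (Complex.I / 2) • ∑ j, cl K (vecOf (K.metric m) (α j m)) (cl K (V j m) σ)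
        + (Complex.I * ∑ j, trace10 (K.Jlin m) ((α j m).smulRight (V j m))) • σ := by
  simp only [endA2, LinearMap.add_apply, LinearMap.smul_apply,
    LinearMap.sum_apply, Module.End.mul_apply, Module.End.one_apply]

theorem endA3_apply (c : ι → M → ℝ)
    (W : ι → ∀ m : M, TangentSpace 𝓘(ℝ, E) m →ₗ[ℝ] TangentSpace 𝓘(ℝ, E) m) (m : M)
    (σ : FormFibre E L p m) : endA3 K L p c W m σ
      = -((Complex.I / 2) • ∑ j, (c j m : ℂ) • clTrace K L p m (W j m) σ)
        - (Complex.I * ∑ j, (c j m : ℂ) * trace10 (K.Jlin m) (W j m)) • σ := by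
  simp only [endA3, LinearMap.sub_apply, LinearMap.neg_apply, LinearMap.smul_apply,
    LinearMap.sum_apply, Module.End.one_apply]

theorem endA1_mem (X : VField E M) (V : ι → VField E M) (m : M) {σ : FormFibre E L p m}
    (hσ : σ ∈ SpinorFibre K L p m) : endA1 K nabla L p X V m σ ∈ SpinorFibre K L p m := by
  rw [endA1_apply]
  exact add_mem (sub_mem (Submodule.smul_mem _ _ (clTrace_mem K _ hσ)) (Submodule.smul_mem _ _ hσ))
    (Submodule.smul_mem _ _ (sum_mem fun j _ => add_mem
      (Submodule.smul_mem _ _ (cl_mem K _ (cl_mem K _ hσ))) (Submodule.smul_mem _ _ hσ)))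

theorem endA2_mem (α : ι → ∀ m : M, TangentSpace 𝓘(ℝ, E) m →ₗ[ℝ] ℝ) (V : ι → VField E M) (m : M)
    {σ : FormFibre E L p m} (hσ : σ ∈ SpinorFibre K L p m) :
    endA2 K L p α V m σ ∈ SpinorFibre K L p m := by
  rw [endA2_apply]
  exact add_mem (Submodule.smul_mem _ _ (sum_mem fun j _ => cl_mem K _ (cl_mem K _ hσ)))
    (Submodule.smul_mem _ _ hσ)

theorem endA3_mem (c : ι → M → ℝ)
    (W : ι → ∀ m : M, TangentSpace 𝓘(ℝ, E) m →ₗ[ℝ] TangentSpace 𝓘(ℝ, E) m) (m : M)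
    {σ : FormFibre E L p m} (hσ : σ ∈ SpinorFibre K L p m) :
    endA3 K L p c W m σ ∈ SpinorFibre K L p m := by
  rw [endA3_apply]
  exact sub_mem (neg_mem (Submodule.smul_mem _ _ (sum_mem fun j _ =>
    Submodule.smul_mem _ _ (clTrace_mem K _ hσ)))) (Submodule.smul_mem _ _ hσ)

variable {K}

/-- The value of an orthonormal frame at a point is its own dual frame. -/
theorem isDualFrame_of_isOrthonormalFrameOn {U : Set M} {e : Fin (Module.finrank ℝ E) → VField E M}
    (he : K.IsOrthonormalFrameOn e U) {m : M} (hm : m ∈ U) :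
    IsDualFrame (K.metric m) (fun k => e k m) (fun k => e k m) :=
  isDualFrame_of_orthonormal (fun k => e k m) (he.orthonormal m hm)

/-- The frame expression of the first endomorphism does not depend on the frame. -/
theorem formulaA1_eq {nabla} (hnabla : K.IsLeviCivita nabla) {U : Set M}
    {e : Fin (Module.finrank ℝ E) → VField E M} (he : K.IsOrthonormalFrameOn e U) {m : M}
    (hm : m ∈ U) {X : VField E M} (hX : DiffVFieldAt X m) (V : ι → VField E M) :
    formulaA1 K nabla L p X V e m = endA1 K nabla L p X V m := by
  rw [formulaA1, endA1, trace_nabla10 K hnabla hX,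
    clTrace_eq_sum K (isDualFrame_of_isOrthonormalFrameOn he hm)]
  rfl

end Endomorphisms

/-! ### Smoothness of the zeroth-order terms -/

section SmoothEndomorphisms

variable {E : Type*} [NormedAddCommGroup E] [NormedSpace ℝ E] [FiniteDimensional ℝ E]
  {M : Type*} [TopologicalSpace M] [ChartedSpace E M] [IsManifold 𝓘(ℝ, E) ∞ M] [T2Space M]
  {L : M → Type*} [TopologicalSpace (TotalSpace ℂ L)]
  [∀ m, NormedAddCommGroup (L m)] [∀ m, InnerProductSpace ℂ (L m)]
  [FiberBundle ℂ L] [VectorBundle ℂ ℂ L] [VectorBundle ℝ ℂ L]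
  (K : AlmostKahler E M)
  {nabla : CovariantDerivative 𝓘(ℝ, E) E (TangentSpace 𝓘(ℝ, E) : M → Type _)}
  {ι : Type*} [Fintype ι] {p : ℕ} {s : ∀ m : M, FormFibre E L p m} {m : M}

theorem SmoothFormAt.clTrace
    {T : ∀ x : M, TangentSpace 𝓘(ℝ, E) x →ₗ[ℝ] TangentSpace 𝓘(ℝ, E) x}
    (hT : ∀ i, SmoothVFieldAt (fun x => T x (coordField m i x)) m) (hs : SmoothFormAt p s m) :
    SmoothFormAt p (fun x => SpincBochner.clTrace K L p x (T x) (s x)) m :=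
  SmoothFormAt.cliffordTrace K hT hs

theorem SmoothFormAt.endA1 (hnabla : K.IsLeviCivita nabla) {X : VField E M} {V : ι → VField E M}
    (hX : ∀ x, SmoothVFieldAt X x) (hV : ∀ j x, SmoothVFieldAt (V j) x)
    (hs : SmoothFormAt p s m) :
    SmoothFormAt p (fun x => SpincBochner.endA1 K nabla L p X V x (s x)) m := by
  have hT : ∀ i, SmoothVFieldAt
      (fun x => (nabla X x).toLinearMap (coordField m i x)) m := fun i =>
    SmoothVFieldAt.covariantDerivative K hnabla (Filter.Eventually.of_forall hX)
      (smoothVFieldAt_coordField (mem_chart_source E m) i)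
  simp only [endA1_apply]
  refine SmoothFormAt.add (SmoothFormAt.sub ((hs.clTrace K hT).const_smul _) (SmoothFormAt.smul
    (contMDiffAt_mul contMDiffAt_const (contMDiffAt_trace10 K hT)) hs))
    (SmoothFormAt.const_smul _ (SmoothFormAt.sum Finset.univ fun j _ => SmoothFormAt.add
      (((hs.cl K (hV j m)).cl K ((hV j m).map_J K)).const_smul _)
      (SmoothFormAt.smul (contMDiffAt_ofReal (contMDiffAt_metric K (hV j m) (hV j m))) hs)))

theorem SmoothFormAt.endA2 {α : ι → ∀ m : M, TangentSpace 𝓘(ℝ, E) m →ₗ[ℝ] ℝ} {V : ι → VField E M}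
    (hα : ∀ j i, ContMDiffAt 𝓘(ℝ, E) 𝓘(ℝ, ℝ) ∞ (fun x => α j x (coordField m i x)) m)
    (hV : ∀ j x, SmoothVFieldAt (V j) x) (hs : SmoothFormAt p s m) :
    SmoothFormAt p (fun x => SpincBochner.endA2 K L p α V x (s x)) m := by
  have h1 : ∀ j, ContMDiffAt 𝓘(ℝ, E) 𝓘(ℝ, ℂ) ∞
      (fun x => trace10 (K.Jlin x) ((α j x).smulRight (V j x))) m := fun j =>
    contMDiffAt_trace10 K fun i => SmoothVFieldAt.smul (hα j i) (hV j m)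
  simp only [endA2_apply]
  exact SmoothFormAt.add (SmoothFormAt.const_smul _ (SmoothFormAt.sum Finset.univ fun j _ =>
      (hs.cl K (hV j m)).cl K (smoothVFieldAt_metric_dual K (hα j))))
    (SmoothFormAt.smul (contMDiffAt_mul contMDiffAt_const
      (ContMDiffAt.sum (t := Finset.univ) fun j _ => h1 j)) hs)

theorem SmoothFormAt.endA3 {c : ι → M → ℝ}
    {W : ι → ∀ m : M, TangentSpace 𝓘(ℝ, E) m →ₗ[ℝ] TangentSpace 𝓘(ℝ, E) m}
    (hc : ∀ j, ContMDiffAt 𝓘(ℝ, E) 𝓘(ℝ, ℝ) ∞ (c j) m)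
    (hW : ∀ j i, SmoothVFieldAt (fun x => W j x (coordField m i x)) m) (hs : SmoothFormAt p s m) :
    SmoothFormAt p (fun x => SpincBochner.endA3 K L p c W x (s x)) m := by
  have h1 : ∀ j, ContMDiffAt 𝓘(ℝ, E) 𝓘(ℝ, ℂ) ∞
      (fun x => (c j x : ℂ) * trace10 (K.Jlin x) (W j x)) m := fun j =>
    contMDiffAt_mul (contMDiffAt_ofReal (hc j)) (contMDiffAt_trace10 K (hW j))
  simp only [endA3_apply, ← neg_smul]
  exact SmoothFormAt.sub (SmoothFormAt.const_smul _ (SmoothFormAt.sum Finset.univ fun j _ =>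
      SmoothFormAt.smul (contMDiffAt_ofReal (hc j)) (hs.clTrace K (hW j))))
    (SmoothFormAt.smul (contMDiffAt_mul contMDiffAt_const
      (ContMDiffAt.sum (t := Finset.univ) fun j _ => h1 j)) hs)

end SmoothEndomorphisms

/-! ### The Bochner formula -/

section BochnerFormula

variable {E : Type*} [NormedAddCommGroup E] [NormedSpace ℝ E] [FiniteDimensional ℝ E]
  {M : Type*} [TopologicalSpace M] [ChartedSpace E M] [IsManifold 𝓘(ℝ, E) ∞ M] [T2Space M]
  {EG : Type*} [NormedAddCommGroup EG] [NormedSpace ℝ EG] [FiniteDimensional ℝ EG]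
  {G : Type*} [TopologicalSpace G] [ChartedSpace EG G] [Group G] [LieGroup 𝓘(ℝ, EG) ∞ G]
  [MulAction G M] [ContMDiffSMul 𝓘(ℝ, EG) 𝓘(ℝ, E) ∞ G M]
  {K : AlmostKahler E M}
  {nabla : CovariantDerivative 𝓘(ℝ, E) E (TangentSpace 𝓘(ℝ, E) : M → Type _)}
  {L : M → Type*} [TopologicalSpace (TotalSpace ℂ L)]
  [∀ m, NormedAddCommGroup (L m)] [∀ m, InnerProductSpace ℂ (L m)]
  [FiberBundle ℂ L] [VectorBundle ℂ ℂ L] [VectorBundle ℝ ℂ L]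
  [ContMDiffVectorBundle ∞ ℂ L 𝓘(ℝ, E)]
  {nablaL : CovariantDerivative 𝓘(ℝ, E) ℂ L} {actL : ∀ (g : G) (m : M), L m ≃ₗ[ℂ] L (g • m)}
  {κ : M → LinearMap.BilinForm ℝ (EG →L[ℝ] ℝ)} {μ : M → (EG →L[ℝ] ℝ)}
  {ι : Type*} [Fintype ι] [DecidableEq ι] {h : ι → M → (EG →L[ℝ] ℝ)} {c : ι → M → ℝ}

/-- The frame expression of the second endomorphism does not depend on the frame. -/
theorem formulaA2_eq {U : Set M} {e : Fin (Module.finrank ℝ E) → VField E M}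
    (he : K.IsOrthonormalFrameOn e U) {m : M} (hm : m ∈ U) {p : ℕ} :
    formulaA2 K G L p κ μ h e m
      = endA2 K L p (fun j m => pairDeriv μ (dualMap κ (h j)) m)
          (fun j => inducedVF E G κ (h j)) m := by
  have hd := isDualFrame_of_isOrthonormalFrameOn he hm
  have h1 : ∀ j, ∑ k, covecC (pairDeriv μ (dualMap κ (h j)) m) (vec10 (K.Jlin m) (e k m))
        * herm (K.metric m) (1 ⊗ₜ inducedVF E G κ (h j) m) (vec10 (K.Jlin m) (e k m))
      = trace10 (K.Jlin m) ((pairDeriv μ (dualMap κ (h j)) m).smulRight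
          (inducedVF E G κ (h j) m)) := fun j =>
    trace10_smulRight_eq_sum (K.hermitianPair m) hd _ _
  simp only [formulaA2, endA2, h1]

/-- The frame expression of the third endomorphism does not depend on the frame; the commutators in
it are values of an endomorphism by `bracketDiff_eq`. -/
theorem formulaA3_eq (hnabla : K.IsLeviCivita nabla) (hκ : IsInvariantMetric E G κ)
    (hh : IsOrthonormalFrame E κ h) {U : Set M}
    {e : Fin (Module.finrank ℝ E) → VField E M} (hU : IsOpen U)
    (he : K.IsOrthonormalFrameOn e U) {m : M} (hm : m ∈ U) {p : ℕ} :
    formulaA3 K G L p κ c h e m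
      = endA3 K L p c (fun j m => variationEnd E G (dualMap κ (h j)) m) m := by
  have hd := isDualFrame_of_isOrthonormalFrameOn he hm
  have hed : ∀ k, DiffVFieldAt (e k) m := fun k =>
    SmoothVFieldAt.diff ((he.smooth k).contMDiffAt (hU.mem_nhds hm))
  have h1 : ∀ j k, bracketDiff E G (dualMap κ (h j)) (e k) m
      = variationEnd E G (dualMap κ (h j)) m (e k m) := fun j k =>
    bracketDiff_eq hnabla (contMDiffAt_dualMap_frame hκ hh j m) (hed k)
  have h2 : ∀ j k, bracketDiff10 K G (dualMap κ (h j)) (e k) m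
      = (1 / 2 : ℂ) ⊗ₜ variationEnd E G (dualMap κ (h j)) m (e k m)
        - (Complex.I / 2) ⊗ₜ variationEnd E G (dualMap κ (h j)) m (K.Jlin m (e k m)) :=
    fun j k => by
      rw [bracketDiff10, h1,
        bracketDiff_eq hnabla (contMDiffAt_dualMap_frame hκ hh j m) ((hed k).map_J K)]
      rfl
  have h3 : ∀ j, ∑ k, herm (K.metric m) (bracketDiff10 K G (dualMap κ (h j)) (e k) m)
      (vec10 (K.Jlin m) (e k m)) = trace10 (K.Jlin m) (variationEnd E G (dualMap κ (h j)) m) :=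
    fun j => by
      simp only [h2]
      exact trace10_eq_sum_herm (K.hermitianPair m) hd _
  have h4 : ∀ j, (∑ k, cl K (e k m) * cl K (bracketDiff E G (dualMap κ (h j)) (e k) m)
      : Module.End ℂ (FormFibre E L p m))
      = clTrace K L p m (variationEnd E G (dualMap κ (h j)) m) := fun j => by
    rw [clTrace_eq_sum K hd]
    simp only [h1]
  simp only [formulaA3, endA3, ← Finset.smul_sum, ← Finset.mul_sum, h3, h4]

/-- The trace of the rank one endomorphism `g(J v, ·) ⊗ v`, which accounts for the terms `‖V_j‖²`.
-/
theorem trace10_smulRight_J (m : M) (v : TangentSpace 𝓘(ℝ, E) m) :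
    trace10 (K.Jlin m) ((K.metric m (K.J m v)).smulRight v)
      = -(Complex.I / 2) * (K.metric m v v : ℂ) := by
  have H := K.hermitianPair m
  have h1 : K.metric m (K.J m v) v = 0 := by
    have e1 := H.skew v v
    have e2 := H.symm (K.J m v) v
    simp only [K.Jlin_apply] at e1
    linarith
  have h2 : K.metric m (K.J m v) (K.Jlin m v) = K.metric m v v := H.isometry v v
  rw [trace10_smulRight, h1, h2]
  push_cast
  ring

/-- The algebraic identity behind the expression for the square of the deformed Dirac operator: the
terms involving the covariant derivatives of the vector fields `ξ^M` combine to the endomorphisms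
`A₁`, `A₂` and `A₃`. -/
theorem bochner_algebra {N ι : Type*} [AddCommGroup N] [Module ℂ N] (S : Finset ι) (t P : ℂ)
    (σ : N) (a b q w l : ι → N) (c g τ x y : ι → ℂ) :
    (Complex.I * t / 2) • ((2 : ℂ) • ∑ j ∈ S, (a j + b j + c j • (q j - w j))
      - (2 : ℂ) • (2 : ℂ) • ∑ j ∈ S, c j • (l j + (1 / 4 : ℂ) • q j + ((1 / 2 : ℂ) * x j) • σ
          + (2 * P * Complex.I * c j) • σ))
    = t • ((Complex.I / 4) • ((2 : ℂ) • ∑ j ∈ S, (a j + b j + c j • (q j - w j)))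
        - (Complex.I / 2 * (2 * ∑ j ∈ S, (-(Complex.I / 2) * g j + τ j + c j * (x j - y j)))) • σ
        + (1 / 2 : ℂ) • ∑ j ∈ S, (Complex.I • a j + g j • σ)
        + ((Complex.I / 2) • ∑ j ∈ S, b j + (Complex.I * ∑ j ∈ S, τ j) • σ)
        + (-((Complex.I / 2) • ∑ j ∈ S, c j • w j) - (Complex.I * ∑ j ∈ S, c j * y j) • σ))
      + (4 * P * t * ∑ j ∈ S, c j * c j) • σ - (2 * Complex.I * t) • ∑ j ∈ S, c j • l j := by
  induction S using Finset.cons_induction with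
  | empty => simp
  | cons i S hi ih =>
    simp only [Finset.sum_cons]
    have h : ∀ u v u' v' r : N, u - u' = r → v - v' = r → u' = v' → u = v := by
      rintro u v u' v' r h1 h2 rfl
      exact sub_left_injective (h1.trans h2.symm)
    refine h _ _ _ _ ((Complex.I * t / 2) • ((2 : ℂ) • (a i + b i + c i • (q i - w i))
      - (2 : ℂ) • (2 : ℂ) • c i • (l i + (1 / 4 : ℂ) • q i + ((1 / 2 : ℂ) * x i) • σ
          + (2 * P * Complex.I * c i) • σ))) ?_ ?_ ih
    · module
    · match_scalars
      all_goals first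
        | ring1
        | (ring_nf; rw [Complex.I_sq]; ring1)

/-- The square of the Dirac operator deformed by `X_1^H`. -/
theorem deformedDirac_X1_sq (hnabla : K.IsLeviCivita nabla) (hL : IsPrequantum K nablaL)
    (hact : IsPrequantumAction EG K nablaL actL) (hμ : IsMomentumMap K nablaL actL μ)
    (hκ : IsInvariantMetric E G κ) (hh : IsOrthonormalFrame E κ h)
    (hc : ∀ m, μ m = ∑ j, c j m • h j m) {p : ℕ} (t : ℝ) {s : ∀ m : M, FormFibre E L p m}
    (hs : IsSpinor K p s) (m : M) :
    deformedDirac K nabla nablaL p (X1 K κ μ) t (deformedDirac K nabla nablaL p (X1 K κ μ) t s) m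
      = dirac K nabla nablaL p (dirac K nabla nablaL p s) m
        + (t : ℂ) • (endA1 K nabla L p (X1 K κ μ) (fun j => inducedVF E G κ (h j)) m (s m)
          + endA2 K L p (fun j m => pairDeriv μ (dualMap κ (h j)) m)
              (fun j => inducedVF E G κ (h j)) m (s m)
          + endA3 K L p c (fun j m => variationEnd E G (dualMap κ (h j)) m) m (s m))
        + (4 * Real.pi * p * t * normSqMu κ μ m : ℂ) • s m
        + (t ^ 2 / 4 * K.metric m (X1 K κ μ m) (X1 K κ μ m) : ℂ) • s m
        - (2 * Complex.I * t) •
            ∑ j, (c j m : ℂ) • lieDerivForm actL p (dualMap κ (h j) m) s m := by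
  have hs1 := hs.1
  have hsm := hs.2 m
  set σ := s m with hσ
  -- the covariant derivative along `X_1^H = 2 ∑_j μ_j V_j`
  let D := nablaSpinorL K nabla nablaL (smoothForm_iff.1 hs1 m)
  have hD : nablaSpinor K nabla nablaL p s m (X1 K κ μ m)
      = (2 : ℂ) • ∑ j, (c j m : ℂ) • nablaSpinor K nabla nablaL p s m
          (inducedVF E G κ (h j) m) := by
    change D (X1 K κ μ m) = (2 : ℂ) • ∑ j, (c j m : ℂ) • D (inducedVF E G κ (h j) m)
    rw [X1_eq hκ hh hc hμ, map_smul, map_sum, ← Complex.coe_smul (2 : ℝ)]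
    simp only [map_smul, Complex.coe_smul]
    rfl
  have hD2 : ∀ j, nablaSpinor K nabla nablaL p s m (inducedVF E G κ (h j) m) = _ := fun j =>
    nablaSpinor_fundVF K hnabla hact hμ (smoothForm_iff.1 hs1 m).diff hsm (dualMap κ (h j) m)
  -- the Clifford trace and the trace over `T^{1,0}M` of `∇ X_1^H`
  have hframe := isDualFrame_tangentBasis K m
  have hQ : clTrace K L p m (nabla (X1 K κ μ) m).toLinearMap σ
      = (2 : ℂ) • ∑ j, (cl K (K.J m (inducedVF E G κ (h j) m)) (cl K (inducedVF E G κ (h j) m) σ)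
        + cl K (vecOf (K.metric m) (pairDeriv μ (dualMap κ (h j)) m))
            (cl K (inducedVF E G κ (h j) m) σ)
        + (c j m : ℂ) • (clTrace K L p m (nabla (fundVF E G (dualMap κ (h j) m)) m).toLinearMap σ
          - clTrace K L p m (variationEnd E G (dualMap κ (h j)) m) σ)) := by
    have hcl : ∀ a u : TangentSpace 𝓘(ℝ, E) m, cliffordTrace (K.metric m) (K.Jlin m)
        (dualTangentBasis K m) (tangentBasis m) ((K.metric m a).smulRight u) σ
        = cl K a (cl K u σ) := fun a u => by
      rw [hframe.cliffordTrace_smulRight (K.hermitianPair m)]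
      rfl
    have hsub : ∀ A B : TangentSpace 𝓘(ℝ, E) m →ₗ[ℝ] TangentSpace 𝓘(ℝ, E) m,
        clTrace K L p m (A - B) σ = clTrace K L p m A σ - clTrace K L p m B σ := fun A B => by
      have h1 : clTrace K L p m A σ = clTrace K L p m (A - B) σ + clTrace K L p m B σ := by
        rw [← LinearMap.add_apply, clTrace, clTrace, clTrace, ← cliffordTrace_add, sub_add_cancel]
      rw [h1, add_sub_cancel_right]
    simp only [← hsub]
    rw [nabla_X1 hκ hh hc hμ]
    simp only [clTrace, cliffordTrace_smul, cliffordTrace_sum, cliffordTrace_add,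
      LinearMap.smul_apply, LinearMap.sum_apply, LinearMap.add_apply, hcl]
    norm_num
  have hT : trace10 (K.Jlin m) (nabla (X1 K κ μ) m).toLinearMap
      = 2 * ∑ j, (-(Complex.I / 2)
          * (K.metric m (inducedVF E G κ (h j) m) (inducedVF E G κ (h j) m) : ℂ)
        + trace10 (K.Jlin m) ((pairDeriv μ (dualMap κ (h j)) m).smulRight
            (inducedVF E G κ (h j) m))
        + (c j m : ℂ) * (trace10 (K.Jlin m) (nabla (fundVF E G (dualMap κ (h j) m)) m).toLinearMap
          - trace10 (K.Jlin m) (variationEnd E G (dualMap κ (h j)) m))) := by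
    rw [nabla_X1 hκ hh hc hμ, trace10_smul, trace10_sum]
    simp only [trace10_add, trace10_smul, trace10_sub, trace10_smulRight_J,
      vecOf_spec (K.metric_nondegenerate m)]
    norm_num
  rw [deformedDirac_deformedDirac K hnabla hL (smoothVFieldAt_X1 hκ hh hc hμ m) hs1, hD,
    endA1_apply,
    endA2_apply, endA3_apply, hQ, hT, hh.normSqMu_eq hc]
  simp only [hD2, hh.apply_dualMap hc]
  have hscal : ∀ j, (2 * Real.pi * Complex.I * p * (c j m : ℂ))
      = 2 * (Real.pi * p) * Complex.I * (c j m : ℂ) := fun j => by ring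
  simp only [hscal]
  have key := bochner_algebra Finset.univ (t : ℂ) (Real.pi * p) σ
    (fun j => cl K (K.J m (inducedVF E G κ (h j) m)) (cl K (inducedVF E G κ (h j) m) σ))
    (fun j => cl K (vecOf (K.metric m) (pairDeriv μ (dualMap κ (h j)) m))
      (cl K (inducedVF E G κ (h j) m) σ))
    (fun j => clTrace K L p m (nabla (fundVF E G (dualMap κ (h j) m)) m).toLinearMap σ)
    (fun j => clTrace K L p m (variationEnd E G (dualMap κ (h j)) m) σ)
    (fun j => lieDerivForm actL p (dualMap κ (h j) m) s m) (fun j => (c j m : ℂ))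
    (fun j => (K.metric m (inducedVF E G κ (h j) m) (inducedVF E G κ (h j) m) : ℂ))
    (fun j => trace10 (K.Jlin m) ((pairDeriv μ (dualMap κ (h j)) m).smulRight
      (inducedVF E G κ (h j) m)))
    (fun j => trace10 (K.Jlin m) (nabla (fundVF E G (dualMap κ (h j) m)) m).toLinearMap)
    (fun j => trace10 (K.Jlin m) (variationEnd E G (dualMap κ (h j)) m))
  rw [key]
  push_cast
  module

end BochnerFormula

end SpincBochner

end

theorem theorem5p1
    {E : Type*} [NormedAddCommGroup E] [NormedSpace ℝ E] [FiniteDimensional ℝ E]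
    {M : Type*} [TopologicalSpace M] [T2Space M] [SigmaCompactSpace M] [ChartedSpace E M]
    [IsManifold 𝓘(ℝ, E) ∞ M]
    -- the symplectic form and the almost complex structure
    (K : AlmostKahler E M)
    -- the Levi-Civita connection
    (nabla : CovariantDerivative 𝓘(ℝ, E) E (TangentSpace 𝓘(ℝ, E) : M → Type _))
    (hnabla : K.IsLeviCivita nabla)
    -- the prequantum line bundle
    {L : M → Type*} [TopologicalSpace (TotalSpace ℂ L)]
    [∀ m, NormedAddCommGroup (L m)] [∀ m, InnerProductSpace ℂ (L m)]
    [FiberBundle ℂ L] [VectorBundle ℂ ℂ L] [VectorBundle ℝ ℂ L]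
    [ContMDiffVectorBundle ∞ ℂ L 𝓘(ℝ, E)]
    (nablaL : CovariantDerivative 𝓘(ℝ, E) ℂ L) (hL : IsPrequantum K nablaL)
    -- the group action and the momentum map
    {EG : Type*} [NormedAddCommGroup EG] [NormedSpace ℝ EG] [FiniteDimensional ℝ EG]
    {G : Type*} [TopologicalSpace G] [ChartedSpace EG G] [Group G] [LieGroup 𝓘(ℝ, EG) ∞ G]
    [MulAction G M] [ContMDiffSMul 𝓘(ℝ, EG) 𝓘(ℝ, E) ∞ G M]
    (actL : ∀ (g : G) (m : M), L m ≃ₗ[ℂ] L (g • m)) (hact : IsPrequantumAction EG K nablaL actL)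
    (μ : M → (EG →L[ℝ] ℝ)) (hμ : IsMomentumMap K nablaL actL μ)
    -- the invariant metric on the bundle of copies of the dual Lie algebra, with a frame
    (κ : M → LinearMap.BilinForm ℝ (EG →L[ℝ] ℝ)) (hκ : IsInvariantMetric E G κ)
    {ι : Type*} [Fintype ι] [DecidableEq ι]
    (h : ι → M → (EG →L[ℝ] ℝ)) (hh : IsOrthonormalFrame E κ h)
    (c : ι → M → ℝ) (hc : ∀ m, μ m = ∑ j, c j m • h j m)
    (p : ℕ) (hp : 1 ≤ p) :
    ∃ A₁ A₂ A₃ : ∀ m : M, Module.End ℂ (SpinorFibre K L p m),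
      (IsSmoothEnd K p A₁ ∧ IsSmoothEnd K p A₂ ∧ IsSmoothEnd K p A₃) ∧
      -- the expressions for the endomorphisms in any local orthonormal frame
      (∀ (U : Set M) (e : Fin (Module.finrank ℝ E) → VField E M), IsOpen U →
        K.IsOrthonormalFrameOn e U → ∀ m ∈ U, ∀ σ : SpinorFibre K L p m,
          (A₁ m σ : FormFibre E L p m) = formulaA1 K nabla L p (X1 K κ μ)
              (fun j => inducedVF E G κ (h j)) e m σ ∧
          (A₂ m σ : FormFibre E L p m) = formulaA2 K G L p κ μ h e m σ ∧
          (A₃ m σ : FormFibre E L p m) = formulaA3 K G L p κ c h e m σ) ∧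
      -- the formula for the square
      (∀ (t : ℝ) (s : ∀ m : M, FormFibre E L p m) (hs : IsSpinor K p s) (m : M),
        deformedDirac K nabla nablaL p (X1 K κ μ) t
            (deformedDirac K nabla nablaL p (X1 K κ μ) t s) m
          = dirac K nabla nablaL p (dirac K nabla nablaL p s) m
            + (t : ℂ) • ((A₁ m + A₂ m + A₃ m) ⟨s m, hs.2 m⟩ : FormFibre E L p m)
            + (4 * Real.pi * p * t * normSqMu κ μ m : ℂ) • s m
            + (t ^ 2 / 4 * K.metric m (X1 K κ μ m) (X1 K κ μ m) : ℂ) • s m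
            - (2 * Complex.I * t) •
                ∑ j, (c j m : ℂ) • lieDerivForm actL p (dualMap κ (h j) m) s m) ∧
      -- the case of invariant sections
      (∀ (t : ℝ) (s : ∀ m : M, FormFibre E L p m) (hs : IsSpinor K p s),
        IsInvariantForm actL p s → ∀ m : M,
        (∀ j, lieDerivForm actL p (dualMap κ (h j) m) s m = 0) ∧
        deformedDirac K nabla nablaL p (X1 K κ μ) t
            (deformedDirac K nabla nablaL p (X1 K κ μ) t s) m
          = dirac K nabla nablaL p (dirac K nabla nablaL p s) m
            + (t : ℂ) • ((A₁ m + A₂ m + A₃ m) ⟨s m, hs.2 m⟩ : FormFibre E L p m)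
            + (4 * Real.pi * p * t * normSqMu κ μ m : ℂ) • s m
            + (t ^ 2 / 4 * K.metric m (X1 K κ μ m) (X1 K κ μ m) : ℂ) • s m) := by
  have hX := smoothVFieldAt_X1 (K := K) (nablaL := nablaL) (actL := actL) hκ hh hc hμ
  have hV := smoothVFieldAt_inducedVF (E := E) (G := G) hκ hh
  have hf := contMDiffAt_dualMap_frame hκ hh
  have hcj := contMDiffAt_coeff hκ hh hc hμ
  refine ⟨fun m => (endA1 K nabla L p (X1 K κ μ) (fun j => inducedVF E G κ (h j)) m).restrict
      fun _ => endA1_mem K nabla _ _ m,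
    fun m => (endA2 K L p (fun j m => pairDeriv μ (dualMap κ (h j)) m)
      (fun j => inducedVF E G κ (h j)) m).restrict fun _ => endA2_mem K _ _ m,
    fun m => (endA3 K L p c (fun j m => variationEnd E G (dualMap κ (h j)) m) m).restrict
      fun _ => endA3_mem K _ _ m, ⟨fun s hs => ?_, fun s hs => ?_, fun s hs => ?_⟩,
    fun U e hU he m hm σ => ⟨?_, ?_, ?_⟩, fun t s hs m => ?_, fun t s hs hinv m => ?_⟩
  · exact smoothForm_iff.2 fun m => (smoothForm_iff.1 hs.1 m).endA1 K hnabla hX hV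
  · refine smoothForm_iff.2 fun m => (smoothForm_iff.1 hs.1 m).endA2 K (fun j i => ?_) hV
    exact hμ.smooth.contMDiffAt.clm_apply (contMDiffAt_mvfderiv (hf j m)
      (smoothVFieldAt_coordField (mem_chart_source E m) i))
  · exact smoothForm_iff.2 fun m => (smoothForm_iff.1 hs.1 m).endA3 K (fun j => hcj j m)
      fun j i => smoothVFieldAt_variationEnd (hf j m)
        (smoothVFieldAt_coordField (mem_chart_source E m) i)
  · rw [formulaA1_eq hnabla he hm (hX m).diff]
    rfl
  · rw [formulaA2_eq he hm]
    rfl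
  · rw [formulaA3_eq hnabla hκ hh hU he hm]
    rfl
  · exact deformedDirac_X1_sq hnabla hL hact hμ hκ hh hc t hs m
  · have hzero := fun j => hinv.lieDerivForm_eq_zero (dualMap κ (h j) m) m
    refine ⟨hzero, (deformedDirac_X1_sq hnabla hL hact hμ hκ hh hc t hs m).trans ?_⟩
    simp only [hzero, smul_zero, Finset.sum_const_zero, sub_zero]
    rfl
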